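/- \textbf{Setting.} Let $\mathcal X_1,\mathcal X_2,\mathcal Y,\mathcal Z$ be finite sets and let $p(y,z\mid x_1,x_2)$ be a two-user discrete memoryless multiple access wiretap channel, with output $y$ at the legitimate receiver Bob and $z$ at the eavesdropper Eve. All logarithms are to base 2. For independent inputs $X_1\sim p_1$, $X_2\sim p_2$ let $Y,Z$ be the corresponding outputs. The channel is used in slots $k=1,2,\dots$ of $n$ channel uses each. In slot $k$ user $i\in\{1,2\}$ has a message $\overline W^{(i)}_k$ that is a uniformly distributed bit string; all messages (of all slots and both users) are independent. $\overline Z_k$ and $\overline Y_k$ denote what Eve and Bob receive in slot $k$. \textbf{Slotted codes.} In a \emph{slotted code} the codeword of user $i$ in slot $k$ is chosen by a stochastic encoder from the user's messages of slots $1,\dots,k$ and its own codewords of slots $1,\dots,k-1$, and Bob decodes $(\overline W^{(1)}_k,\overline W^{(2)}_k)$ from $\overline Y_1,\dots,\overline Y_k$. \textbf{The scheme.} Each slot is split into $n_1$ and $n_2$ channel uses, $n_1+n_2=n$. User $i$ has basic messages of $a_i$ bits and sends $r^{(i)}_k+1$ of them in slot $k$. One of them is sent in the first part by a stochastic (wiretap)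 encoder $\{0,1\}^{a_i}\to\mathcal X_i^{n_1}$, the same in every slot. The other $r^{(i)}_k$ are sent in the second part: each is first XORed with one of the basic messages that the same user sent in slot $k-1$ (different messages with different keys), and the XORed messages are mapped to $\mathcal X_i^{n_2}$ by a deterministic encoder. In slot 1 the second part carries no message ($r^{(i)}_1=0$). \textbf{Secrecy-rate regions.} A pair $(R_1,R_2)$ with $R_1,R_2\ge 0$ is \emph{achievable} by a class of slotted codes if for every $\epsilon>0$ there are codes of the class, one for each slot length $n$, such that (i) for each $k$ the probability that Bob decodes $(\overline W^{(1)}_k,\overline W^{(2)}_k)$ incorrectly tends to $0$ as $n\to\infty$; (ii) for all large $n$, for all $k$ and all $l\le k$, $$I\big(\overline W^{(1)}_l,\overline W^{(2)}_l;\overline Z_1,\dots,\overline Z_k\big)\le n\epsilon ;$$ (iii) there is a slot $k_0$, independent of $n$, such that for all large $n$ and all $k\ge k_0$ the message of user $i$ in slot $k$ has at least $nR_i$ bits, $i=1,2$. The \emph{secrecy-rate region} of the class is the closure of the convex hull of the achievable pairs. \textbf{Theorem.} Assume that wiretap coding yields a positive secrecy rate for both users, in the sense that at least one of the following holds: (a)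 there are independent $X_1,X_2$ with $I(X_1;Y|X_2)>I(X_1;Z)$, $I(X_2;Y|X_1)>I(X_2;Z)$ and $I(X_1,X_2;Y)>I(X_1,X_2;Z)$; (b) there are $R_1,R_2>0$ and, for every block length $n$, single-block codes with stochastic encoders and independent uniform messages $W^{(1)},W^{(2)}$, which for all large $n$ have at least $nR_1$ and $nR_2$ bits, such that as $n\to\infty$ Bob's error probability tends to $0$ and $\frac1n I(W^{(1)},W^{(2)};Z^n)\to 0$. Then the secrecy-rate region of the scheme equals the capacity region of the multiple access channel without Eve, i.e. the closure of the convex hull of all pairs $(R_1,R_2)$, $R_1,R_2\ge0$, that satisfy $$R_1<I(X_1;Y|X_2),\qquad R_2<I(X_2;Y|X_1),\qquad R_1+R_2<I(X_1,X_2;Y)$$ for some independent $X_1,X_2$; and the secrecy-rate region of all slotted codes is the same region. -/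

import Mathlib

open Filter Topology

namespace MACWT

/-! ### Entropy and mutual information on a finite probability space (in bits)

`P : Ω → ℝ` is a probability mass function on the finite type `Ω`, random variables are functions
on `Ω`. -/

open Classical in
/-- The probability mass function of the random variable `f` under `P`. -/
noncomputable def law {Ω α : Type*} [Fintype Ω] (P : Ω → ℝ) (f : Ω → α) (a : α) : ℝ :=
  ∑ ω, if f ω = a then P ω else 0

/-- `H(f)`. -/
noncomputable def entropy {Ω α : Type*} [Fintype Ω] [Fintype α] (P : Ω → ℝ) (f : Ω → α) : ℝ :=
  (∑ a, Real.negMulLog (law P f a)) / Real.log 2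

/-- `I(f; g)`. -/
noncomputable def mutualInfo {Ω α β : Type*} [Fintype Ω] [Fintype α] [Fintype β]
    (P : Ω → ℝ) (f : Ω → α) (g : Ω → β) : ℝ :=
  entropy P f + entropy P g - entropy P (fun ω => (f ω, g ω))

/-- `I(f; g | h)`. -/
noncomputable def condMutualInfo {Ω α β γ : Type*} [Fintype Ω] [Fintype α] [Fintype β] [Fintype γ]
    (P : Ω → ℝ) (f : Ω → α) (g : Ω → β) (h : Ω → γ) : ℝ :=
  entropy P (fun ω => (f ω, h ω)) + entropy P (fun ω => (g ω, h ω))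
    - entropy P (fun ω => (f ω, g ω, h ω)) - entropy P h

/-! ### The channel -/

/-- A discrete memoryless multiple access wiretap channel: the transition probabilities
`p(y, z | x₁, x₂)`, with `y` the output at Bob and `z` the output at Eve. -/
structure Channel (X₁ X₂ Y Z : Type*) [Fintype Y] [Fintype Z] where
  prob : X₁ → X₂ → Y × Z → ℝ
  prob_mem : ∀ x₁ x₂, prob x₁ x₂ ∈ stdSimplex ℝ (Y × Z)

section SingleLetter

variable {X₁ X₂ Y Z : Type*} [Fintype X₁] [Fintype X₂] [Fintype Y] [Fintype Z]

/-- Memoryless use of the channel over a block of length `n`. -/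
def Channel.block (ch : Channel X₁ X₂ Y Z) {n : ℕ}
    (x₁ : Fin n → X₁) (x₂ : Fin n → X₂) (y : Fin n → Y) (z : Fin n → Z) : ℝ :=
  ∏ t, ch.prob (x₁ t) (x₂ t) (y t, z t)

/-- The joint law of `(X₁, X₂, Y, Z)` for independent inputs `X₁ ∼ p₁`, `X₂ ∼ p₂`. -/
def Channel.single (ch : Channel X₁ X₂ Y Z) (p₁ : X₁ → ℝ) (p₂ : X₂ → ℝ) :
    X₁ × X₂ × Y × Z → ℝ :=
  fun ω => p₁ ω.1 * p₂ ω.2.1 * ch.prob ω.1 ω.2.1 ω.2.2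

/-- `I(X₁; Y | X₂)`. -/
noncomputable def Channel.infoY₁ (ch : Channel X₁ X₂ Y Z) (p₁ : X₁ → ℝ) (p₂ : X₂ → ℝ) : ℝ :=
  condMutualInfo (ch.single p₁ p₂) (fun ω => ω.1) (fun ω => ω.2.2.1) (fun ω => ω.2.1)

/-- `I(X₂; Y | X₁)`. -/
noncomputable def Channel.infoY₂ (ch : Channel X₁ X₂ Y Z) (p₁ : X₁ → ℝ) (p₂ : X₂ → ℝ) : ℝ :=
  condMutualInfo (ch.single p₁ p₂) (fun ω => ω.2.1) (fun ω => ω.2.2.1) (fun ω => ω.1)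

/-- `I(X₁, X₂; Y)`. -/
noncomputable def Channel.infoY (ch : Channel X₁ X₂ Y Z) (p₁ : X₁ → ℝ) (p₂ : X₂ → ℝ) : ℝ :=
  mutualInfo (ch.single p₁ p₂) (fun ω => (ω.1, ω.2.1)) (fun ω => ω.2.2.1)

/-- `I(X₁; Z)`. -/
noncomputable def Channel.infoZ₁ (ch : Channel X₁ X₂ Y Z) (p₁ : X₁ → ℝ) (p₂ : X₂ → ℝ) : ℝ :=
  mutualInfo (ch.single p₁ p₂) (fun ω => ω.1) (fun ω => ω.2.2.2)

/-- `I(X₂; Z)`. -/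
noncomputable def Channel.infoZ₂ (ch : Channel X₁ X₂ Y Z) (p₁ : X₁ → ℝ) (p₂ : X₂ → ℝ) : ℝ :=
  mutualInfo (ch.single p₁ p₂) (fun ω => ω.2.1) (fun ω => ω.2.2.2)

/-- `I(X₁, X₂; Z)`. -/
noncomputable def Channel.infoZ (ch : Channel X₁ X₂ Y Z) (p₁ : X₁ → ℝ) (p₂ : X₂ → ℝ) : ℝ :=
  mutualInfo (ch.single p₁ p₂) (fun ω => (ω.1, ω.2.1)) (fun ω => ω.2.2.2)

/-- The capacity region of the MAC without Eve: the closure of the convex hull of all rate pairs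
that satisfy the three strict inequalities for some independent inputs. -/
def Channel.macRegion (ch : Channel X₁ X₂ Y Z) : Set (ℝ × ℝ) :=
  closure (convexHull ℝ {R : ℝ × ℝ | 0 ≤ R.1 ∧ 0 ≤ R.2 ∧
    ∃ p₁ ∈ stdSimplex ℝ X₁, ∃ p₂ ∈ stdSimplex ℝ X₂,
      R.1 < ch.infoY₁ p₁ p₂ ∧ R.2 < ch.infoY₂ p₁ p₂ ∧ R.1 + R.2 < ch.infoY p₁ p₂})

/-- For some independent inputs the single-letter wiretap region
`R₁ < I(X₁;Y|X₂) - I(X₁;Z)`, `R₂ < I(X₂;Y|X₁) - I(X₂;Z)`, `R₁ + R₂ < I(X₁,X₂;Y) - I(X₁,X₂;Z)`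
contains a pair of positive rates. -/
def Channel.PositiveSingleLetter (ch : Channel X₁ X₂ Y Z) : Prop :=
  ∃ p₁ ∈ stdSimplex ℝ X₁, ∃ p₂ ∈ stdSimplex ℝ X₂,
    ch.infoZ₁ p₁ p₂ < ch.infoY₁ p₁ p₂ ∧ ch.infoZ₂ p₁ p₂ < ch.infoY₂ p₁ p₂ ∧
      ch.infoZ p₁ p₂ < ch.infoY p₁ p₂

end SingleLetter

/-- Strings of `m` bits; addition is the bitwise XOR. -/
abbrev Bits (m : ℕ) : Type := Fin m → ZMod 2

/-! ### Wiretap codes for a single block -/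

/-- A block code of length `n` with `b₁` and `b₂` message bits for the two users, stochastic
encoders, and a decoder at Bob. -/
structure WiretapCode (X₁ X₂ Y : Type*) [Fintype X₁] [Fintype X₂] (n b₁ b₂ : ℕ) where
  enc₁ : Bits b₁ → (Fin n → X₁) → ℝ
  enc₁_mem : ∀ w, enc₁ w ∈ stdSimplex ℝ (Fin n → X₁)
  enc₂ : Bits b₂ → (Fin n → X₂) → ℝ
  enc₂_mem : ∀ w, enc₂ w ∈ stdSimplex ℝ (Fin n → X₂)
  dec : (Fin n → Y) → Bits b₁ × Bits b₂

section Wiretap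

variable {X₁ X₂ Y Z : Type*} [Fintype X₁] [Fintype X₂] [Fintype Y] [Fintype Z] {n b₁ b₂ : ℕ}

/-- The joint law of messages, codewords and outputs `((w₁, w₂), (x₁, x₂), y, z)`; the messages are
uniform and independent. -/
noncomputable def WiretapCode.joint (C : WiretapCode X₁ X₂ Y n b₁ b₂) (ch : Channel X₁ X₂ Y Z) :
    (Bits b₁ × Bits b₂) × ((Fin n → X₁) × (Fin n → X₂)) × (Fin n → Y) × (Fin n → Z) → ℝ :=
  fun ω => (Fintype.card (Bits b₁ × Bits b₂) : ℝ)⁻¹ *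
    (C.enc₁ ω.1.1 ω.2.1.1 * C.enc₂ ω.1.2 ω.2.1.2) *
    ch.block ω.2.1.1 ω.2.1.2 ω.2.2.1 ω.2.2.2

open Classical in
/-- The average probability of error at Bob. -/
noncomputable def WiretapCode.errorProb (C : WiretapCode X₁ X₂ Y n b₁ b₂)
    (ch : Channel X₁ X₂ Y Z) : ℝ :=
  ∑ ω, if C.dec ω.2.2.1 ≠ ω.1 then C.joint ch ω else 0

/-- The collective leakage `I(W₁, W₂; Zⁿ)`. -/
noncomputable def WiretapCode.leakage (C : WiretapCode X₁ X₂ Y n b₁ b₂)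
    (ch : Channel X₁ X₂ Y Z) : ℝ :=
  mutualInfo (C.joint ch) (fun ω => ω.1) (fun ω => ω.2.2.2)

/-- Some pair of positive secrecy rates is achievable on the channel by block codes, with
vanishing error probability at Bob and vanishing collective leakage rate to Eve. -/
def Channel.PositiveSecrecy (ch : Channel X₁ X₂ Y Z) : Prop :=
  ∃ R₁ > (0 : ℝ), ∃ R₂ > (0 : ℝ), ∃ (b₁ b₂ : ℕ → ℕ)
    (C : ∀ n, WiretapCode X₁ X₂ Y n (b₁ n) (b₂ n)),
    (∀ᶠ n : ℕ in atTop, n * R₁ ≤ b₁ n ∧ n * R₂ ≤ b₂ n) ∧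
    Tendsto (fun n => (C n).errorProb ch) atTop (𝓝 0) ∧
    Tendsto (fun n : ℕ => (C n).leakage ch / n) atTop (𝓝 0)

end Wiretap

/-! ### Slotted codes

Slots are numbered `0, 1, 2, …`, each consists of `n` channel uses. In slot `k` a user has a message
from the finite set `M k`. -/

/-- A stochastic encoder for one user: the conditional law of the codeword of slot `k`, given the
user's messages of slots `0, …, k` and codewords of slots `0, …, k - 1`. -/
structure SlotEncoder (X : Type*) [Fintype X] (n : ℕ) (M : ℕ → Type) where
  enc : (k : ℕ) → ((j : Fin (k + 1)) → M j) → (Fin k → Fin n → X) → (Fin n → X) → ℝ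
  enc_mem : ∀ k w x, enc k w x ∈ stdSimplex ℝ (Fin n → X)

/-- The conditional probability of the codewords of the first `K` slots given the messages. -/
def SlotEncoder.prob {X : Type*} [Fintype X] {n : ℕ} {M : ℕ → Type} (E : SlotEncoder X n M)
    (K : ℕ) (w : (j : Fin K) → M j) (x : Fin K → Fin n → X) : ℝ :=
  ∏ j : Fin K, E.enc j (fun i => w ⟨i, by omega⟩) (fun i => x ⟨i, by omega⟩) (x j)

/-- A slotted code: encoders for the two users, and for each slot `k` a decoder with which Bob
decodes the messages of slot `k` from everything he received in slots `0, …, k`. -/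
structure SlottedCode (X₁ X₂ Y : Type*) [Fintype X₁] [Fintype X₂] (n : ℕ) (M₁ M₂ : ℕ → Type) where
  enc₁ : SlotEncoder X₁ n M₁
  enc₂ : SlotEncoder X₂ n M₂
  dec : (k : ℕ) → (Fin (k + 1) → Fin n → Y) → M₁ k × M₂ k

section Slotted

variable {X₁ X₂ Y Z : Type*} [Fintype X₁] [Fintype X₂] [Fintype Y] [Fintype Z] {n : ℕ}
  {M₁ M₂ : ℕ → Type} [∀ k, Fintype (M₁ k)] [∀ k, Fintype (M₂ k)]

/-- The joint law of messages, codewords and outputs `((w₁, w₂), (x₁, x₂), y, z)` in the first `K`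
slots. All messages are uniform and independent, the channel is memoryless. -/
noncomputable def SlottedCode.joint (C : SlottedCode X₁ X₂ Y n M₁ M₂) (ch : Channel X₁ X₂ Y Z)
    (K : ℕ) :
    (((j : Fin K) → M₁ j) × ((j : Fin K) → M₂ j)) ×
      ((Fin K → Fin n → X₁) × (Fin K → Fin n → X₂)) ×
      (Fin K → Fin n → Y) × (Fin K → Fin n → Z) → ℝ :=
  fun ω => (Fintype.card (((j : Fin K) → M₁ j) × ((j : Fin K) → M₂ j)) : ℝ)⁻¹ *
    (C.enc₁.prob K ω.1.1 ω.2.1.1 * C.enc₂.prob K ω.1.2 ω.2.1.2) *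
    ∏ j, ch.block (ω.2.1.1 j) (ω.2.1.2 j) (ω.2.2.1 j) (ω.2.2.2 j)

open Classical in
/-- The probability that Bob does not decode the message pair of slot `k` correctly. -/
noncomputable def SlottedCode.errorProb (C : SlottedCode X₁ X₂ Y n M₁ M₂)
    (ch : Channel X₁ X₂ Y Z) (k : ℕ) : ℝ :=
  ∑ ω, if C.dec k ω.2.2.1 ≠ (ω.1.1 (Fin.last k), ω.1.2 (Fin.last k))
    then C.joint ch (k + 1) ω else 0

/-- The leakage `I(W_l⁽¹⁾, W_l⁽²⁾; Z_0, …, Z_k)` of the messages of slot `l ≤ k`. -/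
noncomputable def SlottedCode.leakage (C : SlottedCode X₁ X₂ Y n M₁ M₂)
    (ch : Channel X₁ X₂ Y Z) (k : ℕ) (l : Fin (k + 1)) : ℝ :=
  mutualInfo (C.joint ch (k + 1)) (fun ω => (ω.1.1 l, ω.1.2 l)) (fun ω => ω.2.2.2)

/-- `(R₁, R₂)` is achievable by slotted codes: for every `ε > 0` there are slotted codes with slot
length `n = 0, 1, 2, …` such that in every slot the error probability tends to `0` as `n → ∞`, for
large `n` the messages of each slot `l` leak at most `n ε` to all outputs of Eve up to any slot
`k ≥ l`, and from some slot `k₀` on every slot carries at least `n R₁` and `n R₂` message bits. -/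
def Channel.Achievable (ch : Channel X₁ X₂ Y Z) (R : ℝ × ℝ) : Prop :=
  0 ≤ R.1 ∧ 0 ≤ R.2 ∧ ∀ ε > (0 : ℝ), ∃ (b₁ b₂ : ℕ → ℕ → ℕ)
    (C : ∀ n, SlottedCode X₁ X₂ Y n (fun k => Bits (b₁ n k)) (fun k => Bits (b₂ n k))),
    (∀ k, Tendsto (fun n => (C n).errorProb ch k) atTop (𝓝 0)) ∧
    (∀ᶠ n : ℕ in atTop, ∀ k, ∀ l : Fin (k + 1), (C n).leakage ch k l ≤ n * ε) ∧
    ∃ k₀ : ℕ, ∀ᶠ n : ℕ in atTop, ∀ k ≥ k₀, n * R.1 ≤ b₁ n k ∧ n * R.2 ≤ b₂ n k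

/-- The secrecy-rate region over all slotted codes. -/
def Channel.secrecyRegion (ch : Channel X₁ X₂ Y Z) : Set (ℝ × ℝ) :=
  closure (convexHull ℝ {R | ch.Achievable R})

end Slotted

/-! ### The scheme that uses previous messages as keys -/

/-- One user's part of the scheme, for slots that are split into `n₁` and `n₂` channel uses.
The basic messages have `a` bits. In slot `k` the user sends `r k + 1` basic messages:
message `0` in the first part, by the wiretap encoder `wiretapEnc` (stochastic, the same in all
slots), and messages `1, …, r k` in the second part, each XORed with a message of the preceding
slot as a key, by the deterministic encoder `plainEnc k`. The map `key k` selects the keys for slot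
`k + 1`; no message serves twice as a key in the same slot. In slot `0` there is no key, so nothing
is sent in the second part. -/
structure KeyEncoder (X : Type*) [Fintype X] (n₁ n₂ : ℕ) where
  a : ℕ
  r : ℕ → ℕ
  r_zero : r 0 = 0
  key : (k : ℕ) → Fin (r (k + 1)) ↪ Fin (r k + 1)
  wiretapEnc : Bits a → (Fin n₁ → X) → ℝ
  wiretapEnc_mem : ∀ w, wiretapEnc w ∈ stdSimplex ℝ (Fin n₁ → X)
  plainEnc : (k : ℕ) → (Fin (r k) → Bits a) → Fin n₂ → X

section Keys

variable {X : Type*} [Fintype X] {n₁ n₂ : ℕ}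

/-- The overall message of slot `k`. -/
abbrev KeyEncoder.Msg (E : KeyEncoder X n₁ n₂) (k : ℕ) : Type := Fin (E.r k + 1) → Bits E.a

/-- The number of message bits in slot `k`. -/
def KeyEncoder.bits (E : KeyEncoder X n₁ n₂) (k : ℕ) : ℕ := (E.r k + 1) * E.a

/-- The XORed messages for the second part of slot `k` (an empty family for `k = 0`). -/
def KeyEncoder.masked (E : KeyEncoder X n₁ n₂) :
    (k : ℕ) → ((j : Fin (k + 1)) → E.Msg j) → Fin (E.r k) → Bits E.a
  | 0, w, s => w (Fin.last 0) s.succ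
  | k + 1, w, s => w (Fin.last (k + 1)) s.succ + w ⟨k, by omega⟩ (E.key k s)

open Classical in
/-- The conditional law of the whole codeword of slot `k` given the messages. -/
noncomputable def KeyEncoder.enc (E : KeyEncoder X n₁ n₂) {n : ℕ} (h : n₁ + n₂ = n) (k : ℕ)
    (w : (j : Fin (k + 1)) → E.Msg j) (x : Fin n → X) : ℝ :=
  E.wiretapEnc (w (Fin.last k) 0) (fun t => x ⟨t, by omega⟩) *
    if (fun t : Fin n₂ => x ⟨n₁ + t, by omega⟩) = E.plainEnc k (E.masked k w) then 1 else 0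

theorem KeyEncoder.enc_mem (E : KeyEncoder X n₁ n₂) {n : ℕ} (h : n₁ + n₂ = n) (k : ℕ)
    (w : (j : Fin (k + 1)) → E.Msg j) : E.enc h k w ∈ stdSimplex ℝ (Fin n → X) := by
  classical
  subst h
  have hw := E.wiretapEnc_mem (w (Fin.last k) 0)
  refine ⟨fun x => mul_nonneg (hw.1 _) (by split_ifs <;> norm_num), ?_⟩
  rw [← (Fin.appendEquiv (α := X) n₁ n₂).sum_comp, Fintype.sum_prod_type]
  have hl : ∀ (u : Fin n₁ → X) (v : Fin n₂ → X),
      (fun t : Fin n₁ => Fin.append u v ⟨t, by omega⟩) = u := fun u v => by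
    funext t; exact Fin.append_left u v t
  have hr : ∀ (u : Fin n₁ → X) (v : Fin n₂ → X),
      (fun t : Fin n₂ => Fin.append u v ⟨n₁ + t, by omega⟩) = v := fun u v => by
    funext t; exact Fin.append_right u v t
  simp only [KeyEncoder.enc, Fin.appendEquiv, Equiv.coe_fn_mk, hl, hr]
  simpa using hw.2

/-- The scheme as an encoder for slots of length `n = n₁ + n₂`. -/
noncomputable def KeyEncoder.toSlotEncoder (E : KeyEncoder X n₁ n₂) {n : ℕ} (h : n₁ + n₂ = n) :
    SlotEncoder X n E.Msg where
  enc k w _ := E.enc h k w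
  enc_mem k w _ := E.enc_mem h k w

end Keys

/-- The scheme for both users together with Bob's decoders, for slots of length `n`. -/
structure KeyScheme (X₁ X₂ Y : Type*) [Fintype X₁] [Fintype X₂] (n : ℕ) where
  n₁ : ℕ
  n₂ : ℕ
  length_eq : n₁ + n₂ = n
  user₁ : KeyEncoder X₁ n₁ n₂
  user₂ : KeyEncoder X₂ n₁ n₂
  dec : (k : ℕ) → (Fin (k + 1) → Fin n → Y) → user₁.Msg k × user₂.Msg k

/-- The slotted code given by the scheme. -/
noncomputable def KeyScheme.code {X₁ X₂ Y : Type*} [Fintype X₁] [Fintype X₂] {n : ℕ}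
    (S : KeyScheme X₁ X₂ Y n) : SlottedCode X₁ X₂ Y n S.user₁.Msg S.user₂.Msg where
  enc₁ := S.user₁.toSlotEncoder S.length_eq
  enc₂ := S.user₂.toSlotEncoder S.length_eq
  dec := S.dec

section KeyRegion

variable {X₁ X₂ Y Z : Type*} [Fintype X₁] [Fintype X₂] [Fintype Y] [Fintype Z]

/-- `(R₁, R₂)` is achievable by the scheme: as `Channel.Achievable`, but with the slotted codes
given by the scheme. -/
def Channel.AchievableByKeys (ch : Channel X₁ X₂ Y Z) (R : ℝ × ℝ) : Prop :=
  0 ≤ R.1 ∧ 0 ≤ R.2 ∧ ∀ ε > (0 : ℝ), ∃ S : ∀ n, KeyScheme X₁ X₂ Y n,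
    (∀ k, Tendsto (fun n => (S n).code.errorProb ch k) atTop (𝓝 0)) ∧
    (∀ᶠ n : ℕ in atTop, ∀ k, ∀ l : Fin (k + 1), (S n).code.leakage ch k l ≤ n * ε) ∧
    ∃ k₀ : ℕ, ∀ᶠ n : ℕ in atTop, ∀ k ≥ k₀,
      n * R.1 ≤ (S n).user₁.bits k ∧ n * R.2 ≤ (S n).user₂.bits k

/-- The secrecy-rate region of the scheme. -/
def Channel.keyRegion (ch : Channel X₁ X₂ Y Z) : Set (ℝ × ℝ) :=
  closure (convexHull ℝ {R | ch.AchievableByKeys R})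

end KeyRegion

end MACWT

/-!
The three regions are compared in a circle: capacity region of the multiple access channel ⊆ region of
the scheme ⊆ region of all slotted codes ⊆ capacity region.

*From the capacity region to the scheme* (`Channel.PositiveSecrecy.achievableByKeys`). A small fixed
fraction of each slot is left to a wiretap code; as its rate is positive, a bounded number of further
messages of the same length fills the rest of the slot, which is used with a code for the multiple
access channel without secrecy (`Channel.exists_macCodes`). Message `s + 1` of a slot is masked by
message `s` of the preceding slot (`sent`), so that unmasking a message leads back along a chain of
keys to a message that was sent by the wiretap code (`extend_eq_offset_add`). What is transmitted is
again uniform and independent, hence independent over all blocks (`shiftCode_joint`). Bob errs only if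
he errs in one of finitely many blocks (`shiftCode_errorProb_le`). The messages of slot `l` are the
roots of their chains plus a function of the masked messages. Even if Eve is given all masked messages
she learns no more about the messages of slot `l` than about these uniformly distributed roots
(`mutualInfo_mask_le`). The roots lie in a bounded number of slots, and each slot contributes the
leakage of one wiretap block (`shiftCode_leakage_le`).

*Wiretap codes.* The single-letter condition provides such codes by random coding. Codewords are
indexed by a message and by local randomness, all are decoded by Bob, and the local randomness makes the
output at Eve nearly independent of the message. The error probability is bounded by a threshold
decoder (`codeMean_macError_le`), the leakage by the mean relative entropy of the output law of a random
codebook (`codeMean_outputDivergence_le`), and both bounds vanish by exponential moments of the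
log-likelihood ratios (`exists_tendsto_iidLaw_bound`).

*From the scheme to slotted codes.* Several bit strings are one long bit string
(`SlottedCode.relabel`).

*The converse* (`Channel.Achievable.mem_macRegion`). Given the past, the last slot is a block code with
stochastic encoders. Some fixed past and some deterministic encoders do no worse
(`SlottedCode.exists_macError_le`), and then Bob's error probability alone bounds the rates by the
averages of the single-letter quantities over the positions of the block (`converse_bound`). Such
averages lie in the region (`Channel.mem_macRegion_of_le_average`). That region is defined by strict
inequalities, so the positivity of both conditional informations for some inputs, which positive
secrecy rates imply, is needed for boundary points (`Channel.mem_macRegion_of_le`).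
-/

set_option linter.unusedSectionVars false

namespace MACWT

/-! ### Laws, entropy and mutual information -/

section Toolbox

variable {Ω Ω' α β γ : Type*} [Fintype Ω] [Fintype Ω']

theorem law_nonneg {P : Ω → ℝ} (hP : ∀ ω, 0 ≤ P ω) (f : Ω → α) (a : α) : 0 ≤ law P f a :=
  Finset.sum_nonneg fun ω _ => by split_ifs <;> simp [hP]

theorem law_congr {P : Ω → ℝ} {f : Ω → α} {g : Ω → β} {a : α} {b : β}
    (h : ∀ ω, f ω = a ↔ g ω = b) : law P f a = law P g b := by
  classical
  refine Finset.sum_congr rfl fun ω _ => ?_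
  by_cases hω : g ω = b
  · rw [if_pos hω, if_pos ((h ω).2 hω)]
  · rw [if_neg hω, if_neg (mt (h ω).1 hω)]

theorem le_law {P : Ω → ℝ} (hP : ∀ ω, 0 ≤ P ω) (f : Ω → α) (ω : Ω) : P ω ≤ law P f (f ω) := by
  classical
  unfold law
  refine le_trans (by simp) (Finset.single_le_sum (f := fun ω' => if f ω' = f ω then P ω' else 0)
    (fun ω' _ => by split_ifs <;> simp [hP]) (Finset.mem_univ ω))

theorem law_pos {P : Ω → ℝ} (hP : ∀ ω, 0 ≤ P ω) (f : Ω → α) {ω : Ω} (h : P ω ≠ 0) :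
    0 < law P f (f ω) :=
  ((hP ω).lt_of_ne' h).trans_le (le_law hP f ω)

theorem sum_law_mul [Fintype α] (P : Ω → ℝ) (f : Ω → α) (φ : α → ℝ) :
    ∑ a, law P f a * φ a = ∑ ω, P ω * φ (f ω) := by
  classical
  simp only [law, Finset.sum_mul]
  rw [Finset.sum_comm]
  refine Finset.sum_congr rfl fun ω _ => ?_
  simp [ite_mul]

theorem sum_law [Fintype α] (P : Ω → ℝ) (f : Ω → α) : ∑ a, law P f a = ∑ ω, P ω := by
  simpa using sum_law_mul P f fun _ => 1

theorem sum_law_pair_left [Fintype α] (P : Ω → ℝ) (f : Ω → α) (g : Ω → β) (b : β) :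
    ∑ a, law P (fun ω => (f ω, g ω)) (a, b) = law P g b := by
  classical
  simp only [law, Prod.mk.injEq]
  rw [Finset.sum_comm]
  refine Finset.sum_congr rfl fun ω _ => ?_
  by_cases h : g ω = b <;> simp [h]

theorem entropy_mul_log [Fintype α] (P : Ω → ℝ) (f : Ω → α) :
    entropy P f * Real.log 2 = -∑ ω, P ω * Real.log (law P f (f ω)) := by
  have h2 : Real.log 2 ≠ 0 := (Real.log_pos one_lt_two).ne'
  rw [entropy, div_mul_cancel₀ _ h2, ← sum_law_mul P f fun a => Real.log (law P f a),
    ← Finset.sum_neg_distrib]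
  exact Finset.sum_congr rfl fun a _ => by rw [Real.negMulLog]; ring

theorem mutualInfo_mul_log [Fintype α] [Fintype β] (P : Ω → ℝ) (f : Ω → α) (g : Ω → β) :
    mutualInfo P f g * Real.log 2 = ∑ ω, P ω * (Real.log (law P (fun ω => (f ω, g ω)) (f ω, g ω))
      - Real.log (law P f (f ω)) - Real.log (law P g (g ω))) := by
  rw [mutualInfo, sub_mul, add_mul, entropy_mul_log, entropy_mul_log, entropy_mul_log]
  simp only [mul_sub, Finset.sum_sub_distrib]
  ring

theorem entropy_comp_injective [Fintype α] [Fintype β] (P : Ω → ℝ) (f : Ω → α) {φ : α → β}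
    (hφ : Function.Injective φ) : entropy P (fun ω => φ (f ω)) = entropy P f := by
  have h2 := (Real.log_pos one_lt_two).ne'
  refine mul_right_cancel₀ h2 ?_
  rw [entropy_mul_log, entropy_mul_log]
  have h : ∀ ω, law P (fun ω => φ (f ω)) (φ (f ω)) = law P f (f ω) := fun ω =>
    law_congr fun _ => hφ.eq_iff
  simp only [h]

theorem mutualInfo_comm [Fintype α] [Fintype β] (P : Ω → ℝ) (f : Ω → α) (g : Ω → β) :
    mutualInfo P f g = mutualInfo P g f := by
  have := entropy_comp_injective P (fun ω => (f ω, g ω)) (φ := Prod.swap) Prod.swap_injective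
  simp only [Prod.swap] at this
  rw [mutualInfo, mutualInfo, this]
  ring

theorem mutualInfo_comp_injective [Fintype α] [Fintype β] {α' β' : Type*} [Fintype α'] [Fintype β']
    (P : Ω → ℝ) (f : Ω → α) (g : Ω → β) {φ : α → α'} {ψ : β → β'} (hφ : Function.Injective φ)
    (hψ : Function.Injective ψ) :
    mutualInfo P (fun ω => φ (f ω)) (fun ω => ψ (g ω)) = mutualInfo P f g := by
  have := entropy_comp_injective P (fun ω => (f ω, g ω)) (hφ.prodMap hψ)
  simp only [Prod.map] at this
  rw [mutualInfo, mutualInfo, this, entropy_comp_injective P f hφ, entropy_comp_injective P g hψ]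

/-- Gibbs' inequality, for a comparison of `P` with `P * r`. -/
theorem sum_mul_log_le {P r : Ω → ℝ} (hP : ∀ ω, 0 ≤ P ω) (hr : ∀ ω, P ω ≠ 0 → 0 < r ω)
    (h : ∑ ω, P ω * r ω ≤ ∑ ω, P ω) : ∑ ω, P ω * Real.log (r ω) ≤ 0 := by
  have : ∑ ω, P ω * Real.log (r ω) ≤ ∑ ω, (P ω * r ω - P ω) := by
    refine Finset.sum_le_sum fun ω _ => ?_
    by_cases h0 : P ω = 0
    · simp [h0]
    · have := mul_le_mul_of_nonneg_left (Real.log_le_sub_one_of_pos (hr ω h0)) (hP ω)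
      linarith
  rw [Finset.sum_sub_distrib] at this
  linarith

/-- Data processing for a deterministic map. -/
theorem mutualInfo_comp_right_le [Fintype α] [Fintype β] [Fintype γ] {P : Ω → ℝ}
    (hP : ∀ ω, 0 ≤ P ω) (f : Ω → α) (g : Ω → β) (φ : β → γ) :
    mutualInfo P f (fun ω => φ (g ω)) ≤ mutualInfo P f g := by
  classical
  have h2 := Real.log_pos one_lt_two
  refine le_of_mul_le_mul_right ?_ h2
  rw [mutualInfo_mul_log, mutualInfo_mul_log, ← sub_nonpos, ← Finset.sum_sub_distrib]
  set A := law P (fun ω => (f ω, g ω)) with hA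
  set B := law P g with hB
  set C := law P (fun ω => (f ω, φ (g ω))) with hC
  set D := law P (fun ω => φ (g ω)) with hD
  let s : α × β → ℝ := fun x => B x.2 * C (x.1, φ x.2) / (A x * D (φ x.2))
  have key := sum_mul_log_le (P := P) (r := fun ω => s (f ω, g ω)) hP ?_ ?_
  · refine le_trans (le_of_eq (Finset.sum_congr rfl fun ω _ => ?_)) key
    by_cases h : P ω = 0
    · simp [h]
    have hA' : 0 < A (f ω, g ω) := law_pos hP (fun ω => (f ω, g ω)) h
    have hB' : 0 < B (g ω) := law_pos hP g h
    have hC' : 0 < C (f ω, φ (g ω)) := law_pos hP (fun ω => (f ω, φ (g ω))) h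
    have hD' : 0 < D (φ (g ω)) := law_pos hP (fun ω => φ (g ω)) h
    simp only [s]
    rw [Real.log_div (by positivity) (by positivity), Real.log_mul hB'.ne' hC'.ne',
      Real.log_mul hA'.ne' hD'.ne']
    ring
  · intro ω h
    have hA' : 0 < A (f ω, g ω) := law_pos hP (fun ω => (f ω, g ω)) h
    have hB' : 0 < B (g ω) := law_pos hP g h
    have hC' : 0 < C (f ω, φ (g ω)) := law_pos hP (fun ω => (f ω, φ (g ω))) h
    have hD' : 0 < D (φ (g ω)) := law_pos hP (fun ω => φ (g ω)) h
    simp only [s]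
    positivity
  · rw [← sum_law_mul P (fun ω => (f ω, g ω)) s, ← sum_law P g, Fintype.sum_prod_type_right]
    refine Finset.sum_le_sum fun b _ => ?_
    have hA0 : ∀ x, 0 ≤ A x := law_nonneg hP _
    have hB0 : ∀ x, 0 ≤ B x := law_nonneg hP _
    have hC0 : ∀ x, 0 ≤ C x := law_nonneg hP _
    have hD0 : ∀ x, 0 ≤ D x := law_nonneg hP _
    calc ∑ a, A (a, b) * s (a, b) ≤ ∑ a, C (a, φ b) * (B b / D (φ b)) := by
          refine Finset.sum_le_sum fun a _ => ?_
          simp only [s]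
          rcases (hA0 (a, b)).eq_or_lt with h | h
          · rw [← h, zero_mul]
            exact mul_nonneg (hC0 _) (div_nonneg (hB0 _) (hD0 _))
          · rw [← mul_div_assoc, mul_div_mul_left _ _ h.ne']
            exact le_of_eq (by ring)
      _ = D (φ b) * (B b / D (φ b)) := by rw [← Finset.sum_mul, sum_law_pair_left]
      _ ≤ B b := mul_div_le_of_le (hB0 b) (hD0 _)
where
  mul_div_le_of_le {x y : ℝ} (hx : 0 ≤ x) (hy : 0 ≤ y) : y * (x / y) ≤ x := by
    rcases hy.eq_or_lt with h | h
    · simpa [← h] using hx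
    · rw [mul_div_cancel₀ _ h.ne']

theorem mutualInfo_comp_left_le [Fintype α] [Fintype β] [Fintype γ] {P : Ω → ℝ}
    (hP : ∀ ω, 0 ≤ P ω) (f : Ω → α) (g : Ω → β) (φ : α → γ) :
    mutualInfo P (fun ω => φ (f ω)) g ≤ mutualInfo P f g := by
  rw [mutualInfo_comm, mutualInfo_comm P f]
  exact mutualInfo_comp_right_le hP g f φ

theorem mutualInfo_const_right [Fintype α] [Fintype β] {P : Ω → ℝ} (hs : ∑ ω, P ω = 1)
    (f : Ω → α) (b : β) : mutualInfo P f (fun _ => b) = 0 := by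
  have h := entropy_comp_injective P f (φ := fun a => (a, b)) fun _ _ h => (Prod.mk.inj h).1
  have h0 : entropy P (fun _ => b) = 0 := by
    have h2 := (Real.log_pos one_lt_two).ne'
    refine mul_right_cancel₀ h2 ?_
    rw [entropy_mul_log]
    simp [law, hs]
  rw [mutualInfo, h, h0]; ring

theorem mutualInfo_nonneg [Fintype α] [Fintype β] {P : Ω → ℝ} (hP : P ∈ stdSimplex ℝ Ω)
    (f : Ω → α) (g : Ω → β) : 0 ≤ mutualInfo P f g :=
  (mutualInfo_const_right hP.2 f ()).symm.le.trans (mutualInfo_comp_right_le hP.1 f g fun _ => ())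

theorem entropy_le_log_card [Fintype α] {P : Ω → ℝ} (hP : P ∈ stdSimplex ℝ Ω) (f : Ω → α) :
    entropy P f * Real.log 2 ≤ Real.log (Fintype.card α) := by
  have hne : Nonempty Ω := by
    by_contra h
    rw [not_nonempty_iff] at h
    simpa using hP.2
  have hc : (0 : ℝ) < Fintype.card α := by
    have : Nonempty α := hne.map f
    exact_mod_cast Fintype.card_pos
  have key := sum_mul_log_le (P := P)
    (r := fun ω => (fun a => (Fintype.card α : ℝ)⁻¹ * (law P f a)⁻¹) (f ω)) hP.1
    (fun ω h => by have := law_pos hP.1 f h; positivity) ?_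
  · have h : ∑ ω, P ω * Real.log ((Fintype.card α : ℝ)⁻¹ * (law P f (f ω))⁻¹) =
        ∑ ω, (-(P ω * Real.log (law P f (f ω))) - P ω * Real.log (Fintype.card α)) := by
      refine Finset.sum_congr rfl fun ω _ => ?_
      by_cases h : P ω = 0
      · simp [h]
      · rw [Real.log_mul (by positivity) (inv_ne_zero (law_pos hP.1 f h).ne'), Real.log_inv,
          Real.log_inv]
        ring
    simp only [] at key
    rw [h, Finset.sum_sub_distrib, Finset.sum_neg_distrib, ← entropy_mul_log, ← Finset.sum_mul,
      hP.2, one_mul] at key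
    linarith
  · rw [← sum_law_mul P f fun a => (Fintype.card α : ℝ)⁻¹ * (law P f a)⁻¹, hP.2]
    calc ∑ a, law P f a * ((Fintype.card α : ℝ)⁻¹ * (law P f a)⁻¹)
        ≤ ∑ _a : α, (Fintype.card α : ℝ)⁻¹ := by
          refine Finset.sum_le_sum fun a _ => ?_
          by_cases h : law P f a = 0
          · rw [h, zero_mul]; positivity
          · exact le_of_eq (by field_simp)
      _ = 1 := by rw [Finset.sum_const, Finset.card_univ, nsmul_eq_mul, mul_inv_cancel₀ hc.ne']

theorem entropy_of_law_uniform [Fintype α] {P : Ω → ℝ} (hP : P ∈ stdSimplex ℝ Ω) (f : Ω → α)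
    (h : ∀ a, law P f a = (Fintype.card α : ℝ)⁻¹) :
    entropy P f * Real.log 2 = Real.log (Fintype.card α) := by
  rw [entropy_mul_log]
  simp only [h]
  rw [← Finset.sum_mul, hP.2, Real.log_inv]
  ring

/-! ### Change of the probability space -/

theorem law_comp_equiv (P : Ω → ℝ) (e : Ω' ≃ Ω) (f : Ω → α) :
    law (fun ω => P (e ω)) (fun ω => f (e ω)) = law P f := by
  funext a
  exact e.sum_comp fun ω => @ite ℝ (f ω = a) (Classical.propDecidable _) (P ω) 0

theorem mutualInfo_comp_equiv [Fintype α] [Fintype β] (P : Ω → ℝ) (e : Ω' ≃ Ω) (f : Ω → α)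
    (g : Ω → β) : mutualInfo (fun ω => P (e ω)) (fun ω => f (e ω)) (fun ω => g (e ω)) =
      mutualInfo P f g := by
  simp only [mutualInfo, entropy, law_comp_equiv P e f, law_comp_equiv P e g,
    law_comp_equiv P e fun ω => (f ω, g ω)]

theorem law_comp_fst {P : Ω → ℝ} {Q : Ω' → ℝ} (hQ : ∑ ω, Q ω = 1) (f : Ω → α) (a : α) :
    law (fun ω : Ω × Ω' => P ω.1 * Q ω.2) (fun ω => f ω.1) a = law P f a := by
  classical
  simp only [law, Fintype.sum_prod_type]
  refine Finset.sum_congr rfl fun ω _ => ?_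
  split_ifs <;> simp [← Finset.mul_sum, hQ]

theorem law_prod (P : Ω → ℝ) (Q : Ω' → ℝ) (f : Ω → α) (g : Ω' → β) (c : α × β) :
    law (fun ω : Ω × Ω' => P ω.1 * Q ω.2) (fun ω => (f ω.1, g ω.2)) c =
      law P f c.1 * law Q g c.2 := by
  classical
  simp only [law, Fintype.sum_prod_type, Finset.sum_mul_sum, Prod.ext_iff]
  refine Finset.sum_congr rfl fun ω _ => Finset.sum_congr rfl fun ω' _ => ?_
  by_cases h : f ω = c.1 <;> by_cases h' : g ω' = c.2 <;> simp [h, h']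

theorem prod_mem_stdSimplex {P : Ω → ℝ} {Q : Ω' → ℝ} (hP : P ∈ stdSimplex ℝ Ω)
    (hQ : Q ∈ stdSimplex ℝ Ω') : (fun ω : Ω × Ω' => P ω.1 * Q ω.2) ∈ stdSimplex ℝ (Ω × Ω') := by
  refine ⟨fun ω => mul_nonneg (hP.1 _) (hQ.1 _), ?_⟩
  rw [Fintype.sum_prod_type]
  simp [← Finset.mul_sum, hP.2, hQ.2]

/-- An independent pair contributes nothing to the mutual information. -/
theorem mutualInfo_prod [Fintype α] [Fintype β] [Fintype γ] {P : Ω → ℝ} {Q : Ω' → ℝ}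
    (hP : P ∈ stdSimplex ℝ Ω) (hQ : Q ∈ stdSimplex ℝ Ω') (f : Ω → α) (g : Ω → β) (h : Ω' → γ) :
    mutualInfo (fun ω : Ω × Ω' => P ω.1 * Q ω.2) (fun ω => f ω.1) (fun ω => (g ω.1, h ω.2)) =
      mutualInfo P f g := by
  have h2 := (Real.log_pos one_lt_two).ne'
  refine mul_right_cancel₀ h2 ?_
  rw [mutualInfo_mul_log, mutualInfo_mul_log]
  have h3 : ∀ ω : Ω × Ω', law (fun ω : Ω × Ω' => P ω.1 * Q ω.2)
      (fun ω => (f ω.1, g ω.1, h ω.2)) (f ω.1, g ω.1, h ω.2) =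
      law P (fun ω => (f ω, g ω)) (f ω.1, g ω.1) * law Q h (h ω.2) := fun ω => by
    rw [← law_prod P Q (fun ω => (f ω, g ω)) h ((f ω.1, g ω.1), h ω.2)]
    exact law_congr fun _ => by simp only [Prod.mk.injEq, and_assoc]
  simp only [h3, law_comp_fst hQ.2, law_prod, Fintype.sum_prod_type]
  refine Finset.sum_congr rfl fun ω _ => ?_
  have h4 : ∀ ω', P ω * Q ω' * (Real.log (law P (fun ω => (f ω, g ω)) (f ω, g ω) * law Q h (h ω')) -
      Real.log (law P f (f ω)) - Real.log (law P g (g ω) * law Q h (h ω'))) =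
      P ω * (Real.log (law P (fun ω => (f ω, g ω)) (f ω, g ω)) -
      Real.log (law P f (f ω)) - Real.log (law P g (g ω))) * Q ω' := fun ω' => by
    by_cases h0 : P ω = 0
    · simp [h0]
    by_cases h0' : Q ω' = 0
    · simp [h0']
    rw [Real.log_mul (law_pos hP.1 (fun ω => (f ω, g ω)) h0).ne' (law_pos hQ.1 h h0').ne',
      Real.log_mul (law_pos hP.1 g h0).ne' (law_pos hQ.1 h h0').ne']
    ring
  simp only [h4]
  rw [← Finset.mul_sum, hQ.2, mul_one]

end Toolbox

/-! ### Product distributions -/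

section Pi

variable {ι : Type*} [Fintype ι] [DecidableEq ι] {Ω β γ : ι → Type*} [∀ i, Fintype (Ω i)]

theorem sum_pi_prod (F : ∀ i, Ω i → ℝ) : ∑ ω : (∀ i, Ω i), ∏ i, F i (ω i) = ∏ i, ∑ x, F i x := by
  exact (Fintype.prod_sum F).symm

theorem pi_mem_stdSimplex {J : ∀ i, Ω i → ℝ} (hJ : ∀ i, J i ∈ stdSimplex ℝ (Ω i)) :
    (fun ω : ∀ i, Ω i => ∏ i, J i (ω i)) ∈ stdSimplex ℝ (∀ i, Ω i) := by
  refine ⟨fun ω => Finset.prod_nonneg fun i _ => (hJ i).1 _, ?_⟩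
  rw [sum_pi_prod]
  exact Finset.prod_eq_one fun i _ => (hJ i).2

theorem law_pi (J : ∀ i, Ω i → ℝ) (f : ∀ i, Ω i → β i) (b : ∀ i, β i) :
    law (fun ω : ∀ i, Ω i => ∏ i, J i (ω i)) (fun ω i => f i (ω i)) b =
      ∏ i, law (J i) (f i) (b i) := by
  classical
  simp only [law]
  rw [← sum_pi_prod fun i (x : Ω i) => if f i x = b i then J i x else 0]
  refine Finset.sum_congr rfl fun ω _ => ?_
  rw [Finset.prod_ite_zero]
  by_cases h : ∀ i, f i (ω i) = b i
  · rw [if_pos (funext h), if_pos fun i _ => h i]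
  · rw [if_neg (mt funext_iff.1 h), if_neg (by simpa using h)]

theorem sum_pi_mul_eval {J : ∀ i, Ω i → ℝ} (hJ : ∀ i, J i ∈ stdSimplex ℝ (Ω i)) (i : ι)
    (φ : Ω i → ℝ) : ∑ ω : (∀ i, Ω i), (∏ i, J i (ω i)) * φ (ω i) = ∑ x, J i x * φ x := by
  have h : ∀ ω : (∀ i, Ω i), (∏ i, J i (ω i)) * φ (ω i) =
      ∏ j, (if h : i = j then J j (ω j) * φ (h ▸ ω j) else J j (ω j)) := fun ω => by
    rw [← Finset.mul_prod_erase _ _ (Finset.mem_univ i),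
      ← Finset.mul_prod_erase _ (fun j => if h : i = j then J j (ω j) * φ (h ▸ ω j) else J j (ω j))
        (Finset.mem_univ i)]
    simp only [↓reduceDIte]
    rw [mul_right_comm]
    congr 1
    refine Finset.prod_congr rfl fun j hj => ?_
    rw [dif_neg (Finset.ne_of_mem_erase hj).symm]
  simp only [h]
  rw [sum_pi_prod fun j (x : Ω j) => if h : i = j then J j x * φ (h ▸ x) else J j x,
    Finset.prod_eq_single i]
  · simp
  · intro j _ hj
    simp only [dif_neg hj.symm]
    exact (hJ j).2
  · simp

theorem sum_pi_mul_sum {J : ∀ i, Ω i → ℝ} (hJ : ∀ i, J i ∈ stdSimplex ℝ (Ω i))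
    (φ : ∀ i, Ω i → ℝ) : ∑ ω : (∀ i, Ω i), (∏ i, J i (ω i)) * ∑ i, φ i (ω i) =
      ∑ i, ∑ x, J i x * φ i x := by
  simp only [Finset.mul_sum]
  rw [Finset.sum_comm]
  exact Finset.sum_congr rfl fun i _ => sum_pi_mul_eval hJ i (φ i)

theorem entropy_pi [∀ i, Fintype (β i)] {J : ∀ i, Ω i → ℝ} (hJ : ∀ i, J i ∈ stdSimplex ℝ (Ω i))
    (f : ∀ i, Ω i → β i) {δ : Type*} [Fintype δ] (e : (∀ i, β i) → δ) (he : Function.Injective e) :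
    entropy (fun ω : ∀ i, Ω i => ∏ i, J i (ω i)) (fun ω => e fun i => f i (ω i)) =
      ∑ i, entropy (J i) (f i) := by
  have h2 := (Real.log_pos one_lt_two).ne'
  rw [entropy_comp_injective _ (fun (ω : ∀ i, Ω i) i => f i (ω i)) he]
  refine mul_right_cancel₀ h2 ?_
  rw [entropy_mul_log, Finset.sum_mul]
  simp only [entropy_mul_log, Finset.sum_neg_distrib]
  rw [← sum_pi_mul_sum hJ fun i x => Real.log (law (J i) (f i) (f i x))]
  congr 1
  refine Finset.sum_congr rfl fun ω _ => ?_
  by_cases h : ∏ i, J i (ω i) = 0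
  · simp [h]
  · rw [law_pi, Real.log_prod]
    intro i _
    exact (law_pos (hJ i).1 (f i) (Finset.prod_ne_zero_iff.1 h i (Finset.mem_univ i))).ne'

theorem mutualInfo_pi [∀ i, Fintype (β i)] [∀ i, Fintype (γ i)] {J : ∀ i, Ω i → ℝ}
    (hJ : ∀ i, J i ∈ stdSimplex ℝ (Ω i)) (f : ∀ i, Ω i → β i) (g : ∀ i, Ω i → γ i) :
    mutualInfo (fun ω : ∀ i, Ω i => ∏ i, J i (ω i)) (fun ω i => f i (ω i)) (fun ω i => g i (ω i)) =
      ∑ i, mutualInfo (J i) (f i) (g i) := by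
  simp only [mutualInfo, Finset.sum_sub_distrib, Finset.sum_add_distrib]
  rw [← entropy_pi hJ f id Function.injective_id, ← entropy_pi hJ g id Function.injective_id,
    ← entropy_pi hJ (fun i x => (f i x, g i x)) (fun p => (fun i => (p i).1, fun i => (p i).2))]
  · rfl
  · intro p q h
    funext i
    exact Prod.ext (congrFun (Prod.mk.inj h).1 i) (congrFun (Prod.mk.inj h).2 i)

end Pi

/-! ### Exponential moments -/

/-- A random variable with negative mean has an exponential moment below `1`, so that the
corresponding moment of a sum of independent copies decays exponentially. -/
theorem exists_sum_mul_exp_lt_one {Ω : Type*} [Fintype Ω] {P : Ω → ℝ} (hP : P ∈ stdSimplex ℝ Ω)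
    (g : Ω → ℝ) (hg : ∑ ω, P ω * g ω < 0) :
    ∃ s : ℝ, 0 < s ∧ s ≤ 1 ∧ ∑ ω, P ω * Real.exp (s * g ω) < 1 := by
  set μ := ∑ ω, P ω * g ω with hμ
  set B := 1 + ∑ ω, |g ω| with hB
  have hB1 : 1 ≤ B := by
    have : 0 ≤ ∑ ω, |g ω| := Finset.sum_nonneg fun _ _ => abs_nonneg _
    linarith
  have hgB : ∀ ω, |g ω| ≤ B := fun ω => by
    have := Finset.single_le_sum (f := fun ω => |g ω|) (fun _ _ => abs_nonneg _) (Finset.mem_univ ω)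
    linarith
  set s := min (1 / B) (-μ / (2 * B ^ 2)) with hs
  have hs0 : 0 < s := lt_min (by positivity) (div_pos (by linarith) (by positivity))
  have hsB : s * B ≤ 1 := by
    have := min_le_left (1 / B) (-μ / (2 * B ^ 2))
    rw [← hs, le_div_iff₀ (by positivity)] at this
    exact this
  have hs2 : s * (2 * B ^ 2) ≤ -μ := by
    have := min_le_right (1 / B) (-μ / (2 * B ^ 2))
    rwa [← hs, le_div_iff₀ (by positivity)] at this
  refine ⟨s, hs0, by nlinarith, ?_⟩
  have hle : ∀ ω, P ω * Real.exp (s * g ω) ≤ P ω + s * (P ω * g ω) + P ω * (s * B) ^ 2 := fun ω => by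
    have h1 : |s * g ω| ≤ s * B := by
      rw [abs_mul, abs_of_pos hs0]; exact mul_le_mul_of_nonneg_left (hgB ω) hs0.le
    have h2 := (abs_le.1 (Real.abs_exp_sub_one_sub_id_le (h1.trans hsB))).2
    have h3 : (s * g ω) ^ 2 ≤ (s * B) ^ 2 := by
      rw [← sq_abs]; exact pow_le_pow_left₀ (abs_nonneg _) h1 2
    have := mul_le_mul_of_nonneg_left (show Real.exp (s * g ω) ≤ 1 + s * g ω + (s * B) ^ 2 by
      linarith) (hP.1 ω)
    linarith
  calc ∑ ω, P ω * Real.exp (s * g ω)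
      ≤ ∑ ω, (P ω + s * (P ω * g ω) + P ω * (s * B) ^ 2) := Finset.sum_le_sum fun ω _ => hle ω
    _ = 1 + s * μ + (s * B) ^ 2 := by
        rw [Finset.sum_add_distrib, Finset.sum_add_distrib, ← Finset.mul_sum, ← Finset.sum_mul,
          hP.2, one_mul]
    _ < 1 := by nlinarith

/-! ### Information quantities of a channel with two inputs -/

section TwoInputs

variable {A B O : Type*} [Fintype A] [Fintype B] [Fintype O]

/-- The output law given the second input, when the first input has law `a`. -/
def avgLeft (W : A → B → O → ℝ) (a : A → ℝ) (v : B) (o : O) : ℝ := ∑ u, a u * W u v o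

/-- The output law given the first input, when the second input has law `b`. -/
def avgRight (W : A → B → O → ℝ) (b : B → ℝ) (u : A) (o : O) : ℝ := ∑ v, b v * W u v o

/-- The output law for independent inputs with laws `a` and `b`. -/
def avgBoth (W : A → B → O → ℝ) (a : A → ℝ) (b : B → ℝ) (o : O) : ℝ := ∑ u, a u * avgRight W b u o

/-- The joint law of independent inputs and the output. -/
def tripleLaw (W : A → B → O → ℝ) (a : A → ℝ) (b : B → ℝ) (ω : A × B × O) : ℝ :=
  a ω.1 * b ω.2.1 * W ω.1 ω.2.1 ω.2.2

/-- `I(U; O | V)` in nats. The difference of logarithms takes junk values only outside the support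
of the joint law. -/
noncomputable def condInfoLeft (W : A → B → O → ℝ) (a : A → ℝ) (b : B → ℝ) : ℝ :=
  ∑ ω, tripleLaw W a b ω * (Real.log (W ω.1 ω.2.1 ω.2.2) - Real.log (avgLeft W a ω.2.1 ω.2.2))

/-- `I(V; O | U)` in nats. -/
noncomputable def condInfoRight (W : A → B → O → ℝ) (a : A → ℝ) (b : B → ℝ) : ℝ :=
  ∑ ω, tripleLaw W a b ω * (Real.log (W ω.1 ω.2.1 ω.2.2) - Real.log (avgRight W b ω.1 ω.2.2))

/-- `I(U, V; O)` in nats. -/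
noncomputable def jointInfo (W : A → B → O → ℝ) (a : A → ℝ) (b : B → ℝ) : ℝ :=
  ∑ ω, tripleLaw W a b ω * (Real.log (W ω.1 ω.2.1 ω.2.2) - Real.log (avgBoth W a b ω.2.2))

/-- `I(U; O)` in nats. -/
noncomputable def leftInfo (W : A → B → O → ℝ) (a : A → ℝ) (b : B → ℝ) : ℝ :=
  ∑ ω, tripleLaw W a b ω * (Real.log (avgRight W b ω.1 ω.2.2) - Real.log (avgBoth W a b ω.2.2))

/-- `I(V; O)` in nats. -/
noncomputable def rightInfo (W : A → B → O → ℝ) (a : A → ℝ) (b : B → ℝ) : ℝ :=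
  ∑ ω, tripleLaw W a b ω * (Real.log (avgLeft W a ω.2.1 ω.2.2) - Real.log (avgBoth W a b ω.2.2))

variable {W : A → B → O → ℝ} {a : A → ℝ} {b : B → ℝ}

theorem avgBoth_eq : avgBoth W a b = fun o => ∑ v, b v * avgLeft W a v o := by
  funext o
  simp only [avgBoth, avgRight, avgLeft, Finset.mul_sum]
  rw [Finset.sum_comm]
  exact Finset.sum_congr rfl fun v _ => Finset.sum_congr rfl fun u _ => by ring

theorem avgLeft_mem (hW : ∀ u v, W u v ∈ stdSimplex ℝ O) (ha : a ∈ stdSimplex ℝ A) (v : B) :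
    avgLeft W a v ∈ stdSimplex ℝ O := by
  refine ⟨fun o => Finset.sum_nonneg fun u _ => mul_nonneg (ha.1 u) ((hW u v).1 o), ?_⟩
  simp only [avgLeft]
  rw [Finset.sum_comm]
  simp [← Finset.mul_sum, (hW _ v).2, ha.2]

theorem avgRight_mem (hW : ∀ u v, W u v ∈ stdSimplex ℝ O) (hb : b ∈ stdSimplex ℝ B) (u : A) :
    avgRight W b u ∈ stdSimplex ℝ O :=
  avgLeft_mem (W := fun v u => W u v) (fun v u => hW u v) hb u

theorem avgBoth_mem (hW : ∀ u v, W u v ∈ stdSimplex ℝ O) (ha : a ∈ stdSimplex ℝ A)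
    (hb : b ∈ stdSimplex ℝ B) : avgBoth W a b ∈ stdSimplex ℝ O := by
  refine ⟨fun o => Finset.sum_nonneg fun u _ => mul_nonneg (ha.1 u) ((avgRight_mem hW hb u).1 o), ?_⟩
  simp only [avgBoth]
  rw [Finset.sum_comm]
  simp [← Finset.mul_sum, (avgRight_mem hW hb _).2, ha.2]

theorem tripleLaw_mem (hW : ∀ u v, W u v ∈ stdSimplex ℝ O) (ha : a ∈ stdSimplex ℝ A)
    (hb : b ∈ stdSimplex ℝ B) : tripleLaw W a b ∈ stdSimplex ℝ (A × B × O) := by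
  refine ⟨fun ω => mul_nonneg (mul_nonneg (ha.1 _) (hb.1 _)) ((hW _ _).1 _), ?_⟩
  simp only [tripleLaw, Fintype.sum_prod_type]
  simp [← Finset.mul_sum, (hW _ _).2, ha.2, hb.2]

theorem tripleLaw_ne_zero {ω : A × B × O} (h : tripleLaw W a b ω ≠ 0) :
    a ω.1 ≠ 0 ∧ b ω.2.1 ≠ 0 ∧ W ω.1 ω.2.1 ω.2.2 ≠ 0 := by
  simpa [tripleLaw, and_assoc] using h

theorem le_avgLeft (hW : ∀ u v, W u v ∈ stdSimplex ℝ O) (ha : a ∈ stdSimplex ℝ A) (u : A) (v : B)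
    (o : O) : a u * W u v o ≤ avgLeft W a v o :=
  Finset.single_le_sum (f := fun u => a u * W u v o)
    (fun u _ => mul_nonneg (ha.1 u) ((hW u v).1 o)) (Finset.mem_univ u)

theorem avgLeft_pos (hW : ∀ u v, W u v ∈ stdSimplex ℝ O) (ha : a ∈ stdSimplex ℝ A) {u : A} {v : B}
    {o : O} (h : a u ≠ 0) (h' : W u v o ≠ 0) : 0 < avgLeft W a v o :=
  (mul_pos ((ha.1 u).lt_of_ne' h) (((hW u v).1 o).lt_of_ne' h')).trans_le (le_avgLeft hW ha u v o)

theorem avgRight_pos (hW : ∀ u v, W u v ∈ stdSimplex ℝ O) (hb : b ∈ stdSimplex ℝ B) {u : A} {v : B}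
    {o : O} (h : b v ≠ 0) (h' : W u v o ≠ 0) : 0 < avgRight W b u o :=
  avgLeft_pos (W := fun v u => W u v) (fun v u => hW u v) hb h h'

theorem le_avgBoth (hW : ∀ u v, W u v ∈ stdSimplex ℝ O) (ha : a ∈ stdSimplex ℝ A)
    (hb : b ∈ stdSimplex ℝ B) (u : A) (o : O) : a u * avgRight W b u o ≤ avgBoth W a b o :=
  Finset.single_le_sum (f := fun u => a u * avgRight W b u o)
    (fun u _ => mul_nonneg (ha.1 u) ((avgRight_mem hW hb u).1 o)) (Finset.mem_univ u)

theorem avgBoth_pos (hW : ∀ u v, W u v ∈ stdSimplex ℝ O) (ha : a ∈ stdSimplex ℝ A)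
    (hb : b ∈ stdSimplex ℝ B) {u : A} {v : B} {o : O} (h : a u ≠ 0) (h' : b v ≠ 0)
    (h'' : W u v o ≠ 0) : 0 < avgBoth W a b o :=
  (mul_pos ((ha.1 u).lt_of_ne' h) (avgRight_pos hW hb h' h'')).trans_le (le_avgBoth hW ha hb u o)

theorem sum_tripleLaw_comp_right (φ : B → O → ℝ) :
    ∑ ω, tripleLaw W a b ω * φ ω.2.1 ω.2.2 = ∑ v, ∑ o, b v * avgLeft W a v o * φ v o := by
  simp only [tripleLaw, avgLeft, Fintype.sum_prod_type, Finset.mul_sum, Finset.sum_mul]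
  rw [Finset.sum_comm]
  refine Finset.sum_congr rfl fun v _ => ?_
  rw [Finset.sum_comm]
  exact Finset.sum_congr rfl fun o _ => Finset.sum_congr rfl fun u _ => by ring

theorem sum_tripleLaw_swap (φ : A → B → O → ℝ) :
    ∑ ω, tripleLaw (fun v u => W u v) b a ω * φ ω.2.1 ω.1 ω.2.2 =
      ∑ ω, tripleLaw W a b ω * φ ω.1 ω.2.1 ω.2.2 := by
  simp only [tripleLaw, Fintype.sum_prod_type]
  rw [Finset.sum_comm]
  exact Finset.sum_congr rfl fun u _ => Finset.sum_congr rfl fun v _ =>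
    Finset.sum_congr rfl fun o _ => by ring

theorem avgBoth_swap : avgBoth (fun v u => W u v) b a = avgBoth W a b := by
  rw [avgBoth_eq (W := W)]; rfl

theorem condInfoLeft_swap : condInfoLeft (fun v u => W u v) b a = condInfoRight W a b :=
  sum_tripleLaw_swap fun u v o => Real.log (W u v o) - Real.log (avgRight W b u o)

theorem jointInfo_swap : jointInfo (fun v u => W u v) b a = jointInfo W a b := by
  rw [jointInfo, avgBoth_swap]
  exact sum_tripleLaw_swap fun u v o => Real.log (W u v o) - Real.log (avgBoth W a b o)

/-- Replacing the true conditional output law by another one only increases the mean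
log-likelihood ratio. -/
theorem condInfoLeft_le (hW : ∀ u v, W u v ∈ stdSimplex ℝ O) (ha : a ∈ stdSimplex ℝ A)
    (hb : b ∈ stdSimplex ℝ B) {q : B → O → ℝ} (hq : ∀ v, q v ∈ stdSimplex ℝ O)
    (hpos : ∀ ω, tripleLaw W a b ω ≠ 0 → q ω.2.1 ω.2.2 ≠ 0) :
    condInfoLeft W a b ≤
      ∑ ω, tripleLaw W a b ω * (Real.log (W ω.1 ω.2.1 ω.2.2) - Real.log (q ω.2.1 ω.2.2)) := by
  have hP := tripleLaw_mem hW ha hb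
  rw [condInfoLeft, ← sub_nonpos, ← Finset.sum_sub_distrib]
  have key := sum_mul_log_le (P := tripleLaw W a b)
    (r := fun ω => q ω.2.1 ω.2.2 / avgLeft W a ω.2.1 ω.2.2) hP.1 ?_ ?_
  · refine le_trans (le_of_eq (Finset.sum_congr rfl fun ω _ => ?_)) key
    by_cases h : tripleLaw W a b ω = 0
    · simp [h]
    obtain ⟨h1, h2, h3⟩ := tripleLaw_ne_zero h
    rw [Real.log_div (hpos ω h) (avgLeft_pos hW ha h1 h3).ne']
    ring
  · intro ω h
    obtain ⟨h1, h2, h3⟩ := tripleLaw_ne_zero h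
    exact div_pos (((hq _).1 _).lt_of_ne' (hpos ω h)) (avgLeft_pos hW ha h1 h3)
  · rw [sum_tripleLaw_comp_right fun v o => q v o / avgLeft W a v o, hP.2, ← hb.2]
    refine Finset.sum_le_sum fun v _ => ?_
    conv_rhs => rw [← mul_one (b v), ← (hq v).2, Finset.mul_sum]
    refine Finset.sum_le_sum fun o _ => ?_
    rw [mul_assoc]
    refine mul_le_mul_of_nonneg_left ?_ (hb.1 v)
    by_cases h : avgLeft W a v o = 0
    · rw [h, zero_mul]; exact (hq v).1 o
    · rw [mul_div_cancel₀ _ h]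

theorem condInfoLeft_le_jointInfo (hW : ∀ u v, W u v ∈ stdSimplex ℝ O) (ha : a ∈ stdSimplex ℝ A)
    (hb : b ∈ stdSimplex ℝ B) : condInfoLeft W a b ≤ jointInfo W a b :=
  condInfoLeft_le hW ha hb (q := fun _ => avgBoth W a b) (fun _ => avgBoth_mem hW ha hb)
    fun _ h => (avgBoth_pos hW ha hb (tripleLaw_ne_zero h).1 (tripleLaw_ne_zero h).2.1
      (tripleLaw_ne_zero h).2.2).ne'

theorem condInfoRight_le_jointInfo (hW : ∀ u v, W u v ∈ stdSimplex ℝ O) (ha : a ∈ stdSimplex ℝ A)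
    (hb : b ∈ stdSimplex ℝ B) : condInfoRight W a b ≤ jointInfo W a b := by
  rw [← condInfoLeft_swap, ← jointInfo_swap]
  exact condInfoLeft_le_jointInfo (fun v u => hW u v) hb ha

theorem jointInfo_le_add (hW : ∀ u v, W u v ∈ stdSimplex ℝ O) (ha : a ∈ stdSimplex ℝ A)
    (hb : b ∈ stdSimplex ℝ B) : jointInfo W a b ≤ condInfoLeft W a b + condInfoRight W a b := by
  have hP := tripleLaw_mem hW ha hb
  rw [condInfoLeft, condInfoRight, jointInfo, ← Finset.sum_add_distrib, ← sub_nonpos,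
    ← Finset.sum_sub_distrib]
  have key := sum_mul_log_le (P := tripleLaw W a b)
    (r := fun ω => avgLeft W a ω.2.1 ω.2.2 * avgRight W b ω.1 ω.2.2 /
      (W ω.1 ω.2.1 ω.2.2 * avgBoth W a b ω.2.2)) hP.1 ?_ ?_
  · refine le_trans (le_of_eq (Finset.sum_congr rfl fun ω _ => ?_)) key
    by_cases h : tripleLaw W a b ω = 0
    · simp [h]
    obtain ⟨h1, h2, h3⟩ := tripleLaw_ne_zero h
    have k1 := (avgLeft_pos hW ha h1 h3).ne'
    have k2 := (avgRight_pos hW hb h2 h3).ne'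
    have k3 := (avgBoth_pos hW ha hb h1 h2 h3).ne'
    rw [Real.log_div (mul_ne_zero k1 k2) (mul_ne_zero h3 k3), Real.log_mul k1 k2,
      Real.log_mul h3 k3]
    ring
  · intro ω h
    obtain ⟨h1, h2, h3⟩ := tripleLaw_ne_zero h
    exact div_pos (mul_pos (avgLeft_pos hW ha h1 h3) (avgRight_pos hW hb h2 h3))
      (mul_pos (((hW _ _).1 _).lt_of_ne' h3) (avgBoth_pos hW ha hb h1 h2 h3))
  · have hle : ∀ u v o, tripleLaw W a b (u, v, o) * (avgLeft W a v o * avgRight W b u o /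
        (W u v o * avgBoth W a b o)) ≤
        (avgBoth W a b o)⁻¹ * ((a u * avgRight W b u o) * (b v * avgLeft W a v o)) := fun u v o => by
      have n1 := (avgBoth_mem hW ha hb).1 o
      have n2 := (avgLeft_mem hW ha v).1 o
      have n3 := (avgRight_mem hW hb u).1 o
      have n4 := ha.1 u
      have n5 := hb.1 v
      by_cases h : W u v o = 0
      · simp only [tripleLaw, h, mul_zero, zero_mul]; positivity
      · refine le_of_eq ?_
        simp only [tripleLaw]
        rw [div_mul_eq_div_div, div_eq_inv_mul _ (avgBoth W a b o), mul_left_comm]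
        congr 1
        field_simp
    rw [hP.2]
    calc _ ≤ ∑ o, (avgBoth W a b o)⁻¹ *
          ((∑ u, a u * avgRight W b u o) * ∑ v, b v * avgLeft W a v o) := by
          simp only [Finset.sum_mul_sum]
          simp only [Finset.mul_sum]
          rw [Finset.sum_comm, Fintype.sum_prod_type]
          refine Finset.sum_le_sum fun u _ => ?_
          rw [Fintype.sum_prod_type, Finset.sum_comm]
          exact Finset.sum_le_sum fun o _ => Finset.sum_le_sum fun v _ => hle u v o
      _ ≤ ∑ o, avgBoth W a b o := by
          refine Finset.sum_le_sum fun o _ => ?_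
          rw [← congrFun (avgBoth_eq (W := W) (a := a) (b := b)) o, show
            ∑ u, a u * avgRight W b u o = avgBoth W a b o from rfl]
          by_cases h : avgBoth W a b o = 0
          · simp [h]
          · rw [inv_mul_cancel_left₀ h]
      _ = 1 := (avgBoth_mem hW ha hb).2

/-- Mixing other input laws in scales the conditional information down by at most the product of
the weights. -/
theorem mul_condInfoLeft_le (hW : ∀ u v, W u v ∈ stdSimplex ℝ O) (ha : a ∈ stdSimplex ℝ A)
    (hb : b ∈ stdSimplex ℝ B) {a' : A → ℝ} {b' : B → ℝ} (ha' : a' ∈ stdSimplex ℝ A)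
    {s t : ℝ} (hs : 0 < s) (ht : 0 < t) (hsa : ∀ u, s * a u ≤ a' u)
    (htb : ∀ v, t * b v ≤ b' v) : s * t * condInfoLeft W a b ≤ condInfoLeft W a' b' := by
  have hD : ∀ u v, a' u ≠ 0 →
      0 ≤ ∑ o, W u v o * (Real.log (W u v o) - Real.log (avgLeft W a' v o)) := fun u v hu => by
    have hl := avgLeft_mem hW ha' v
    have key := sum_mul_log_le (P := W u v) (r := fun o => avgLeft W a' v o / W u v o) (hW u v).1
      (fun o ho => div_pos (avgLeft_pos hW ha' hu ho) (((hW u v).1 o).lt_of_ne' ho)) ?_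
    · rw [← neg_nonpos, ← Finset.sum_neg_distrib]
      refine le_trans (le_of_eq (Finset.sum_congr rfl fun o _ => ?_)) key
      by_cases h : W u v o = 0
      · simp [h]
      · rw [Real.log_div (avgLeft_pos hW ha' hu h).ne' h]; ring
    · rw [(hW u v).2, ← hl.2]
      refine Finset.sum_le_sum fun o _ => ?_
      by_cases h : W u v o = 0
      · rw [h, zero_mul]; exact hl.1 o
      · rw [mul_div_cancel₀ _ h]
  have ha0 : ∀ u, a u ≠ 0 → a' u ≠ 0 := fun u hu =>
    ((mul_pos hs ((ha.1 u).lt_of_ne' hu)).trans_le (hsa u)).ne'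
  have h1 := condInfoLeft_le hW ha hb (q := avgLeft W a') (avgLeft_mem hW ha') fun ω h =>
    (avgLeft_pos hW ha' (ha0 _ (tripleLaw_ne_zero h).1) (tripleLaw_ne_zero h).2.2).ne'
  refine (mul_le_mul_of_nonneg_left h1 (mul_pos hs ht).le).trans ?_
  rw [condInfoLeft]
  simp only [Fintype.sum_prod_type, tripleLaw, mul_assoc, ← Finset.mul_sum]
  rw [← mul_assoc, Finset.mul_sum]
  refine Finset.sum_le_sum fun u _ => ?_
  rw [Finset.mul_sum, Finset.mul_sum, Finset.mul_sum]
  refine Finset.sum_le_sum fun v _ => ?_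
  by_cases hu : a' u = 0
  · have : a u = 0 := by
      by_contra h
      exact ha0 u h hu
    simp [hu, this]
  · have := mul_le_mul (hsa u) (htb v) (mul_nonneg ht.le (hb.1 v)) (ha'.1 u)
    have := mul_le_mul_of_nonneg_right this (hD u v hu)
    linarith

theorem mul_condInfoRight_le (hW : ∀ u v, W u v ∈ stdSimplex ℝ O) (ha : a ∈ stdSimplex ℝ A)
    (hb : b ∈ stdSimplex ℝ B) {a' : A → ℝ} {b' : B → ℝ} (hb' : b' ∈ stdSimplex ℝ B)
    {s t : ℝ} (hs : 0 < s) (ht : 0 < t) (hsa : ∀ u, s * a u ≤ a' u)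
    (htb : ∀ v, t * b v ≤ b' v) : s * t * condInfoRight W a b ≤ condInfoRight W a' b' := by
  rw [← condInfoLeft_swap, ← condInfoLeft_swap, mul_comm s t]
  exact mul_condInfoLeft_le (fun v u => hW u v) hb ha hb' ht hs htb hsa

theorem rightInfo_nonneg (hW : ∀ u v, W u v ∈ stdSimplex ℝ O) (ha : a ∈ stdSimplex ℝ A)
    (hb : b ∈ stdSimplex ℝ B) : 0 ≤ rightInfo W a b := by
  have := condInfoLeft_le_jointInfo hW ha hb
  have h : rightInfo W a b = jointInfo W a b - condInfoLeft W a b := by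
    rw [rightInfo, jointInfo, condInfoLeft, ← Finset.sum_sub_distrib]
    exact Finset.sum_congr rfl fun _ _ => by ring
  linarith

theorem leftInfo_nonneg (hW : ∀ u v, W u v ∈ stdSimplex ℝ O) (ha : a ∈ stdSimplex ℝ A)
    (hb : b ∈ stdSimplex ℝ B) : 0 ≤ leftInfo W a b := by
  have := condInfoRight_le_jointInfo hW ha hb
  have h : leftInfo W a b = jointInfo W a b - condInfoRight W a b := by
    rw [leftInfo, jointInfo, condInfoRight, ← Finset.sum_sub_distrib]
    exact Finset.sum_congr rfl fun _ _ => by ring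
  linarith

theorem leftInfo_add_rightInfo_le (hW : ∀ u v, W u v ∈ stdSimplex ℝ O) (ha : a ∈ stdSimplex ℝ A)
    (hb : b ∈ stdSimplex ℝ B) : leftInfo W a b + rightInfo W a b ≤ jointInfo W a b := by
  have := jointInfo_le_add hW ha hb
  have h : leftInfo W a b + rightInfo W a b =
      jointInfo W a b + (jointInfo W a b - condInfoLeft W a b - condInfoRight W a b) := by
    rw [leftInfo, rightInfo, jointInfo, condInfoRight, condInfoLeft, ← Finset.sum_sub_distrib,
      ← Finset.sum_sub_distrib, ← Finset.sum_add_distrib, ← Finset.sum_add_distrib]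
    exact Finset.sum_congr rfl fun _ _ => by ring
  linarith

end TwoInputs

/-! ### The single-letter quantities of the statement as mean log-likelihood ratios -/

section SingleLetterFormulas

variable {X₁ X₂ Y Z : Type*} [Fintype X₁] [Fintype X₂] [Fintype Y] [Fintype Z]

/-- The channel to Bob. -/
def Channel.bob (ch : Channel X₁ X₂ Y Z) (u : X₁) (v : X₂) (y : Y) : ℝ := ∑ z, ch.prob u v (y, z)

/-- The channel to Eve. -/
def Channel.eve (ch : Channel X₁ X₂ Y Z) (u : X₁) (v : X₂) (z : Z) : ℝ := ∑ y, ch.prob u v (y, z)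

variable (ch : Channel X₁ X₂ Y Z)

theorem Channel.bob_mem (u : X₁) (v : X₂) : ch.bob u v ∈ stdSimplex ℝ Y := by
  refine ⟨fun y => Finset.sum_nonneg fun z _ => (ch.prob_mem u v).1 _, ?_⟩
  rw [← (ch.prob_mem u v).2, Fintype.sum_prod_type]
  rfl

theorem Channel.eve_mem (u : X₁) (v : X₂) : ch.eve u v ∈ stdSimplex ℝ Z := by
  refine ⟨fun y => Finset.sum_nonneg fun z _ => (ch.prob_mem u v).1 _, ?_⟩
  rw [← (ch.prob_mem u v).2, Fintype.sum_prod_type_right]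
  rfl

variable {p₁ : X₁ → ℝ} {p₂ : X₂ → ℝ}

theorem Channel.sum_single_bob (φ : X₁ × X₂ × Y → ℝ) :
    ∑ ω, ch.single p₁ p₂ ω * φ (ω.1, ω.2.1, ω.2.2.1) = ∑ ω, tripleLaw ch.bob p₁ p₂ ω * φ ω := by
  simp only [Fintype.sum_prod_type, Channel.single, tripleLaw, Channel.bob, Finset.mul_sum,
    Finset.sum_mul]

theorem Channel.sum_single_eve (φ : X₁ × X₂ × Z → ℝ) :
    ∑ ω, ch.single p₁ p₂ ω * φ (ω.1, ω.2.1, ω.2.2.2) = ∑ ω, tripleLaw ch.eve p₁ p₂ ω * φ ω := by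
  simp only [Fintype.sum_prod_type, Channel.single, tripleLaw, Channel.eve, Finset.mul_sum,
    Finset.sum_mul]
  refine Finset.sum_congr rfl fun u _ => Finset.sum_congr rfl fun v _ => ?_
  rw [Finset.sum_comm]

theorem law_eq_sum {Ω α : Type*} [Fintype Ω] [DecidableEq α] (P : Ω → ℝ) (f : Ω → α) (a : α) :
    law P f a = ∑ ω, P ω * if f ω = a then 1 else 0 := by
  refine Finset.sum_congr rfl fun ω _ => ?_
  by_cases h : f ω = a <;> simp [h]

theorem Channel.law_single_bob {α : Type*} (f : X₁ × X₂ × Y → α) (c : α) :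
    law (ch.single p₁ p₂) (fun ω => f (ω.1, ω.2.1, ω.2.2.1)) c = law (tripleLaw ch.bob p₁ p₂) f c := by
  classical
  rw [law_eq_sum, law_eq_sum]
  exact ch.sum_single_bob fun ω => if f ω = c then 1 else 0

theorem Channel.law_single_eve {α : Type*} (f : X₁ × X₂ × Z → α) (c : α) :
    law (ch.single p₁ p₂) (fun ω => f (ω.1, ω.2.1, ω.2.2.2)) c = law (tripleLaw ch.eve p₁ p₂) f c := by
  classical
  rw [law_eq_sum, law_eq_sum]
  exact ch.sum_single_eve fun ω => if f ω = c then 1 else 0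

end SingleLetterFormulas

section TripleLaw

variable {A B O : Type*} [Fintype A] [Fintype B] [Fintype O] {W : A → B → O → ℝ} {a : A → ℝ}
  {b : B → ℝ}

theorem law_triple (u : A) (v : B) (o : O) :
    law (tripleLaw W a b) (fun ω => ω) (u, v, o) = a u * b v * W u v o := by
  classical
  rw [law_eq_sum]
  simp [tripleLaw]

theorem law_triple_inputs (hW : ∀ u v, W u v ∈ stdSimplex ℝ O) (u : A) (v : B) :
    law (tripleLaw W a b) (fun ω => (ω.1, ω.2.1)) (u, v) = a u * b v := by
  classical
  rw [law_eq_sum]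
  simp only [tripleLaw, Fintype.sum_prod_type, Prod.mk.injEq, ite_and, mul_ite, mul_one, mul_zero]
  simp [Finset.sum_ite_irrel, ← Finset.mul_sum, (hW _ _).2]

theorem law_triple_left (hW : ∀ u v, W u v ∈ stdSimplex ℝ O) (hb : b ∈ stdSimplex ℝ B) (u : A) :
    law (tripleLaw W a b) (fun ω => ω.1) u = a u := by
  classical
  rw [law_eq_sum]
  simp only [tripleLaw, Fintype.sum_prod_type, mul_ite, mul_one, mul_zero]
  simp [Finset.sum_ite_irrel, ← Finset.mul_sum, (hW _ _).2, hb.2]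

theorem law_triple_right (hW : ∀ u v, W u v ∈ stdSimplex ℝ O) (ha : a ∈ stdSimplex ℝ A) (v : B) :
    law (tripleLaw W a b) (fun ω => ω.2.1) v = b v := by
  classical
  rw [law_eq_sum]
  simp only [tripleLaw, Fintype.sum_prod_type, mul_ite, mul_one, mul_zero]
  simp [Finset.sum_ite_irrel, ← Finset.mul_sum, ← Finset.sum_mul, (hW _ _).2, ha.2]

theorem law_triple_right_out (v : B) (o : O) :
    law (tripleLaw W a b) (fun ω => (ω.2.2, ω.2.1)) (o, v) = b v * avgLeft W a v o := by
  classical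
  rw [law_eq_sum]
  simp only [tripleLaw, Fintype.sum_prod_type, Prod.mk.injEq, ite_and, mul_ite, mul_one, mul_zero,
    avgLeft, Finset.mul_sum]
  simp only [Finset.sum_ite_eq', Finset.mem_univ, if_true]
  exact Finset.sum_congr rfl fun u _ => by ring

theorem law_triple_left_out (u : A) (o : O) :
    law (tripleLaw W a b) (fun ω => (ω.1, ω.2.2)) (u, o) = a u * avgRight W b u o := by
  classical
  rw [law_eq_sum]
  simp only [tripleLaw, Fintype.sum_prod_type, Prod.mk.injEq, ite_and, mul_ite, mul_one, mul_zero,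
    avgRight, Finset.mul_sum]
  simp only [Finset.sum_ite_eq', Finset.mem_univ, if_true, Finset.sum_ite_irrel,
    Finset.sum_const_zero]
  exact Finset.sum_congr rfl fun u _ => by ring

theorem law_triple_out (o : O) :
    law (tripleLaw W a b) (fun ω => ω.2.2) o = avgBoth W a b o := by
  classical
  rw [law_eq_sum]
  simp only [tripleLaw, Fintype.sum_prod_type, mul_ite, mul_one, mul_zero,
    avgRight, avgBoth, Finset.mul_sum]
  simp only [Finset.sum_ite_eq', Finset.mem_univ, if_true]
  exact Finset.sum_congr rfl fun u _ => Finset.sum_congr rfl fun v _ => by ring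

end TripleLaw

section SingleLetterFormulas

variable {X₁ X₂ Y Z : Type*} [Fintype X₁] [Fintype X₂] [Fintype Y] [Fintype Z]
  (ch : Channel X₁ X₂ Y Z) {p₁ : X₁ → ℝ} {p₂ : X₂ → ℝ}

theorem condMutualInfo_mul_log {Ω α β γ : Type*} [Fintype Ω] [Fintype α] [Fintype β] [Fintype γ]
    (P : Ω → ℝ) (f : Ω → α) (g : Ω → β) (h : Ω → γ) :
    condMutualInfo P f g h * Real.log 2 = ∑ ω, P ω *
      (Real.log (law P (fun ω => (f ω, g ω, h ω)) (f ω, g ω, h ω)) + Real.log (law P h (h ω))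
      - Real.log (law P (fun ω => (f ω, h ω)) (f ω, h ω))
      - Real.log (law P (fun ω => (g ω, h ω)) (g ω, h ω))) := by
  rw [condMutualInfo, sub_mul, sub_mul, add_mul, entropy_mul_log, entropy_mul_log, entropy_mul_log,
    entropy_mul_log]
  simp only [mul_sub, mul_add, Finset.sum_sub_distrib, Finset.sum_add_distrib]
  ring

theorem Channel.infoY₁_mul_log (h₁ : p₁ ∈ stdSimplex ℝ X₁) :
    ch.infoY₁ p₁ p₂ * Real.log 2 = condInfoLeft ch.bob p₁ p₂ := by
  have hW := ch.bob_mem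
  have e1 := fun ω : X₁ × X₂ × Y × Z => ch.law_single_bob (p₁ := p₁) (p₂ := p₂)
    (fun ω => (ω.1, ω.2.2, ω.2.1)) (ω.1, ω.2.2.1, ω.2.1)
  have e2 := fun ω : X₁ × X₂ × Y × Z => ch.law_single_bob (p₁ := p₁) (p₂ := p₂)
    (fun ω => ω.2.1) ω.2.1
  have e3 := fun ω : X₁ × X₂ × Y × Z => ch.law_single_bob (p₁ := p₁) (p₂ := p₂)
    (fun ω => (ω.1, ω.2.1)) (ω.1, ω.2.1)
  have e4 := fun ω : X₁ × X₂ × Y × Z => ch.law_single_bob (p₁ := p₁) (p₂ := p₂)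
    (fun ω => (ω.2.2, ω.2.1)) (ω.2.2.1, ω.2.1)
  have e5 : ∀ (u : X₁) (v : X₂) (y : Y), law (tripleLaw ch.bob p₁ p₂)
      (fun ω => (ω.1, ω.2.2, ω.2.1)) (u, y, v) = p₁ u * p₂ v * ch.bob u v y := fun u v y => by
    rw [← law_triple]
    exact law_congr fun ω => by simp only [Prod.ext_iff]; tauto
  rw [Channel.infoY₁, condMutualInfo_mul_log]
  simp only at e1 e2 e3 e4
  simp only [e1, e2, e3, e4, e5, law_triple_right hW h₁, law_triple_inputs hW, law_triple_right_out]
  rw [ch.sum_single_bob fun ω => Real.log (p₁ ω.1 * p₂ ω.2.1 * ch.bob ω.1 ω.2.1 ω.2.2) +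
    Real.log (p₂ ω.2.1) - Real.log (p₁ ω.1 * p₂ ω.2.1) -
    Real.log (p₂ ω.2.1 * avgLeft ch.bob p₁ ω.2.1 ω.2.2)]
  refine Finset.sum_congr rfl fun ω _ => ?_
  by_cases h : tripleLaw ch.bob p₁ p₂ ω = 0
  · simp [h]
  obtain ⟨k1, k2, k3⟩ := tripleLaw_ne_zero h
  rw [Real.log_mul (mul_ne_zero k1 k2) k3, Real.log_mul k2 (avgLeft_pos hW h₁ k1 k3).ne']
  ring

theorem Channel.infoY₂_mul_log (h₂ : p₂ ∈ stdSimplex ℝ X₂) :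
    ch.infoY₂ p₁ p₂ * Real.log 2 = condInfoRight ch.bob p₁ p₂ := by
  let ch' : Channel X₂ X₁ Y Z := ⟨fun v u => ch.prob u v, fun v u => ch.prob_mem u v⟩
  have h := ch'.infoY₁_mul_log (p₂ := p₁) h₂
  rw [show ch'.bob = fun v u => ch.bob u v from rfl, condInfoLeft_swap] at h
  rw [← h, Channel.infoY₁, Channel.infoY₂]
  congr 1
  have hP : ch'.single p₂ p₁ = fun ω => ch.single p₁ p₂ (ω.2.1, ω.1, ω.2.2) := by
    funext ω; simp only [Channel.single, ch']; ring
  let e : X₂ × X₁ × Y × Z ≃ X₁ × X₂ × Y × Z :=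
    ⟨fun ω => (ω.2.1, ω.1, ω.2.2), fun ω => (ω.2.1, ω.1, ω.2.2), fun _ => rfl, fun _ => rfl⟩
  rw [hP]
  simp only [condMutualInfo, entropy]
  rw [← law_comp_equiv (ch.single p₁ p₂) e, ← law_comp_equiv (ch.single p₁ p₂) e,
    ← law_comp_equiv (ch.single p₁ p₂) e, ← law_comp_equiv (ch.single p₁ p₂) e]
  rfl

theorem mutualInfo_inputs_mul_log {A B O : Type*} [Fintype A] [Fintype B] [Fintype O]
    {W : A → B → O → ℝ} {a : A → ℝ} {b : B → ℝ} (hW : ∀ u v, W u v ∈ stdSimplex ℝ O) :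
    mutualInfo (tripleLaw W a b) (fun ω => (ω.1, ω.2.1)) (fun ω => ω.2.2) * Real.log 2 =
      jointInfo W a b := by
  have e : ∀ (u : A) (v : B) (y : O), law (tripleLaw W a b)
      (fun ω => ((ω.1, ω.2.1), ω.2.2)) ((u, v), y) = a u * b v * W u v y := fun u v y => by
    rw [← law_triple]
    exact law_congr fun ω => by simp only [Prod.ext_iff]; tauto
  rw [mutualInfo_mul_log, jointInfo]
  refine Finset.sum_congr rfl fun ω _ => ?_
  by_cases h : tripleLaw W a b ω = 0
  · simp [h]
  obtain ⟨k1, k2, k3⟩ := tripleLaw_ne_zero h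
  rw [e, law_triple_inputs hW, law_triple_out, Real.log_mul (mul_ne_zero k1 k2) k3]
  ring

theorem mutualInfo_left_mul_log {A B O : Type*} [Fintype A] [Fintype B] [Fintype O]
    {W : A → B → O → ℝ} {a : A → ℝ} {b : B → ℝ} (hW : ∀ u v, W u v ∈ stdSimplex ℝ O)
    (hb : b ∈ stdSimplex ℝ B) :
    mutualInfo (tripleLaw W a b) (fun ω => ω.1) (fun ω => ω.2.2) * Real.log 2 =
      leftInfo W a b := by
  rw [mutualInfo_mul_log, leftInfo]
  refine Finset.sum_congr rfl fun ω _ => ?_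
  by_cases h : tripleLaw W a b ω = 0
  · simp [h]
  obtain ⟨k1, k2, k3⟩ := tripleLaw_ne_zero h
  rw [law_triple_left_out, law_triple_left hW hb, law_triple_out,
    Real.log_mul k1 (avgRight_pos hW hb k2 k3).ne']
  ring

theorem mutualInfo_right_mul_log {A B O : Type*} [Fintype A] [Fintype B] [Fintype O]
    {W : A → B → O → ℝ} {a : A → ℝ} {b : B → ℝ} (hW : ∀ u v, W u v ∈ stdSimplex ℝ O)
    (ha : a ∈ stdSimplex ℝ A) :
    mutualInfo (tripleLaw W a b) (fun ω => ω.2.1) (fun ω => ω.2.2) * Real.log 2 =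
      rightInfo W a b := by
  rw [mutualInfo_comm, mutualInfo_mul_log, rightInfo]
  refine Finset.sum_congr rfl fun ω _ => ?_
  by_cases h : tripleLaw W a b ω = 0
  · simp [h]
  obtain ⟨k1, k2, k3⟩ := tripleLaw_ne_zero h
  rw [law_triple_right_out, law_triple_right hW ha, law_triple_out,
    Real.log_mul k2 (avgLeft_pos hW ha k1 k3).ne']
  ring

theorem Channel.infoY_mul_log :
    ch.infoY p₁ p₂ * Real.log 2 = jointInfo ch.bob p₁ p₂ := by
  rw [← mutualInfo_inputs_mul_log ch.bob_mem]
  simp only [Channel.infoY, mutualInfo, entropy]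
  simp only [← ch.law_single_bob]

theorem Channel.infoZ_mul_log :
    ch.infoZ p₁ p₂ * Real.log 2 = jointInfo ch.eve p₁ p₂ := by
  rw [← mutualInfo_inputs_mul_log ch.eve_mem]
  simp only [Channel.infoZ, mutualInfo, entropy]
  simp only [← ch.law_single_eve]

theorem Channel.infoZ₁_mul_log (h₂ : p₂ ∈ stdSimplex ℝ X₂) :
    ch.infoZ₁ p₁ p₂ * Real.log 2 = leftInfo ch.eve p₁ p₂ := by
  rw [← mutualInfo_left_mul_log ch.eve_mem h₂]
  simp only [Channel.infoZ₁, mutualInfo, entropy]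
  simp only [← ch.law_single_eve]

theorem Channel.infoZ₂_mul_log (h₁ : p₁ ∈ stdSimplex ℝ X₁) :
    ch.infoZ₂ p₁ p₂ * Real.log 2 = rightInfo ch.eve p₁ p₂ := by
  rw [← mutualInfo_right_mul_log ch.eve_mem h₁]
  simp only [Channel.infoZ₂, mutualInfo, entropy]
  simp only [← ch.law_single_eve]

end SingleLetterFormulas

/-! ### Geometry of the capacity region -/

section Region

variable {X₁ X₂ Y Z : Type*} [Fintype X₁] [Fintype X₂] [Fintype Y] [Fintype Z]
  (ch : Channel X₁ X₂ Y Z) {p₁ : X₁ → ℝ} {p₂ : X₂ → ℝ}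

theorem Channel.infoY₁_le_infoY (h₁ : p₁ ∈ stdSimplex ℝ X₁) (h₂ : p₂ ∈ stdSimplex ℝ X₂) :
    ch.infoY₁ p₁ p₂ ≤ ch.infoY p₁ p₂ := by
  refine le_of_mul_le_mul_right ?_ (Real.log_pos one_lt_two)
  rw [ch.infoY₁_mul_log h₁, ch.infoY_mul_log]
  exact condInfoLeft_le_jointInfo ch.bob_mem h₁ h₂

theorem Channel.infoY₂_le_infoY (h₁ : p₁ ∈ stdSimplex ℝ X₁) (h₂ : p₂ ∈ stdSimplex ℝ X₂) :
    ch.infoY₂ p₁ p₂ ≤ ch.infoY p₁ p₂ := by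
  refine le_of_mul_le_mul_right ?_ (Real.log_pos one_lt_two)
  rw [ch.infoY₂_mul_log h₂, ch.infoY_mul_log]
  exact condInfoRight_le_jointInfo ch.bob_mem h₁ h₂

theorem Channel.infoY_le_add (h₁ : p₁ ∈ stdSimplex ℝ X₁) (h₂ : p₂ ∈ stdSimplex ℝ X₂) :
    ch.infoY p₁ p₂ ≤ ch.infoY₁ p₁ p₂ + ch.infoY₂ p₁ p₂ := by
  refine le_of_mul_le_mul_right ?_ (Real.log_pos one_lt_two)
  rw [add_mul, ch.infoY₁_mul_log h₁, ch.infoY₂_mul_log h₂, ch.infoY_mul_log]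
  exact jointInfo_le_add ch.bob_mem h₁ h₂

theorem Channel.mul_infoY₁_le (h₁ : p₁ ∈ stdSimplex ℝ X₁) (h₂ : p₂ ∈ stdSimplex ℝ X₂)
    {q₁ : X₁ → ℝ} {q₂ : X₂ → ℝ} (hq₁ : q₁ ∈ stdSimplex ℝ X₁) {t : ℝ} (ht : 0 < t)
    (ht₁ : ∀ u, t * p₁ u ≤ q₁ u) (ht₂ : ∀ v, t * p₂ v ≤ q₂ v) :
    t * t * ch.infoY₁ p₁ p₂ ≤ ch.infoY₁ q₁ q₂ := by
  refine le_of_mul_le_mul_right ?_ (Real.log_pos one_lt_two)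
  rw [mul_assoc, ch.infoY₁_mul_log h₁, ch.infoY₁_mul_log hq₁]
  exact mul_condInfoLeft_le ch.bob_mem h₁ h₂ hq₁ ht ht ht₁ ht₂

theorem Channel.mul_infoY₂_le (h₁ : p₁ ∈ stdSimplex ℝ X₁) (h₂ : p₂ ∈ stdSimplex ℝ X₂)
    {q₁ : X₁ → ℝ} {q₂ : X₂ → ℝ} (hq₂ : q₂ ∈ stdSimplex ℝ X₂) {t : ℝ} (ht : 0 < t)
    (ht₁ : ∀ u, t * p₁ u ≤ q₁ u) (ht₂ : ∀ v, t * p₂ v ≤ q₂ v) :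
    t * t * ch.infoY₂ p₁ p₂ ≤ ch.infoY₂ q₁ q₂ := by
  refine le_of_mul_le_mul_right ?_ (Real.log_pos one_lt_two)
  rw [mul_assoc, ch.infoY₂_mul_log h₂, ch.infoY₂_mul_log hq₂]
  exact mul_condInfoRight_le ch.bob_mem h₁ h₂ hq₂ ht ht ht₁ ht₂

theorem Channel.continuous_entropy_single {α : Type*} [Fintype α] (f : X₁ × X₂ × Y × Z → α) :
    Continuous fun p : (X₁ → ℝ) × (X₂ → ℝ) => entropy (ch.single p.1 p.2) f := by
  classical
  unfold entropy law Channel.single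
  refine Continuous.div_const (continuous_finsetSum _ fun a _ =>
    Real.continuous_negMulLog.comp (continuous_finsetSum _ fun ω _ => ?_)) _
  split_ifs <;> fun_prop

theorem Channel.continuous_infoY₁ :
    Continuous fun p : (X₁ → ℝ) × (X₂ → ℝ) => ch.infoY₁ p.1 p.2 :=
  (((ch.continuous_entropy_single _).add (ch.continuous_entropy_single _)).sub
    (ch.continuous_entropy_single _)).sub (ch.continuous_entropy_single _)

theorem Channel.continuous_infoY₂ :
    Continuous fun p : (X₁ → ℝ) × (X₂ → ℝ) => ch.infoY₂ p.1 p.2 :=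
  (((ch.continuous_entropy_single _).add (ch.continuous_entropy_single _)).sub
    (ch.continuous_entropy_single _)).sub (ch.continuous_entropy_single _)

theorem Channel.continuous_infoY :
    Continuous fun p : (X₁ → ℝ) × (X₂ → ℝ) => ch.infoY p.1 p.2 :=
  ((ch.continuous_entropy_single _).add (ch.continuous_entropy_single _)).sub
    (ch.continuous_entropy_single _)

/-- Both users can convey information at the same time. -/
def Channel.BothPositive (ch : Channel X₁ X₂ Y Z) : Prop :=
  ∃ p₁ ∈ stdSimplex ℝ X₁, ∃ p₂ ∈ stdSimplex ℝ X₂, 0 < ch.infoY₁ p₁ p₂ ∧ 0 < ch.infoY₂ p₁ p₂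

theorem mix_mem {A : Type*} [Fintype A] {p q : A → ℝ} (hp : p ∈ stdSimplex ℝ A)
    (hq : q ∈ stdSimplex ℝ A) {t : ℝ} (ht : 0 ≤ t) (ht1 : t ≤ 1) :
    (1 - t) • p + t • q ∈ stdSimplex ℝ A :=
  convex_stdSimplex ℝ A hp hq (by linarith) ht (by ring)

theorem mul_le_mix {A : Type*} [Fintype A] {p q : A → ℝ} (hp : p ∈ stdSimplex ℝ A) {t : ℝ}
    (ht1 : t ≤ 1) (x : A) : t * q x ≤ ((1 - t) • p + t • q) x := by
  have := mul_nonneg (sub_nonneg.2 ht1) (hp.1 x)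
  simpa using this

/-- Inputs that serve the first user and inputs that serve the second one can be mixed. -/
theorem Channel.bothPositive_of_pos (h₁ : p₁ ∈ stdSimplex ℝ X₁) (h₂ : p₂ ∈ stdSimplex ℝ X₂)
    {q₁ : X₁ → ℝ} {q₂ : X₂ → ℝ} (hq₁ : q₁ ∈ stdSimplex ℝ X₁) (hq₂ : q₂ ∈ stdSimplex ℝ X₂)
    (hp : 0 < ch.infoY₁ p₁ p₂) (hq : 0 < ch.infoY₂ q₁ q₂) : ch.BothPositive := by
  have k₁ := mix_mem h₁ hq₁ (t := 1 / 2) (by norm_num) (by norm_num)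
  have k₂ := mix_mem h₂ hq₂ (t := 1 / 2) (by norm_num) (by norm_num)
  refine ⟨_, k₁, _, k₂, lt_of_lt_of_le ?_ (ch.mul_infoY₁_le h₁ h₂ k₁ (t := 1 / 2) (by norm_num)
    (fun u => ?_) fun v => ?_), lt_of_lt_of_le ?_ (ch.mul_infoY₂_le hq₁ hq₂ k₂ (t := 1 / 2)
    (by norm_num) (fun u => ?_) fun v => ?_)⟩
  · linarith
  · have := hq₁.1 u
    simp only [Pi.add_apply, Pi.smul_apply, smul_eq_mul]; linarith
  · have := hq₂.1 v
    simp only [Pi.add_apply, Pi.smul_apply, smul_eq_mul]; linarith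
  · linarith
  · have := h₁.1 u
    simp only [Pi.add_apply, Pi.smul_apply, smul_eq_mul]; linarith
  · have := h₂.1 v
    simp only [Pi.add_apply, Pi.smul_apply, smul_eq_mul]; linarith

/-- The whole closed pentagon of every pair of input laws belongs to the capacity region. The strict
inequalities of the definition exclude degenerate pentagons; mixing in inputs with positive
information makes a degenerate pentagon a limit of nondegenerate ones. -/
theorem Channel.mem_macRegion_of_le (hpos : ch.BothPositive) (h₁ : p₁ ∈ stdSimplex ℝ X₁)
    (h₂ : p₂ ∈ stdSimplex ℝ X₂) {r₁ r₂ : ℝ} (hr₁ : 0 ≤ r₁) (hr₂ : 0 ≤ r₂)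
    (hI₁ : r₁ ≤ ch.infoY₁ p₁ p₂) (hI₂ : r₂ ≤ ch.infoY₂ p₁ p₂) (hI : r₁ + r₂ ≤ ch.infoY p₁ p₂) :
    (r₁, r₂) ∈ ch.macRegion := by
  obtain ⟨q₁, hq₁, q₂, hq₂, hp₁, hp₂⟩ := hpos
  let P : ℝ → (X₁ → ℝ) × (X₂ → ℝ) := fun t => ((1 - t) • p₁ + t • q₁, (1 - t) • p₂ + t • q₂)
  have hP : Continuous P := by fun_prop
  have hP0 : P 0 = (p₁, p₂) := by simp [P]
  have hκ : ∀ κ > (0 : ℝ), (max (r₁ - κ) 0, max (r₂ - κ) 0) ∈ {R : ℝ × ℝ | 0 ≤ R.1 ∧ 0 ≤ R.2 ∧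
      ∃ p₁ ∈ stdSimplex ℝ X₁, ∃ p₂ ∈ stdSimplex ℝ X₂,
      R.1 < ch.infoY₁ p₁ p₂ ∧ R.2 < ch.infoY₂ p₁ p₂ ∧ R.1 + R.2 < ch.infoY p₁ p₂} := by
    intro κ hκ
    have c₁ := (ch.continuous_infoY₁.comp hP).tendsto 0
    have c₂ := (ch.continuous_infoY₂.comp hP).tendsto 0
    have c₃ := (ch.continuous_infoY.comp hP).tendsto 0
    simp only [Function.comp, hP0] at c₁ c₂ c₃
    have e₁ := c₁.eventually_const_lt (show r₁ - κ < _ by linarith)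
    have e₂ := c₂.eventually_const_lt (show r₂ - κ < _ by linarith)
    have e₃ := c₃.eventually_const_lt (show r₁ + r₂ - κ < _ by linarith)
    have e₄ : ∀ᶠ t : ℝ in 𝓝 0, t < 1 := eventually_lt_nhds one_pos
    have e := (((e₁.and e₂).and e₃).and e₄).filter_mono (nhdsWithin_le_nhds (s := Set.Ioi 0))
    obtain ⟨t, ⟨⟨⟨e₁, e₂⟩, e₃⟩, e₄⟩, ht⟩ := (e.and self_mem_nhdsWithin).exists
    have ht : 0 < t := ht
    simp only [Function.comp] at e₁ e₂ e₃
    have k₁ : (P t).1 ∈ _ := mix_mem h₁ hq₁ ht.le e₄.le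
    have k₂ : (P t).2 ∈ _ := mix_mem h₂ hq₂ ht.le e₄.le
    have l₁ : 0 < ch.infoY₁ (P t).1 (P t).2 := lt_of_lt_of_le (by positivity)
      (ch.mul_infoY₁_le hq₁ hq₂ k₁ ht (mul_le_mix h₁ e₄.le) (mul_le_mix h₂ e₄.le))
    have l₂ : 0 < ch.infoY₂ (P t).1 (P t).2 := lt_of_lt_of_le (by positivity)
      (ch.mul_infoY₂_le hq₁ hq₂ k₂ ht (mul_le_mix h₁ e₄.le) (mul_le_mix h₂ e₄.le))
    have m₁ := ch.infoY₁_le_infoY k₁ k₂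
    have m₂ := ch.infoY₂_le_infoY k₁ k₂
    refine ⟨le_max_right _ _, le_max_right _ _, _, k₁, _, k₂, max_lt e₁ l₁, max_lt e₂ l₂, ?_⟩
    rcases max_cases (r₁ - κ) 0 with ⟨h, h'⟩ | ⟨h, h'⟩ <;>
    rcases max_cases (r₂ - κ) 0 with ⟨g, g'⟩ | ⟨g, g'⟩ <;> simp only [h, g] <;> linarith
  have hlim : Tendsto (fun m : ℕ => (max (r₁ - 1 / ((m : ℝ) + 1)) 0, max (r₂ - 1 / ((m : ℝ) + 1)) 0))
      atTop (𝓝 (r₁, r₂)) := by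
    have h0 := tendsto_one_div_add_atTop_nhds_zero_nat (𝕜 := ℝ)
    have g : ∀ r : ℝ, 0 ≤ r → Tendsto (fun m : ℕ => max (r - 1 / ((m : ℝ) + 1)) 0) atTop (𝓝 r) := by
      intro r hr
      have := (h0.const_sub r).max (tendsto_const_nhds (x := (0 : ℝ)))
      simpa [hr] using this
    exact (g r₁ hr₁).prodMk_nhds (g r₂ hr₂)
  refine mem_closure_of_tendsto hlim (Eventually.of_forall fun m => ?_)
  exact subset_convexHull ℝ _ (hκ _ (by positivity))

theorem Channel.convex_macRegion : Convex ℝ ch.macRegion := (convex_convexHull ℝ _).closure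

/-- Time sharing: averages of the three bounds over several pairs of input laws again define a subset
of the capacity region. A point below the averages is the average of points of the single
pentagons, each a rescaled point on the segment between the two corners of its pentagon, with the
same position on the segment and the same scaling for all of them. -/
theorem Channel.mem_macRegion_of_le_average (hpos : ch.BothPositive) {n : ℕ} (hn : 0 < n)
    {p₁ : Fin n → X₁ → ℝ} {p₂ : Fin n → X₂ → ℝ} (h₁ : ∀ t, p₁ t ∈ stdSimplex ℝ X₁)
    (h₂ : ∀ t, p₂ t ∈ stdSimplex ℝ X₂) {r₁ r₂ : ℝ} (hr₁ : 0 ≤ r₁) (hr₂ : 0 ≤ r₂)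
    (hI₁ : n * r₁ ≤ ∑ t, ch.infoY₁ (p₁ t) (p₂ t)) (hI₂ : n * r₂ ≤ ∑ t, ch.infoY₂ (p₁ t) (p₂ t))
    (hI : n * (r₁ + r₂) ≤ ∑ t, ch.infoY (p₁ t) (p₂ t)) : (r₁, r₂) ∈ ch.macRegion := by
  have hn' : (0 : ℝ) < n := by exact_mod_cast hn
  set I₁ := fun t => ch.infoY₁ (p₁ t) (p₂ t) with hI₁d
  set I₂ := fun t => ch.infoY₂ (p₁ t) (p₂ t) with hI₂d
  set I := fun t => ch.infoY (p₁ t) (p₂ t) with hId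
  have hle₁ : ∀ t, I₁ t ≤ I t := fun t => ch.infoY₁_le_infoY (h₁ t) (h₂ t)
  have hle₂ : ∀ t, I₂ t ≤ I t := fun t => ch.infoY₂_le_infoY (h₁ t) (h₂ t)
  have hle : ∀ t, I t ≤ I₁ t + I₂ t := fun t => ch.infoY_le_add (h₁ t) (h₂ t)
  set S₁ := ∑ t, I₁ t with hS₁
  set S₂ := ∑ t, I₂ t with hS₂
  set S := ∑ t, I t with hS
  have hSle : S ≤ S₁ + S₂ := by
    rw [hS, hS₁, hS₂, ← Finset.sum_add_distrib]; exact Finset.sum_le_sum fun t _ => hle t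
  have hSle₁ : S₁ ≤ S := Finset.sum_le_sum fun t _ => hle₁ t
  have hSle₂ : S₂ ≤ S := Finset.sum_le_sum fun t _ => hle₂ t
  set u₁ := max (n * r₁) (S - S₂) with hu₁
  have hu₁le : u₁ ≤ S₁ := max_le hI₁ (by linarith)
  have hu₁ge : n * r₁ ≤ u₁ := le_max_left _ _
  have hu₁ge' : S - S₂ ≤ u₁ := le_max_right _ _
  have hu₂ge : n * r₂ ≤ S - u₁ := by
    have : u₁ ≤ S - n * r₂ := max_le (by linarith) (by linarith)
    linarith
  obtain ⟨θ, hθ0, hθ1, hθ⟩ : ∃ θ : ℝ, 0 ≤ θ ∧ θ ≤ 1 ∧ θ * S₁ + (1 - θ) * (S - S₂) = u₁ := by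
    rcases (show S - S₂ ≤ S₁ by linarith).eq_or_lt with h | h
    · exact ⟨0, le_rfl, zero_le_one, by linarith⟩
    · refine ⟨(u₁ - (S - S₂)) / (S₁ - (S - S₂)), div_nonneg (by linarith) (by linarith),
        (div_le_one (by linarith)).2 (by linarith), ?_⟩
      have : S₁ - (S - S₂) ≠ 0 := by linarith
      field_simp
      ring
  have scale : ∀ x y : ℝ, 0 ≤ x → x ≤ y → ∃ α : ℝ, 0 ≤ α ∧ α ≤ 1 ∧ α * y = x := by
    intro x y hx hxy
    rcases (hx.trans hxy).eq_or_lt with h | h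
    · exact ⟨0, le_rfl, zero_le_one, by linarith⟩
    · exact ⟨x / y, div_nonneg hx h.le, (div_le_one h).2 hxy, div_mul_cancel₀ _ h.ne'⟩
  obtain ⟨α, hα0, hα1, hα⟩ := scale (n * r₁) u₁ (by positivity) hu₁ge
  obtain ⟨β, hβ0, hβ1, hβ⟩ := scale (n * r₂) (S - u₁) (by positivity) hu₂ge
  let v₁ : Fin n → ℝ := fun t => θ * I₁ t + (1 - θ) * (I t - I₂ t)
  let v₂ : Fin n → ℝ := fun t => θ * (I t - I₁ t) + (1 - θ) * I₂ t
  have hI₂0 : ∀ t, 0 ≤ I₂ t := fun t => by linarith [hle₁ t, hle t]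
  have hI₁0 : ∀ t, 0 ≤ I₁ t := fun t => by linarith [hle₂ t, hle t]
  have hv₁0 : ∀ t, 0 ≤ v₁ t := fun t => add_nonneg (mul_nonneg hθ0 (hI₁0 t))
    (mul_nonneg (by linarith) (by linarith [hle₂ t]))
  have hv₂0 : ∀ t, 0 ≤ v₂ t := fun t => add_nonneg (mul_nonneg hθ0 (by linarith [hle₁ t]))
    (mul_nonneg (by linarith) (hI₂0 t))
  have hmem : ∀ t, (α * v₁ t, β * v₂ t) ∈ ch.macRegion := fun t => by
    have a₁ : α * v₁ t ≤ v₁ t := mul_le_of_le_one_left (hv₁0 t) hα1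
    have a₂ : β * v₂ t ≤ v₂ t := mul_le_of_le_one_left (hv₂0 t) hβ1
    have b₁ : v₁ t ≤ I₁ t := by
      have := mul_nonneg (sub_nonneg.2 hθ1) (sub_nonneg.2 (hle t))
      simp only [v₁]; linarith
    have b₂ : v₂ t ≤ I₂ t := by
      have := mul_nonneg hθ0 (sub_nonneg.2 (hle t))
      simp only [v₂]; linarith
    have b₃ : v₁ t + v₂ t = I t := by simp only [v₁, v₂]; ring
    exact ch.mem_macRegion_of_le hpos (h₁ t) (h₂ t) (mul_nonneg hα0 (hv₁0 t))
      (mul_nonneg hβ0 (hv₂0 t)) (a₁.trans b₁) (a₂.trans b₂) (by linarith)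
  have key := ch.convex_macRegion.sum_mem (t := Finset.univ) (w := fun _ : Fin n => (n : ℝ)⁻¹)
    (fun _ _ => by positivity) (by simp [hn'.ne']) fun t _ => hmem t
  convert key using 1
  have hv₁ : ∑ t, v₁ t = u₁ := by
    simp only [v₁, Finset.sum_add_distrib, ← Finset.mul_sum, Finset.sum_sub_distrib]
    exact hθ
  have hv₂ : ∑ t, v₂ t = S - u₁ := by
    rw [← hv₁, hS, ← Finset.sum_sub_distrib]
    exact Finset.sum_congr rfl fun t _ => by simp only [v₁, v₂]; ring
  rw [← Finset.smul_sum, Prod.ext_iff]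
  simp only [Prod.smul_fst, Prod.smul_snd, Prod.fst_sum, Prod.snd_sum, ← Finset.mul_sum, hv₁, hv₂,
    hα, hβ, smul_eq_mul]
  exact ⟨by field_simp, by field_simp⟩

end Region

/-! ### The converse for block codes -/

section Converse

/-- If an event of probability at most `1 / N` under a reference distribution has probability `p`
under `P`, then the relative entropy is at least `p log N - log 2`. The reference distribution is
given by its likelihood ratio `r`. -/
theorem sum_mul_log_card_le {Ω : Type*} [Fintype Ω] {P r : Ω → ℝ} (hP : P ∈ stdSimplex ℝ Ω)
    (hr : ∀ ω, P ω ≠ 0 → 0 < r ω) (hr1 : ∑ ω, P ω * r ω ≤ 1) (E : Ω → Prop) [DecidablePred E]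
    {N : ℝ} (hN : 0 < N) (hE : ∑ ω, P ω * r ω * (if E ω then 1 else 0) ≤ 1 / N) :
    (∑ ω, P ω * if E ω then 1 else 0) * Real.log N ≤
      ∑ ω, P ω * -Real.log (r ω) + Real.log 2 := by
  have key := sum_mul_log_le (P := P) (r := fun ω => r ω * ((if E ω then N else 1) / 2)) hP.1
    (fun ω h => mul_pos (hr ω h) (by split_ifs <;> positivity)) ?_
  · have h : ∀ ω, P ω * Real.log (r ω * ((if E ω then N else 1) / 2)) =
        (P ω * if E ω then 1 else 0) * Real.log N - P ω * -Real.log (r ω) - P ω * Real.log 2 := by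
      intro ω
      by_cases h : P ω = 0
      · simp [h]
      have hif : (if E ω then N else 1) ≠ 0 := by split_ifs <;> positivity
      rw [Real.log_mul (hr ω h).ne' (by positivity), Real.log_div hif two_ne_zero]
      split_ifs <;> simp <;> ring
    simp only [h, Finset.sum_sub_distrib, ← Finset.sum_mul, hP.2] at key
    linarith
  · rw [hP.2]
    have h : ∀ ω, P ω * (r ω * ((if E ω then N else 1) / 2)) ≤
        (P ω * r ω + N * (P ω * r ω * (if E ω then 1 else 0))) / 2 := by
      intro ω
      have : 0 ≤ P ω * r ω := by
        by_cases h : P ω = 0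
        · simp [h]
        · exact mul_nonneg (hP.1 ω) (hr ω h).le
      split_ifs <;> linarith
    refine (Finset.sum_le_sum fun ω _ => h ω).trans ?_
    rw [← Finset.sum_div, Finset.sum_add_distrib, ← Finset.mul_sum]
    have := mul_le_mul_of_nonneg_left hE hN.le
    rw [mul_one_div_cancel hN.ne'] at this
    linarith

variable {A B O M₁ M₂ : Type*} [Fintype A] [Fintype B] [Fintype O] [Fintype M₁] [Fintype M₂]

/-- The `n`-fold memoryless extension of a channel. -/
def blockKernel (W : A → B → O → ℝ) (n : ℕ) (u : Fin n → A) (v : Fin n → B) (o : Fin n → O) : ℝ :=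
  ∏ t, W (u t) (v t) (o t)

theorem blockKernel_mem {W : A → B → O → ℝ} (hW : ∀ u v, W u v ∈ stdSimplex ℝ O) {n : ℕ}
    (u : Fin n → A) (v : Fin n → B) : blockKernel W n u v ∈ stdSimplex ℝ (Fin n → O) :=
  pi_mem_stdSimplex fun t => hW (u t) (v t)

open Classical in
/-- The average error probability of a code with encoders `c₁`, `c₂` and decoder `d`. -/
noncomputable def macError (W : A → B → O → ℝ) (c₁ : M₁ → A) (c₂ : M₂ → B) (d : O → M₁ × M₂) : ℝ :=
  ((Fintype.card M₁ : ℝ) * Fintype.card M₂)⁻¹ *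
    ∑ m₁, ∑ m₂, ∑ o, W (c₁ m₁) (c₂ m₂) o * if d o ≠ (m₁, m₂) then 1 else 0

/-- The input law at one position when the message is uniform. -/
noncomputable def letterLaw {n : ℕ} (c : M₁ → Fin n → A) (t : Fin n) : A → ℝ :=
  law (fun _ => (Fintype.card M₁ : ℝ)⁻¹) fun m => c m t

theorem letterLaw_mem [Nonempty M₁] {n : ℕ} (c : M₁ → Fin n → A) (t : Fin n) :
    letterLaw c t ∈ stdSimplex ℝ A := by
  refine ⟨law_nonneg (fun _ => by positivity) _, ?_⟩
  rw [letterLaw, sum_law]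
  simp

theorem letterLaw_pos [Nonempty M₁] {n : ℕ} (c : M₁ → Fin n → A) (t : Fin n) (m : M₁) :
    letterLaw c t (c m t) ≠ 0 :=
  (law_pos (P := fun _ : M₁ => (Fintype.card M₁ : ℝ)⁻¹) (fun _ => by positivity) (fun m => c m t)
    (ω := m) (by positivity)).ne'

/-- The joint law of messages and output. -/
noncomputable def messageLaw (W : A → B → O → ℝ) (c₁ : M₁ → A) (c₂ : M₂ → B)
    (ω : M₁ × M₂ × O) : ℝ :=
  ((Fintype.card M₁ : ℝ) * Fintype.card M₂)⁻¹ * W (c₁ ω.1) (c₂ ω.2.1) ω.2.2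

theorem messageLaw_mem [Nonempty M₁] [Nonempty M₂] {W : A → B → O → ℝ}
    (hW : ∀ u v, W u v ∈ stdSimplex ℝ O) (c₁ : M₁ → A) (c₂ : M₂ → B) :
    messageLaw W c₁ c₂ ∈ stdSimplex ℝ (M₁ × M₂ × O) := by
  refine ⟨fun ω => mul_nonneg (by positivity) ((hW _ _).1 _), ?_⟩
  simp only [messageLaw, Fintype.sum_prod_type, ← Finset.mul_sum, (hW _ _).2]
  simp only [Finset.sum_const, Finset.card_univ, nsmul_eq_mul, mul_one]
  exact inv_mul_cancel₀ (by positivity)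

theorem macError_eq [DecidableEq M₁] [DecidableEq M₂] (W : A → B → O → ℝ) (c₁ : M₁ → A)
    (c₂ : M₂ → B) (d : O → M₁ × M₂) : macError W c₁ c₂ d =
      ∑ ω, messageLaw W c₁ c₂ ω * if d ω.2.2 ≠ (ω.1, ω.2.1) then 1 else 0 := by
  simp only [macError, messageLaw, Fintype.sum_prod_type, Finset.mul_sum, mul_assoc]
  refine Finset.sum_congr rfl fun _ _ => Finset.sum_congr rfl fun _ _ =>
    Finset.sum_congr rfl fun _ _ => ?_
  congr

theorem one_sub_macError_le [Nonempty M₁] [Nonempty M₂] {W : A → B → O → ℝ}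
    (hW : ∀ u v, W u v ∈ stdSimplex ℝ O) (c₁ : M₁ → A) (c₂ : M₂ → B) (d : O → M₁ × M₂)
    (E : M₁ × M₂ × O → Prop) [DecidablePred E] (hE : ∀ ω, d ω.2.2 = (ω.1, ω.2.1) → E ω) :
    1 - macError W c₁ c₂ d ≤ ∑ ω, messageLaw W c₁ c₂ ω * if E ω then 1 else 0 := by
  classical
  have hP := messageLaw_mem hW c₁ c₂
  rw [macError_eq, sub_le_iff_le_add, ← Finset.sum_add_distrib]
  refine hP.2.symm.le.trans <| Finset.sum_le_sum fun ω _ => ?_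
  have := hP.1 ω
  by_cases h : d ω.2.2 = (ω.1, ω.2.1)
  · rw [if_pos (hE ω h)]; simp [h]
  · simp only [ne_eq, h, not_false_eq_true, if_true, mul_one]
    split_ifs <;> linarith

theorem sum_messageLaw_letter [Nonempty M₁] [Nonempty M₂] {W : A → B → O → ℝ}
    (hW : ∀ u v, W u v ∈ stdSimplex ℝ O) {n : ℕ} (c₁ : M₁ → Fin n → A) (c₂ : M₂ → Fin n → B)
    (t : Fin n) (φ : A → B → O → ℝ) :
    ∑ ω, messageLaw (blockKernel W n) c₁ c₂ ω * φ (c₁ ω.1 t) (c₂ ω.2.1 t) (ω.2.2 t) =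
      ∑ ω, tripleLaw W (letterLaw c₁ t) (letterLaw c₂ t) ω * φ ω.1 ω.2.1 ω.2.2 := by
  simp only [messageLaw, tripleLaw, Fintype.sum_prod_type, mul_assoc, ← Finset.mul_sum]
  simp only [letterLaw]
  rw [sum_law_mul _ _ fun u => ∑ v, law (fun _ => (Fintype.card M₂ : ℝ)⁻¹) (fun m => c₂ m t) v *
    ∑ o, W u v o * φ u v o, mul_inv]
  simp only [mul_assoc, ← Finset.mul_sum]
  congr 1
  rw [Finset.mul_sum]
  refine Finset.sum_congr rfl fun m₁ _ => ?_
  rw [sum_law_mul _ _ fun v => ∑ o, W (c₁ m₁ t) v o * φ (c₁ m₁ t) v o, ← Finset.mul_sum]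
  congr 1
  refine Finset.sum_congr rfl fun m₂ _ => ?_
  exact sum_pi_mul_eval (J := fun t o => W (c₁ m₁ t) (c₂ m₂ t) o)
    (fun t => hW _ _) t fun o => φ (c₁ m₁ t) (c₂ m₂ t) o

/-- The converse for an arbitrary memoryless reference channel `q`: an event that is unlikely when
the output is generated by `q` and contains correct decoding bounds the number of messages. -/
theorem converse_bound [Nonempty M₁] [Nonempty M₂] {W : A → B → O → ℝ}
    (hW : ∀ u v, W u v ∈ stdSimplex ℝ O) {n : ℕ} (c₁ : M₁ → Fin n → A) (c₂ : M₂ → Fin n → B)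
    (d : (Fin n → O) → M₁ × M₂) (q : Fin n → A → B → O → ℝ)
    (hq : ∀ t u v, q t u v ∈ stdSimplex ℝ O)
    (hq0 : ∀ t m₁ m₂ o, W (c₁ m₁ t) (c₂ m₂ t) o ≠ 0 → q t (c₁ m₁ t) (c₂ m₂ t) o ≠ 0)
    (E : M₁ × M₂ × (Fin n → O) → Prop) [DecidablePred E]
    (hE : ∀ ω, d ω.2.2 = (ω.1, ω.2.1) → E ω) {N : ℝ} (hN : 1 ≤ N)
    (hN' : ∑ m₁, ∑ m₂, ∑ o : Fin n → O, (∏ t, q t (c₁ m₁ t) (c₂ m₂ t) (o t)) *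
      (if E (m₁, m₂, o) then 1 else 0) ≤ Fintype.card M₁ * Fintype.card M₂ * (1 / N)) :
    (1 - macError (blockKernel W n) c₁ c₂ d) * Real.log N ≤
      (∑ t, ∑ ω, tripleLaw W (letterLaw c₁ t) (letterLaw c₂ t) ω *
        (Real.log (W ω.1 ω.2.1 ω.2.2) - Real.log (q t ω.1 ω.2.1 ω.2.2))) + Real.log 2 := by
  have hP := messageLaw_mem (blockKernel_mem hW (n := n)) c₁ c₂
  set P := messageLaw (blockKernel W n) c₁ c₂ with hPd
  set c : ℝ := ((Fintype.card M₁ : ℝ) * Fintype.card M₂)⁻¹ with hc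
  have hc0 : 0 < c := by positivity
  let Q : M₁ × M₂ × (Fin n → O) → ℝ := fun ω => ∏ t, q t (c₁ ω.1 t) (c₂ ω.2.1 t) (ω.2.2 t)
  let r : M₁ × M₂ × (Fin n → O) → ℝ := fun ω => Q ω / blockKernel W n (c₁ ω.1) (c₂ ω.2.1) ω.2.2
  have hPW : ∀ ω, P ω ≠ 0 → ∀ t, W (c₁ ω.1 t) (c₂ ω.2.1 t) (ω.2.2 t) ≠ 0 := fun ω h t => by
    have h' : blockKernel W n (c₁ ω.1) (c₂ ω.2.1) ω.2.2 ≠ 0 := right_ne_zero_of_mul h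
    exact Finset.prod_ne_zero_iff.1 h' t (Finset.mem_univ t)
  have hQ0 : ∀ ω, 0 ≤ Q ω := fun ω => Finset.prod_nonneg fun t _ => (hq _ _ _).1 _
  have hr : ∀ ω, P ω ≠ 0 → 0 < r ω := fun ω h =>
    div_pos (Finset.prod_pos fun t _ => ((hq _ _ _).1 _).lt_of_ne' (hq0 _ _ _ _ (hPW ω h t)))
      (Finset.prod_pos fun t _ => ((hW _ _).1 _).lt_of_ne' (hPW ω h t))
  have hPr : ∀ ω, P ω * r ω ≤ c * Q ω := fun ω => by
    by_cases h : P ω = 0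
    · rw [h, zero_mul]; exact mul_nonneg hc0.le (hQ0 ω)
    · have h' : blockKernel W n (c₁ ω.1) (c₂ ω.2.1) ω.2.2 ≠ 0 := right_ne_zero_of_mul h
      exact le_of_eq (by simp only [hPd, messageLaw, r]; rw [mul_assoc, mul_div_cancel₀ _ h'])
  have key := sum_mul_log_card_le hP hr ?_ E (N := N) (by linarith) ?_
  · refine (mul_le_mul_of_nonneg_right (one_sub_macError_le (blockKernel_mem hW) c₁ c₂ d E hE)
      (Real.log_nonneg hN)).trans (key.trans (le_of_eq ?_))
    congr 1
    rw [Finset.sum_congr rfl fun t _ => (sum_messageLaw_letter hW c₁ c₂ t fun u v o =>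
      Real.log (W u v o) - Real.log (q t u v o)).symm, Finset.sum_comm]
    refine Finset.sum_congr rfl fun ω _ => ?_
    by_cases h : P ω = 0
    · rw [h, zero_mul]; exact (Finset.sum_eq_zero fun t _ => by rw [← hPd, h, zero_mul]).symm
    · rw [← Finset.mul_sum, ← hPd]
      congr 1
      have h1 : Real.log (Q ω) = ∑ t, Real.log (q t (c₁ ω.1 t) (c₂ ω.2.1 t) (ω.2.2 t)) :=
        Real.log_prod fun t _ => hq0 _ _ _ _ (hPW ω h t)
      have h2 : Real.log (blockKernel W n (c₁ ω.1) (c₂ ω.2.1) ω.2.2) =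
          ∑ t, Real.log (W (c₁ ω.1 t) (c₂ ω.2.1 t) (ω.2.2 t)) :=
        Real.log_prod fun t _ => hPW ω h t
      rw [Finset.sum_sub_distrib, ← h1, ← h2]
      simp only [r]
      rw [Real.log_div]
      · ring
      · exact Finset.prod_ne_zero_iff.2 fun t _ => hq0 _ _ _ _ (hPW ω h t)
      · exact Finset.prod_ne_zero_iff.2 fun t _ => hPW ω h t
  · refine (Finset.sum_le_sum fun ω _ => hPr ω).trans (le_of_eq ?_)
    simp only [← Finset.mul_sum, Fintype.sum_prod_type, Q]
    have : ∀ m₁ m₂, ∑ o : Fin n → O, ∏ t, q t (c₁ m₁ t) (c₂ m₂ t) (o t) = 1 := fun m₁ m₂ =>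
      (pi_mem_stdSimplex fun t => hq t (c₁ m₁ t) (c₂ m₂ t)).2
    simp only [this, Finset.sum_const, Finset.card_univ, nsmul_eq_mul, mul_one]
    exact inv_mul_cancel₀ (by positivity)
  · refine (Finset.sum_le_sum fun ω _ => mul_le_mul_of_nonneg_right (hPr ω)
      (by split_ifs <;> norm_num)).trans ?_
    simp only [mul_assoc, ← Finset.mul_sum, Fintype.sum_prod_type, Q]
    refine (mul_le_mul_of_nonneg_left hN' hc0.le).trans (le_of_eq ?_)
    rw [hc, inv_mul_cancel_left₀ (by positivity)]

theorem converse_left [Nonempty M₁] [Nonempty M₂] {W : A → B → O → ℝ}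
    (hW : ∀ u v, W u v ∈ stdSimplex ℝ O) {n : ℕ} (c₁ : M₁ → Fin n → A) (c₂ : M₂ → Fin n → B)
    (d : (Fin n → O) → M₁ × M₂) :
    (1 - macError (blockKernel W n) c₁ c₂ d) * Real.log (Fintype.card M₁) ≤
      (∑ t, condInfoLeft W (letterLaw c₁ t) (letterLaw c₂ t)) + Real.log 2 := by
  classical
  refine converse_bound hW c₁ c₂ d (fun t _ v => avgLeft W (letterLaw c₁ t) v)
    (fun t _ v => avgLeft_mem hW (letterLaw_mem c₁ t) v)
    (fun t m₁ m₂ o h => (avgLeft_pos hW (letterLaw_mem c₁ t) (letterLaw_pos c₁ t m₁) h).ne')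
    (fun ω => (d ω.2.2).1 = ω.1) (fun ω h => by rw [h])
    (by exact_mod_cast Fintype.card_pos) ?_
  have h1 : ∀ m₂, ∑ o : Fin n → O, ∏ t, avgLeft W (letterLaw c₁ t) (c₂ m₂ t) (o t) = 1 := fun m₂ =>
    (pi_mem_stdSimplex fun t => avgLeft_mem hW (letterLaw_mem c₁ t) (c₂ m₂ t)).2
  rw [Finset.sum_comm]
  have h2 : ∀ m₂, ∑ m₁, ∑ o : Fin n → O, (∏ t, avgLeft W (letterLaw c₁ t) (c₂ m₂ t) (o t)) *
      (if (d o).1 = m₁ then 1 else 0) = 1 := fun m₂ => by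
    rw [Finset.sum_comm]
    exact (Finset.sum_congr rfl fun o _ => by simp).trans (h1 m₂)
  simp only [h2]
  simp only [Finset.sum_const, Finset.card_univ, nsmul_eq_mul, mul_one]
  refine le_of_eq ?_
  field_simp

theorem converse_right [Nonempty M₁] [Nonempty M₂] {W : A → B → O → ℝ}
    (hW : ∀ u v, W u v ∈ stdSimplex ℝ O) {n : ℕ} (c₁ : M₁ → Fin n → A) (c₂ : M₂ → Fin n → B)
    (d : (Fin n → O) → M₁ × M₂) :
    (1 - macError (blockKernel W n) c₁ c₂ d) * Real.log (Fintype.card M₂) ≤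
      (∑ t, condInfoRight W (letterLaw c₁ t) (letterLaw c₂ t)) + Real.log 2 := by
  classical
  refine converse_bound hW c₁ c₂ d (fun t u _ => avgRight W (letterLaw c₂ t) u)
    (fun t u _ => avgRight_mem hW (letterLaw_mem c₂ t) u)
    (fun t m₁ m₂ o h => (avgRight_pos hW (letterLaw_mem c₂ t) (letterLaw_pos c₂ t m₂) h).ne')
    (fun ω => (d ω.2.2).2 = ω.2.1) (fun ω h => by rw [h])
    (by exact_mod_cast Fintype.card_pos) ?_
  have h1 : ∀ m₁, ∑ o : Fin n → O, ∏ t, avgRight W (letterLaw c₂ t) (c₁ m₁ t) (o t) = 1 := fun m₁ =>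
    (pi_mem_stdSimplex fun t => avgRight_mem hW (letterLaw_mem c₂ t) (c₁ m₁ t)).2
  have h2 : ∀ m₁, ∑ m₂, ∑ o : Fin n → O, (∏ t, avgRight W (letterLaw c₂ t) (c₁ m₁ t) (o t)) *
      (if (d o).2 = m₂ then 1 else 0) = 1 := fun m₁ => by
    rw [Finset.sum_comm]
    exact (Finset.sum_congr rfl fun o _ => by simp).trans (h1 m₁)
  simp only [h2]
  simp only [Finset.sum_const, Finset.card_univ, nsmul_eq_mul, mul_one]
  refine le_of_eq ?_
  field_simp

theorem converse_joint [Nonempty M₁] [Nonempty M₂] {W : A → B → O → ℝ}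
    (hW : ∀ u v, W u v ∈ stdSimplex ℝ O) {n : ℕ} (c₁ : M₁ → Fin n → A) (c₂ : M₂ → Fin n → B)
    (d : (Fin n → O) → M₁ × M₂) :
    (1 - macError (blockKernel W n) c₁ c₂ d) *
      Real.log ((Fintype.card M₁ : ℝ) * Fintype.card M₂) ≤
      (∑ t, jointInfo W (letterLaw c₁ t) (letterLaw c₂ t)) + Real.log 2 := by
  classical
  have hb := fun t => avgBoth_mem hW (letterLaw_mem c₁ t) (letterLaw_mem c₂ t)
  refine converse_bound hW c₁ c₂ d (fun t _ _ => avgBoth W (letterLaw c₁ t) (letterLaw c₂ t))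
    (fun t _ _ => hb t) (fun t m₁ m₂ o h => (avgBoth_pos hW (letterLaw_mem c₁ t)
      (letterLaw_mem c₂ t) (letterLaw_pos c₁ t m₁) (letterLaw_pos c₂ t m₂) h).ne')
    (fun ω => d ω.2.2 = (ω.1, ω.2.1)) (fun ω h => h) ?_ ?_
  · have h1 : (1 : ℝ) ≤ Fintype.card M₁ := by exact_mod_cast Fintype.card_pos
    have h2 : (1 : ℝ) ≤ Fintype.card M₂ := by exact_mod_cast Fintype.card_pos
    nlinarith
  · have h1 : ∑ o : Fin n → O, ∏ t, avgBoth W (letterLaw c₁ t) (letterLaw c₂ t) (o t) = 1 :=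
      (pi_mem_stdSimplex hb).2
    rw [mul_one_div_cancel (by positivity)]
    refine le_of_eq (Eq.trans ?_ h1)
    have h2 : ∀ m₁ : M₁, ∑ m₂ : M₂, ∑ o : Fin n → O,
        (∏ t, avgBoth W (letterLaw c₁ t) (letterLaw c₂ t) (o t)) *
          (if d o = (m₁, m₂) then 1 else 0) = ∑ o : Fin n → O,
        (∏ t, avgBoth W (letterLaw c₁ t) (letterLaw c₂ t) (o t)) *
          (if (d o).1 = m₁ then 1 else 0) := fun m₁ => by
      rw [Finset.sum_comm]
      refine Finset.sum_congr rfl fun o _ => ?_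
      rw [← Finset.mul_sum]
      congr 1
      by_cases h : (d o).1 = m₁ <;> simp [Prod.ext_iff, h]
    rw [Finset.sum_congr rfl fun m₁ _ => h2 m₁, Finset.sum_comm]
    exact Finset.sum_congr rfl fun o _ => by simp

/-! ### Stochastic encoders do not help -/

theorem exists_ne_zero_le_sum_mul {Ω : Type*} [Fintype Ω] {p : Ω → ℝ} (hp : p ∈ stdSimplex ℝ Ω)
    (g : Ω → ℝ) : ∃ ω, p ω ≠ 0 ∧ g ω ≤ ∑ ω, p ω * g ω := by
  by_contra! h
  have hne : ∃ ω, p ω ≠ 0 := by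
    by_contra! h0
    simpa [h0] using hp.2
  obtain ⟨ω₀, h0⟩ := hne
  have : ∑ ω, p ω * (∑ ω, p ω * g ω) < ∑ ω, p ω * g ω := by
    refine Finset.sum_lt_sum (fun ω _ => ?_)
      ⟨ω₀, Finset.mem_univ _, mul_lt_mul_of_pos_left (h ω₀ h0) ((hp.1 ω₀).lt_of_ne' h0)⟩
    by_cases hω : p ω = 0
    · simp [hω]
    · exact mul_le_mul_of_nonneg_left (h ω hω).le (hp.1 ω)
  rw [← Finset.sum_mul, hp.2, one_mul] at this
  exact lt_irrefl _ this

theorem exists_le_sum_mul {Ω : Type*} [Fintype Ω] {p : Ω → ℝ} (hp : p ∈ stdSimplex ℝ Ω)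
    (g : Ω → ℝ) : ∃ ω, g ω ≤ ∑ ω, p ω * g ω :=
  (exists_ne_zero_le_sum_mul hp g).imp fun _ h => h.2

open Classical in
/-- The average error probability of a code with stochastic encoders. -/
noncomputable def stochasticError (W : A → B → O → ℝ) (e₁ : M₁ → A → ℝ) (e₂ : M₂ → B → ℝ)
    (d : O → M₁ × M₂) : ℝ :=
  ((Fintype.card M₁ : ℝ) * Fintype.card M₂)⁻¹ *
    ∑ m₁, ∑ m₂, ∑ u, ∑ v, e₁ m₁ u * e₂ m₂ v * ∑ o, W u v o * if d o ≠ (m₁, m₂) then 1 else 0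

theorem exists_macError_le (W : A → B → O → ℝ) {e₁ : M₁ → A → ℝ} {e₂ : M₂ → B → ℝ}
    (h₁ : ∀ m, e₁ m ∈ stdSimplex ℝ A) (h₂ : ∀ m, e₂ m ∈ stdSimplex ℝ B) (d : O → M₁ × M₂) :
    ∃ c₁ c₂, macError W c₁ c₂ d ≤ stochasticError W e₁ e₂ d := by
  classical
  let g : M₁ → M₂ → A → B → ℝ := fun m₁ m₂ u v => ∑ o, W u v o * if d o ≠ (m₁, m₂) then 1 else 0
  have k₁ := fun m₁ => exists_le_sum_mul (h₁ m₁) fun u => ∑ m₂, ∑ v, e₂ m₂ v * g m₁ m₂ u v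
  choose c₁ hc₁ using k₁
  have k₂ := fun m₂ => exists_le_sum_mul (h₂ m₂) fun v => ∑ m₁, g m₁ m₂ (c₁ m₁) v
  choose c₂ hc₂ using k₂
  refine ⟨c₁, c₂, mul_le_mul_of_nonneg_left ?_ (by positivity)⟩
  calc ∑ m₁, ∑ m₂, g m₁ m₂ (c₁ m₁) (c₂ m₂) = ∑ m₂, ∑ m₁, g m₁ m₂ (c₁ m₁) (c₂ m₂) :=
        Finset.sum_comm
    _ ≤ ∑ m₂, ∑ v, e₂ m₂ v * ∑ m₁, g m₁ m₂ (c₁ m₁) v := Finset.sum_le_sum fun m₂ _ => hc₂ m₂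
    _ = ∑ m₁, ∑ m₂, ∑ v, e₂ m₂ v * g m₁ m₂ (c₁ m₁) v := by
        simp only [Finset.mul_sum]
        rw [Finset.sum_comm (s := (Finset.univ : Finset M₁))]
        exact Finset.sum_congr rfl fun m₂ _ => Finset.sum_comm
    _ ≤ ∑ m₁, ∑ u, e₁ m₁ u * ∑ m₂, ∑ v, e₂ m₂ v * g m₁ m₂ u v :=
        Finset.sum_le_sum fun m₁ _ => hc₁ m₁
    _ = _ := by
        refine Finset.sum_congr rfl fun m₁ _ => ?_
        change ∑ u, e₁ m₁ u * ∑ m₂, ∑ v, e₂ m₂ v * g m₁ m₂ u v =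
          ∑ m₂, ∑ u, ∑ v, e₁ m₁ u * e₂ m₂ v * g m₁ m₂ u v
        simp only [Finset.mul_sum]
        rw [Finset.sum_comm]
        exact Finset.sum_congr rfl fun _ _ => Finset.sum_congr rfl fun _ _ =>
          Finset.sum_congr rfl fun _ _ => (mul_assoc _ _ _).symm

end Converse

/-! ### The converse for sequences of codes -/

section CodeSequences

variable {X₁ X₂ Y Z : Type*} [Fintype X₁] [Fintype X₂] [Fintype Y] [Fintype Z]
  (ch : Channel X₁ X₂ Y Z)

theorem log_card_bits (b : ℕ) : Real.log (Fintype.card (Bits b)) = b * Real.log 2 := by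
  rw [Fintype.card_fun, ZMod.card, Fintype.card_fin, Nat.cast_pow, Real.log_pow]
  norm_num

theorem Channel.converse_bits {n b₁ b₂ : ℕ} (c₁ : Bits b₁ → Fin n → X₁) (c₂ : Bits b₂ → Fin n → X₂)
    (d : (Fin n → Y) → Bits b₁ × Bits b₂) :
    (1 - macError (blockKernel ch.bob n) c₁ c₂ d) * b₁ ≤
        (∑ t, ch.infoY₁ (letterLaw c₁ t) (letterLaw c₂ t)) + 1 ∧
      (1 - macError (blockKernel ch.bob n) c₁ c₂ d) * b₂ ≤
        (∑ t, ch.infoY₂ (letterLaw c₁ t) (letterLaw c₂ t)) + 1 ∧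
      (1 - macError (blockKernel ch.bob n) c₁ c₂ d) * (b₁ + b₂) ≤
        (∑ t, ch.infoY (letterLaw c₁ t) (letterLaw c₂ t)) + 1 := by
  have h2 := Real.log_pos one_lt_two
  refine ⟨le_of_mul_le_mul_right ?_ h2, le_of_mul_le_mul_right ?_ h2, le_of_mul_le_mul_right ?_ h2⟩
  · rw [add_mul, Finset.sum_mul, one_mul, mul_assoc, ← log_card_bits]
    simp only [ch.infoY₁_mul_log (letterLaw_mem c₁ _)]
    exact converse_left ch.bob_mem c₁ c₂ d
  · rw [add_mul, Finset.sum_mul, one_mul, mul_assoc, ← log_card_bits]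
    simp only [ch.infoY₂_mul_log (letterLaw_mem c₂ _)]
    exact converse_right ch.bob_mem c₁ c₂ d
  · rw [add_mul _ 1, Finset.sum_mul, one_mul, mul_assoc, add_mul, ← log_card_bits, ← log_card_bits,
      ← Real.log_mul (by positivity) (by positivity)]
    simp only [ch.infoY_mul_log]
    exact converse_joint ch.bob_mem c₁ c₂ d

/-- The rate pair `R` is attained by block codes with vanishing error probability, for the channel
to Bob alone. -/
def Channel.AttainedByCodes (ch : Channel X₁ X₂ Y Z) (R : ℝ × ℝ) : Prop :=
  ∃ e : ℕ → ℝ, Tendsto e atTop (𝓝 0) ∧ ∀ᶠ n : ℕ in atTop, ∃ (b₁ b₂ : ℕ)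
    (c₁ : Bits b₁ → Fin n → X₁) (c₂ : Bits b₂ → Fin n → X₂) (d : (Fin n → Y) → Bits b₁ × Bits b₂),
    n * R.1 ≤ b₁ ∧ n * R.2 ≤ b₂ ∧ macError (blockKernel ch.bob n) c₁ c₂ d ≤ e n

theorem Channel.AttainedByCodes.bothPositive {R : ℝ × ℝ} (h : ch.AttainedByCodes R)
    (h₁ : 0 < R.1) (h₂ : 0 < R.2) : ch.BothPositive := by
  obtain ⟨e, he, hc⟩ := h
  have he' := he.eventually_lt_const (show (0 : ℝ) < 1 / 2 by norm_num)
  have g₁ := (tendsto_natCast_atTop_atTop (R := ℝ)).eventually_gt_atTop (2 / R.1)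
  have g₂ := (tendsto_natCast_atTop_atTop (R := ℝ)).eventually_gt_atTop (2 / R.2)
  obtain ⟨n, ⟨⟨b₁, b₂, c₁, c₂, d, hb₁, hb₂, herr⟩, hen⟩, hn₁, hn₂⟩ :=
    ((hc.and he').and (g₁.and g₂)).exists
  rw [div_lt_iff₀ h₁] at hn₁
  rw [div_lt_iff₀ h₂] at hn₂
  obtain ⟨k₁, k₂, -⟩ := ch.converse_bits c₁ c₂ d
  have herr' : macError (blockKernel ch.bob n) c₁ c₂ d < 1 / 2 := herr.trans_lt hen
  have s₁ : 0 < ∑ t, ch.infoY₁ (letterLaw c₁ t) (letterLaw c₂ t) := by nlinarith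
  have s₂ : 0 < ∑ t, ch.infoY₂ (letterLaw c₁ t) (letterLaw c₂ t) := by nlinarith
  obtain ⟨t₁, -, ht₁⟩ := Finset.exists_lt_of_sum_lt (f := fun _ => (0 : ℝ)) (by simpa using s₁)
  obtain ⟨t₂, -, ht₂⟩ := Finset.exists_lt_of_sum_lt (f := fun _ => (0 : ℝ)) (by simpa using s₂)
  exact ch.bothPositive_of_pos (letterLaw_mem c₁ t₁) (letterLaw_mem c₂ t₁) (letterLaw_mem c₁ t₂)
    (letterLaw_mem c₂ t₂) ht₁ ht₂

theorem Channel.AttainedByCodes.mem_macRegion {R : ℝ × ℝ} (h : ch.AttainedByCodes R)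
    (hpos : ch.BothPositive) (h₁ : 0 ≤ R.1) (h₂ : 0 ≤ R.2) : R ∈ ch.macRegion := by
  obtain ⟨e, he, hc⟩ := h
  have lim : ∀ r : ℝ, 0 ≤ r →
      Tendsto (fun n : ℕ => max ((1 - e n) * r - 1 / (n : ℝ)) 0) atTop (𝓝 r) := by
    intro r hr
    have h0 := tendsto_one_div_atTop_nhds_zero_nat (𝕜 := ℝ)
    have := ((((he.const_sub 1).mul_const r).sub h0).max (tendsto_const_nhds (x := (0 : ℝ))))
    simpa [hr] using this
  refine isClosed_closure.mem_of_tendsto ((lim R.1 h₁).prodMk_nhds (lim R.2 h₂)) ?_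
  filter_upwards [hc, he.eventually_lt_const one_pos, eventually_gt_atTop 0]
  rintro n ⟨b₁, b₂, c₁, c₂, d, hb₁, hb₂, herr⟩ hen hn
  have hn' : (0 : ℝ) < n := by exact_mod_cast hn
  obtain ⟨k₁, k₂, k₃⟩ := ch.converse_bits c₁ c₂ d
  have hE : 1 - e n ≤ 1 - macError (blockKernel ch.bob n) c₁ c₂ d := by linarith
  have l₁ : (1 - e n) * (n * R.1) ≤ (1 - macError (blockKernel ch.bob n) c₁ c₂ d) * b₁ :=
    mul_le_mul hE hb₁ (by positivity) (by linarith)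
  have l₂ : (1 - e n) * (n * R.2) ≤ (1 - macError (blockKernel ch.bob n) c₁ c₂ d) * b₂ :=
    mul_le_mul hE hb₂ (by positivity) (by linarith)
  have m₁ := letterLaw_mem c₁
  have m₂ := letterLaw_mem c₂
  have le₁ := Finset.sum_le_sum fun t (_ : t ∈ Finset.univ) => ch.infoY₁_le_infoY (m₁ t) (m₂ t)
  have le₂ := Finset.sum_le_sum fun t (_ : t ∈ Finset.univ) => ch.infoY₂_le_infoY (m₁ t) (m₂ t)
  have le₃ := Finset.sum_le_sum fun t (_ : t ∈ Finset.univ) => ch.infoY_le_add (m₁ t) (m₂ t)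
  rw [Finset.sum_add_distrib] at le₃
  have e₁ : n * ((1 - e n) * R.1 - 1 / (n : ℝ)) = (1 - e n) * (n * R.1) - 1 := by field_simp
  have e₂ : n * ((1 - e n) * R.2 - 1 / (n : ℝ)) = (1 - e n) * (n * R.2) - 1 := by field_simp
  refine ch.mem_macRegion_of_le_average hpos hn m₁ m₂ (le_max_right _ _) (le_max_right _ _)
    ?_ ?_ ?_
  · rcases max_cases ((1 - e n) * R.1 - 1 / (n : ℝ)) 0 with ⟨h, h'⟩ | ⟨h, h'⟩ <;> rw [h] <;> linarith
  · rcases max_cases ((1 - e n) * R.2 - 1 / (n : ℝ)) 0 with ⟨h, h'⟩ | ⟨h, h'⟩ <;> rw [h] <;> linarith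
  · rw [mul_add]
    rcases max_cases ((1 - e n) * R.1 - 1 / (n : ℝ)) 0 with ⟨h, h'⟩ | ⟨h, h'⟩ <;>
    rcases max_cases ((1 - e n) * R.2 - 1 / (n : ℝ)) 0 with ⟨g, g'⟩ | ⟨g, g'⟩ <;>
    rw [h, g] <;> linarith

end CodeSequences

/-! ### The joint law of a block -/

section Block

variable {X₁ X₂ Y Z M₁ M₂ : Type*} [Fintype X₁] [Fintype X₂] [Fintype Y] [Fintype Z] [Fintype M₁]
  [Fintype M₂] (ch : Channel X₁ X₂ Y Z) {n : ℕ}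

theorem Channel.sum_block_eve (u : Fin n → X₁) (v : Fin n → X₂) (y : Fin n → Y) :
    ∑ z, ch.block u v y z = blockKernel ch.bob n u v y :=
  sum_pi_prod fun t z => ch.prob (u t) (v t) (y t, z)

theorem Channel.sum_block_bob (u : Fin n → X₁) (v : Fin n → X₂) (z : Fin n → Z) :
    ∑ y, ch.block u v y z = blockKernel ch.eve n u v z :=
  sum_pi_prod fun t y => ch.prob (u t) (v t) (y, z t)

/-- The joint law of uniform messages, codewords and outputs `((m₁, m₂), (x₁, x₂), y, z)` for a
block code with arbitrary message sets. -/
noncomputable def Channel.blockJoint (ch : Channel X₁ X₂ Y Z) (e₁ : M₁ → (Fin n → X₁) → ℝ)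
    (e₂ : M₂ → (Fin n → X₂) → ℝ) :
    (M₁ × M₂) × ((Fin n → X₁) × (Fin n → X₂)) × (Fin n → Y) × (Fin n → Z) → ℝ :=
  fun ω => (Fintype.card (M₁ × M₂) : ℝ)⁻¹ * (e₁ ω.1.1 ω.2.1.1 * e₂ ω.1.2 ω.2.1.2) *
    ch.block ω.2.1.1 ω.2.1.2 ω.2.2.1 ω.2.2.2

theorem Channel.blockJoint_mem [Nonempty M₁] [Nonempty M₂] {e₁ : M₁ → (Fin n → X₁) → ℝ}
    {e₂ : M₂ → (Fin n → X₂) → ℝ} (h₁ : ∀ m, e₁ m ∈ stdSimplex ℝ (Fin n → X₁))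
    (h₂ : ∀ m, e₂ m ∈ stdSimplex ℝ (Fin n → X₂)) : ch.blockJoint e₁ e₂ ∈ stdSimplex ℝ _ := by
  refine ⟨fun ω => mul_nonneg (mul_nonneg (by positivity) (mul_nonneg ((h₁ _).1 _) ((h₂ _).1 _)))
    (Finset.prod_nonneg fun t _ => (ch.prob_mem _ _).1 _), ?_⟩
  simp only [Channel.blockJoint, Fintype.sum_prod_type, ← Finset.mul_sum, ch.sum_block_eve,
    (blockKernel_mem ch.bob_mem _ _).2, mul_one, (h₂ _).2, (h₁ _).2]
  simp only [Finset.sum_const, Finset.card_univ, nsmul_eq_mul, Fintype.card_prod,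
    Nat.cast_mul]
  field_simp

open Classical in
theorem Channel.sum_blockJoint_error (e₁ : M₁ → (Fin n → X₁) → ℝ) (e₂ : M₂ → (Fin n → X₂) → ℝ)
    (d : (Fin n → Y) → M₁ × M₂) :
    ∑ ω, ch.blockJoint e₁ e₂ ω * (if d ω.2.2.1 ≠ ω.1 then 1 else 0) =
      stochasticError (blockKernel ch.bob n) e₁ e₂ d := by
  obtain ⟨g, hg⟩ : ∃ g : M₁ × M₂ → (Fin n → Y) → ℝ, ∀ m y, (if d y ≠ m then 1 else 0) = g m y :=
    ⟨_, fun _ _ => rfl⟩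
  simp only [stochasticError, hg]
  simp only [Channel.blockJoint, Fintype.sum_prod_type]
  simp only [← Finset.sum_mul, ← Finset.mul_sum, ch.sum_block_eve]
  simp only [mul_assoc, ← Finset.mul_sum, Fintype.card_prod, Nat.cast_mul]

theorem Channel.stochasticError_nonneg {e₁ : M₁ → (Fin n → X₁) → ℝ}
    {e₂ : M₂ → (Fin n → X₂) → ℝ} (h₁ : ∀ m, e₁ m ∈ stdSimplex ℝ (Fin n → X₁))
    (h₂ : ∀ m, e₂ m ∈ stdSimplex ℝ (Fin n → X₂)) (d : (Fin n → Y) → M₁ × M₂) :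
    0 ≤ stochasticError (blockKernel ch.bob n) e₁ e₂ d := by
  classical
  refine mul_nonneg (by positivity) (Finset.sum_nonneg fun m₁ _ => Finset.sum_nonneg fun m₂ _ =>
    Finset.sum_nonneg fun u _ => Finset.sum_nonneg fun v _ => mul_nonneg
    (mul_nonneg ((h₁ _).1 _) ((h₂ _).1 _)) (Finset.sum_nonneg fun o _ => mul_nonneg
    ((blockKernel_mem ch.bob_mem _ _).1 _) (by split_ifs <;> norm_num)))

theorem WiretapCode.errorProb_eq {b₁ b₂ : ℕ} (C : WiretapCode X₁ X₂ Y n b₁ b₂) :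
    C.errorProb ch = stochasticError (blockKernel ch.bob n) C.enc₁ C.enc₂ C.dec := by
  classical
  rw [← ch.sum_blockJoint_error, WiretapCode.errorProb]
  refine Finset.sum_congr rfl fun ω _ => ?_
  by_cases h : C.dec ω.2.2.1 = ω.1 <;> simp only [h, ne_eq, not_true_eq_false, not_false_eq_true,
    if_true, if_false, mul_one, mul_zero]
  rfl

theorem Channel.PositiveSecrecy.bothPositive (h : ch.PositiveSecrecy) : ch.BothPositive := by
  obtain ⟨R₁, hR₁, R₂, hR₂, b₁, b₂, C, hb, herr, -⟩ := h
  refine Channel.AttainedByCodes.bothPositive ch (R := (R₁, R₂)) ⟨_, herr, ?_⟩ hR₁ hR₂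
  filter_upwards [hb] with n hn
  obtain ⟨c₁, c₂, hc⟩ := exists_macError_le (blockKernel ch.bob n) (C n).enc₁_mem (C n).enc₂_mem
    (C n).dec
  exact ⟨b₁ n, b₂ n, c₁, c₂, (C n).dec, hn.1, hn.2, hc.trans_eq ((C n).errorProb_eq ch).symm⟩

end Block

/-! ### The converse for slotted codes -/

section SlottedConverse

variable {X₁ X₂ Y Z : Type*} [Fintype X₁] [Fintype X₂] [Fintype Y] [Fintype Z]
  (ch : Channel X₁ X₂ Y Z) {n : ℕ} {M₁ M₂ : ℕ → Type} [∀ k, Fintype (M₁ k)] [∀ k, Fintype (M₂ k)]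

/-- The family of the first `k + 1` messages, from the first `k` and the last one. -/
def snocEquivNat (M : ℕ → Type*) (k : ℕ) : ((j : Fin k) → M j) × M k ≃ ((j : Fin (k + 1)) → M j) :=
  (Equiv.prodComm _ _).trans (Fin.snocEquiv fun j : Fin (k + 1) => M j)

theorem snocEquivNat_last {M : ℕ → Type*} {k : ℕ} (p : ((j : Fin k) → M j) × M k) :
    snocEquivNat M k p (Fin.last k) = p.2 :=
  Fin.snoc_last (α := fun j : Fin (k + 1) => M j) _ _

theorem snocEquivNat_castSucc {M : ℕ → Type*} {k : ℕ} (p : ((j : Fin k) → M j) × M k) (j : Fin k) :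
    snocEquivNat M k p j.castSucc = p.1 j :=
  Fin.snoc_castSucc (α := fun j : Fin (k + 1) => M j) _ _ _

theorem SlotEncoder.prob_snoc {X : Type*} [Fintype X] {M : ℕ → Type} (E : SlotEncoder X n M)
    (k : ℕ) (w : ((j : Fin k) → M j) × M k) (x : (Fin k → Fin n → X) × (Fin n → X)) :
    E.prob (k + 1) (snocEquivNat M k w) (snocEquivNat (fun _ => Fin n → X) k x) =
      E.prob k w.1 x.1 * E.enc k (snocEquivNat M k w) x.1 x.2 := by
  rw [SlotEncoder.prob, Fin.prod_univ_castSucc, SlotEncoder.prob]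
  congr 1
  · refine Finset.prod_congr rfl fun j _ => ?_
    congr 1
    · funext i
      exact snocEquivNat_castSucc w ⟨i, i.2.trans_le j.2⟩
    · funext i
      exact snocEquivNat_castSucc (M := fun _ => Fin n → X) x ⟨i, i.2.trans j.2⟩
    · exact snocEquivNat_castSucc (M := fun _ => Fin n → X) x j
  · congr 1
    · funext i
      exact snocEquivNat_castSucc (M := fun _ => Fin n → X) x ⟨i, by omega⟩
    · exact snocEquivNat_last (M := fun _ => Fin n → X) x

/-- The sample space of `k + 1` slots as the product of the past and the last slot. -/
def slotEquiv (X₁ X₂ Y Z : Type*) (n : ℕ) (M₁ M₂ : ℕ → Type) (k : ℕ) :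
    ((((j : Fin k) → M₁ j) × ((j : Fin k) → M₂ j)) ×
      ((Fin k → Fin n → X₁) × (Fin k → Fin n → X₂)) ×
      (Fin k → Fin n → Y) × (Fin k → Fin n → Z)) ×
    ((M₁ k × M₂ k) × ((Fin n → X₁) × (Fin n → X₂)) × (Fin n → Y) × (Fin n → Z)) ≃
    (((j : Fin (k + 1)) → M₁ j) × ((j : Fin (k + 1)) → M₂ j)) ×
      ((Fin (k + 1) → Fin n → X₁) × (Fin (k + 1) → Fin n → X₂)) ×
      (Fin (k + 1) → Fin n → Y) × (Fin (k + 1) → Fin n → Z) :=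
  (Equiv.prodProdProdComm _ _ _ _).trans <|
    Equiv.prodCongr
      ((Equiv.prodProdProdComm _ _ _ _).trans ((snocEquivNat M₁ k).prodCongr (snocEquivNat M₂ k)))
      ((Equiv.prodProdProdComm _ _ _ _).trans (Equiv.prodCongr
        ((Equiv.prodProdProdComm _ _ _ _).trans ((snocEquivNat (fun _ => Fin n → X₁) k).prodCongr
          (snocEquivNat (fun _ => Fin n → X₂) k)))
        ((Equiv.prodProdProdComm _ _ _ _).trans ((snocEquivNat (fun _ => Fin n → Y) k).prodCongr
          (snocEquivNat (fun _ => Fin n → Z) k)))))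

theorem SlottedCode.joint_slotEquiv (C : SlottedCode X₁ X₂ Y n M₁ M₂) (k : ℕ) (p) (q) :
    C.joint ch (k + 1) (slotEquiv X₁ X₂ Y Z n M₁ M₂ k (p, q)) =
      C.joint ch k p * ch.blockJoint
        (fun m => C.enc₁.enc k (snocEquivNat M₁ k (p.1.1, m)) p.2.1.1)
        (fun m => C.enc₂.enc k (snocEquivNat M₂ k (p.1.2, m)) p.2.1.2) q := by
  obtain ⟨⟨w₁, w₂⟩, ⟨x₁, x₂⟩, y, z⟩ := p
  obtain ⟨⟨m₁, m₂⟩, ⟨u₁, u₂⟩, y', z'⟩ := q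
  have h₁ := C.enc₁.prob_snoc k (w₁, m₁) (x₁, u₁)
  have h₂ := C.enc₂.prob_snoc k (w₂, m₂) (x₂, u₂)
  have hb : ∏ j, ch.block (snocEquivNat (fun _ => Fin n → X₁) k (x₁, u₁) j)
      (snocEquivNat (fun _ => Fin n → X₂) k (x₂, u₂) j)
      (snocEquivNat (fun _ => Fin n → Y) k (y, y') j)
      (snocEquivNat (fun _ => Fin n → Z) k (z, z') j) =
      (∏ j, ch.block (x₁ j) (x₂ j) (y j) (z j)) * ch.block u₁ u₂ y' z' := by
    rw [Fin.prod_univ_castSucc]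
    congr 1
    · refine Finset.prod_congr rfl fun j _ => ?_
      congr 1
      · exact snocEquivNat_castSucc (M := fun _ => Fin n → X₁) (x₁, u₁) j
      · exact snocEquivNat_castSucc (M := fun _ => Fin n → X₂) (x₂, u₂) j
      · exact snocEquivNat_castSucc (M := fun _ => Fin n → Y) (y, y') j
      · exact snocEquivNat_castSucc (M := fun _ => Fin n → Z) (z, z') j
    · congr 1
      · exact snocEquivNat_last (M := fun _ => Fin n → X₁) (x₁, u₁)
      · exact snocEquivNat_last (M := fun _ => Fin n → X₂) (x₂, u₂)
      · exact snocEquivNat_last (M := fun _ => Fin n → Y) (y, y')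
      · exact snocEquivNat_last (M := fun _ => Fin n → Z) (z, z')
  have hcard : Fintype.card (((j : Fin (k + 1)) → M₁ j) × ((j : Fin (k + 1)) → M₂ j)) =
      Fintype.card (((j : Fin k) → M₁ j) × ((j : Fin k) → M₂ j)) *
        Fintype.card (M₁ k × M₂ k) := by
    rw [← Fintype.card_prod]
    exact Fintype.card_congr (((Equiv.prodProdProdComm _ _ _ _).trans
      ((snocEquivNat M₁ k).prodCongr (snocEquivNat M₂ k))).symm)
  change (Fintype.card _ : ℝ)⁻¹ * (C.enc₁.prob (k + 1) (snocEquivNat M₁ k (w₁, m₁))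
    (snocEquivNat (fun _ => Fin n → X₁) k (x₁, u₁)) * C.enc₂.prob (k + 1)
    (snocEquivNat M₂ k (w₂, m₂)) (snocEquivNat (fun _ => Fin n → X₂) k (x₂, u₂))) *
    ∏ j, ch.block (snocEquivNat (fun _ => Fin n → X₁) k (x₁, u₁) j)
      (snocEquivNat (fun _ => Fin n → X₂) k (x₂, u₂) j)
      (snocEquivNat (fun _ => Fin n → Y) k (y, y') j)
      (snocEquivNat (fun _ => Fin n → Z) k (z, z') j) = _
  rw [h₁, h₂, hb, hcard, Nat.cast_mul, mul_inv]
  simp only [SlottedCode.joint, Channel.blockJoint]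
  ring

theorem SlottedCode.joint_mem [∀ k, Nonempty (M₁ k)] [∀ k, Nonempty (M₂ k)]
    (C : SlottedCode X₁ X₂ Y n M₁ M₂) (K : ℕ) : C.joint ch K ∈ stdSimplex ℝ _ := by
  refine ⟨fun ω => mul_nonneg (mul_nonneg (by positivity) (mul_nonneg
    (Finset.prod_nonneg fun j _ => (C.enc₁.enc_mem _ _ _).1 _)
    (Finset.prod_nonneg fun j _ => (C.enc₂.enc_mem _ _ _).1 _)))
    (Finset.prod_nonneg fun j _ => Finset.prod_nonneg fun t _ => (ch.prob_mem _ _).1 _), ?_⟩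
  induction K with
  | zero =>
    simp [SlottedCode.joint, SlotEncoder.prob]
  | succ k ih =>
    rw [← (slotEquiv X₁ X₂ Y Z n M₁ M₂ k).sum_comp, Fintype.sum_prod_type]
    simp only [C.joint_slotEquiv, ← Finset.mul_sum]
    rw [← ih]
    refine Finset.sum_congr rfl fun p _ => ?_
    rw [(ch.blockJoint_mem (fun m => C.enc₁.enc_mem _ _ _) fun m => C.enc₂.enc_mem _ _ _).2, mul_one]

/-- For some fixed past, the last slot of a slotted code is a good block code. -/
theorem SlottedCode.exists_macError_le [∀ k, Nonempty (M₁ k)] [∀ k, Nonempty (M₂ k)]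
    (C : SlottedCode X₁ X₂ Y n M₁ M₂) (k : ℕ) :
    ∃ (c₁ : M₁ k → Fin n → X₁) (c₂ : M₂ k → Fin n → X₂) (d : (Fin n → Y) → M₁ k × M₂ k),
      macError (blockKernel ch.bob n) c₁ c₂ d ≤ C.errorProb ch k := by
  classical
  have h : C.errorProb ch k = ∑ p, C.joint ch k p * stochasticError (blockKernel ch.bob n)
      (fun m => C.enc₁.enc k (snocEquivNat M₁ k (p.1.1, m)) p.2.1.1)
      (fun m => C.enc₂.enc k (snocEquivNat M₂ k (p.1.2, m)) p.2.1.2)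
      (fun y => C.dec k (snocEquivNat (fun _ => Fin n → Y) k (p.2.2.1, y))) := by
    rw [SlottedCode.errorProb, ← (slotEquiv X₁ X₂ Y Z n M₁ M₂ k).sum_comp, Fintype.sum_prod_type]
    refine Finset.sum_congr rfl fun p _ => ?_
    rw [← ch.sum_blockJoint_error, Finset.mul_sum]
    refine Finset.sum_congr rfl fun q _ => ?_
    rw [C.joint_slotEquiv, mul_ite, mul_one, mul_zero, mul_ite, mul_zero]
    have e₁ : ((slotEquiv X₁ X₂ Y Z n M₁ M₂ k (p, q)).1.1 (Fin.last k),
        (slotEquiv X₁ X₂ Y Z n M₁ M₂ k (p, q)).1.2 (Fin.last k)) = q.1 :=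
      Prod.ext (snocEquivNat_last (p.1.1, q.1.1)) (snocEquivNat_last (p.1.2, q.1.2))
    have e₂ : (slotEquiv X₁ X₂ Y Z n M₁ M₂ k (p, q)).2.2.1 =
      snocEquivNat (fun _ => Fin n → Y) k (p.2.2.1, q.2.2.1) := rfl
    rw [e₁, e₂]
  obtain ⟨p, hp⟩ := exists_le_sum_mul (C.joint_mem ch k) fun p =>
    stochasticError (blockKernel ch.bob n)
      (fun m => C.enc₁.enc k (snocEquivNat M₁ k (p.1.1, m)) p.2.1.1)
      (fun m => C.enc₂.enc k (snocEquivNat M₂ k (p.1.2, m)) p.2.1.2)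
      (fun y => C.dec k (snocEquivNat (fun _ => Fin n → Y) k (p.2.2.1, y)))
  rw [← h] at hp
  obtain ⟨c₁, c₂, hc⟩ := MACWT.exists_macError_le (blockKernel ch.bob n)
    (e₁ := fun m => C.enc₁.enc k (snocEquivNat M₁ k (p.1.1, m)) p.2.1.1)
    (e₂ := fun m => C.enc₂.enc k (snocEquivNat M₂ k (p.1.2, m)) p.2.1.2)
    (fun m => C.enc₁.enc_mem _ _ _) (fun m => C.enc₂.enc_mem _ _ _)
    (fun y => C.dec k (snocEquivNat (fun _ => Fin n → Y) k (p.2.2.1, y)))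
  exact ⟨c₁, c₂, _, hc.trans hp⟩

theorem Channel.Achievable.mem_macRegion {R : ℝ × ℝ} (h : ch.Achievable R)
    (hpos : ch.BothPositive) : R ∈ ch.macRegion := by
  obtain ⟨h₁, h₂, h⟩ := h
  obtain ⟨b₁, b₂, C, herr, -, k₀, hk₀⟩ := h 1 one_pos
  refine Channel.AttainedByCodes.mem_macRegion ch ⟨_, herr k₀, ?_⟩ hpos h₁ h₂
  filter_upwards [hk₀] with n hn
  obtain ⟨c₁, c₂, d, hc⟩ := (C n).exists_macError_le ch k₀
  exact ⟨_, _, c₁, c₂, d, (hn k₀ le_rfl).1, (hn k₀ le_rfl).2, hc⟩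

theorem Channel.secrecyRegion_subset (hpos : ch.BothPositive) : ch.secrecyRegion ⊆ ch.macRegion :=
  closure_minimal (convexHull_min (fun _ h => Channel.Achievable.mem_macRegion ch h hpos)
    ch.convex_macRegion) isClosed_closure

end SlottedConverse

/-! ### Random codebooks -/

section Mean

variable {Ω Ω' : Type*} [Fintype Ω] [Fintype Ω']

/-- The mean of `f` under `p`. -/
def mean (p : Ω → ℝ) (f : Ω → ℝ) : ℝ := ∑ ω, p ω * f ω

variable {p : Ω → ℝ} {f g : Ω → ℝ}

theorem mean_add : mean p (fun ω => f ω + g ω) = mean p f + mean p g := by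
  simp only [mean, mul_add, Finset.sum_add_distrib]

theorem mean_sum {ι : Type*} (s : Finset ι) (f : ι → Ω → ℝ) :
    mean p (fun ω => ∑ i ∈ s, f i ω) = ∑ i ∈ s, mean p (f i) := by
  simp only [mean, Finset.mul_sum]
  exact Finset.sum_comm

theorem mean_const_mul (c : ℝ) : mean p (fun ω => c * f ω) = c * mean p f := by
  simp only [mean, Finset.mul_sum]
  exact Finset.sum_congr rfl fun _ _ => by ring

theorem mean_const (hp : p ∈ stdSimplex ℝ Ω) (c : ℝ) : mean p (fun _ => c) = c := by
  rw [mean, ← Finset.sum_mul, hp.2, one_mul]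

theorem mean_mono (hp : p ∈ stdSimplex ℝ Ω) (h : ∀ ω, p ω ≠ 0 → f ω ≤ g ω) :
    mean p f ≤ mean p g := by
  refine Finset.sum_le_sum fun ω _ => ?_
  by_cases hω : p ω = 0
  · simp [hω]
  · exact mul_le_mul_of_nonneg_left (h ω hω) (hp.1 ω)

theorem mean_congr (h : ∀ ω, f ω = g ω) : mean p f = mean p g := by
  rw [funext h]

theorem mean_comm (p : Ω → ℝ) (q : Ω' → ℝ) (f : Ω → Ω' → ℝ) :
    mean p (fun ω => mean q (f ω)) = mean q (fun ω' => mean p fun ω => f ω ω') := by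
  simp only [mean, Finset.mul_sum]
  rw [Finset.sum_comm]
  exact Finset.sum_congr rfl fun _ _ => Finset.sum_congr rfl fun _ _ => by ring

theorem mean_tripleLaw {A B O : Type*} [Fintype A] [Fintype B] [Fintype O] (W : A → B → O → ℝ)
    (a : A → ℝ) (b : B → ℝ) (f : A → B → O → ℝ) :
    mean (tripleLaw W a b) (fun ω => f ω.1 ω.2.1 ω.2.2) =
      mean a fun u => mean b fun v => mean (W u v) (f u v) := by
  simp only [mean, tripleLaw, Fintype.sum_prod_type, Finset.mul_sum, mul_assoc]

variable {A ι : Type*} [Fintype A] [Fintype ι] [DecidableEq ι] {a : A → ℝ}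

/-- The law of a family of independent letters. -/
def iidLaw (a : A → ℝ) (ι : Type*) [Fintype ι] (c : ι → A) : ℝ := ∏ i, a (c i)

theorem iidLaw_mem (ha : a ∈ stdSimplex ℝ A) : iidLaw a ι ∈ stdSimplex ℝ (ι → A) :=
  pi_mem_stdSimplex fun _ => ha

theorem iidLaw_ne_zero {c : ι → A} (h : iidLaw a ι c ≠ 0) (i : ι) : a (c i) ≠ 0 :=
  Finset.prod_ne_zero_iff.1 h i (Finset.mem_univ i)

theorem mean_iidLaw_eval (ha : a ∈ stdSimplex ℝ A) (i : ι) (φ : A → ℝ) :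
    mean (iidLaw a ι) (fun c => φ (c i)) = mean a φ :=
  sum_pi_mul_eval (J := fun _ => a) (fun _ => ha) i φ

theorem mean_iidLaw_pair (ha : a ∈ stdSimplex ℝ A) {i j : ι} (hij : i ≠ j) (φ : A → A → ℝ) :
    mean (iidLaw a ι) (fun c => φ (c i) (c j)) = mean a fun x => mean a fun y => φ x y := by
  classical
  have h : ∀ y, mean (iidLaw a ι) (fun c => if c j = y then φ (c i) y else 0) =
      a y * mean a fun x => φ x y := fun y => by
    let F : ι → A → ℝ := fun k x =>
      a x * ((if k = i then φ x y else 1) * if k = j then (if x = y then 1 else 0) else 1)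
    have h1 : mean (iidLaw a ι) (fun c => if c j = y then φ (c i) y else 0) =
        ∑ c : ι → A, ∏ k, F k (c k) := by
      refine Finset.sum_congr rfl fun c _ => ?_
      simp only [F, Finset.prod_mul_distrib, Finset.prod_ite_eq', Finset.mem_univ, if_true]
      rw [iidLaw]
      congr 1
      split_ifs <;> simp
    rw [h1, sum_pi_prod, Fintype.prod_eq_mul i j hij]
    · simp [F, hij, hij.symm, mean, mul_comm]
    · rintro k ⟨hk, hk'⟩
      simp [F, hk, hk', ha.2]
  have h2 : ∀ c : ι → A, φ (c i) (c j) = ∑ y, if c j = y then φ (c i) y else 0 := fun c => by simp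
  simp only [h2]
  rw [mean_sum, mean_comm]
  exact Finset.sum_congr rfl fun y _ => h y

end Mean

section OneShot

variable {A B O M₁ M₂ : Type*} [Fintype A] [Fintype B] [Fintype O] [Fintype M₁] [Fintype M₂]
  [DecidableEq M₁] [DecidableEq M₂] {W : A → B → O → ℝ} {a : A → ℝ} {b : B → ℝ}

/-- The mean over two independent codebooks with independent letters. -/
def codeMean (a : A → ℝ) (b : B → ℝ) (M₁ M₂ : Type*) [Fintype M₁] [Fintype M₂] [DecidableEq M₁]
    [DecidableEq M₂] (f : (M₁ → A) → (M₂ → B) → ℝ) : ℝ :=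
  mean (iidLaw a M₁) fun c₁ => mean (iidLaw b M₂) fun c₂ => f c₁ c₂

theorem codeMean_mono (ha : a ∈ stdSimplex ℝ A) (hb : b ∈ stdSimplex ℝ B)
    {f g : (M₁ → A) → (M₂ → B) → ℝ}
    (h : ∀ c₁ c₂, (∀ m, a (c₁ m) ≠ 0) → (∀ m, b (c₂ m) ≠ 0) → f c₁ c₂ ≤ g c₁ c₂) :
    codeMean a b M₁ M₂ f ≤ codeMean a b M₁ M₂ g :=
  mean_mono (iidLaw_mem ha) fun c₁ h₁ => mean_mono (iidLaw_mem hb) fun c₂ h₂ =>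
    h c₁ c₂ (iidLaw_ne_zero h₁) (iidLaw_ne_zero h₂)

theorem codeMean_add (f g : (M₁ → A) → (M₂ → B) → ℝ) :
    codeMean a b M₁ M₂ (fun c₁ c₂ => f c₁ c₂ + g c₁ c₂) =
      codeMean a b M₁ M₂ f + codeMean a b M₁ M₂ g := by
  simp only [codeMean, mean_add]

theorem codeMean_sum {ι : Type*} (s : Finset ι) (f : ι → (M₁ → A) → (M₂ → B) → ℝ) :
    codeMean a b M₁ M₂ (fun c₁ c₂ => ∑ i ∈ s, f i c₁ c₂) = ∑ i ∈ s, codeMean a b M₁ M₂ (f i) := by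
  simp only [codeMean, mean_sum]

theorem codeMean_const_mul (c : ℝ) (f : (M₁ → A) → (M₂ → B) → ℝ) :
    codeMean a b M₁ M₂ (fun c₁ c₂ => c * f c₁ c₂) = c * codeMean a b M₁ M₂ f := by
  simp only [codeMean, mean_const_mul]

theorem codeMean_eval (ha : a ∈ stdSimplex ℝ A) (hb : b ∈ stdSimplex ℝ B) (m₁ : M₁) (m₂ : M₂)
    (φ : A → B → ℝ) : codeMean a b M₁ M₂ (fun c₁ c₂ => φ (c₁ m₁) (c₂ m₂)) =
      mean a fun u => mean b fun v => φ u v := by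
  rw [codeMean, ← mean_iidLaw_eval ha m₁]
  exact mean_congr fun c₁ => mean_iidLaw_eval hb m₂ fun v => φ (c₁ m₁) v

/-- The mean of a function of the codewords of the pairs `(m₁, m₂)` and `(m₁', m₂')`, in the four
cases of coincidence. -/
theorem codeMean_pair (ha : a ∈ stdSimplex ℝ A) (hb : b ∈ stdSimplex ℝ B) (m₁ m₁' : M₁)
    (m₂ m₂' : M₂) (φ : A → A → B → B → ℝ) :
    codeMean a b M₁ M₂ (fun c₁ c₂ => φ (c₁ m₁) (c₁ m₁') (c₂ m₂) (c₂ m₂')) =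
      mean a fun u => mean b fun v =>
        if m₁ = m₁' then (if m₂ = m₂' then φ u u v v else mean b fun v' => φ u u v v')
        else (if m₂ = m₂' then mean a fun u' => φ u u' v v
          else mean a fun u' => mean b fun v' => φ u u' v v') := by
  rw [codeMean]
  have h : ∀ c₁ : M₁ → A, mean (iidLaw b M₂) (fun c₂ => φ (c₁ m₁) (c₁ m₁') (c₂ m₂) (c₂ m₂')) =
      mean b fun v => if m₂ = m₂' then φ (c₁ m₁) (c₁ m₁') v v
        else mean b fun v' => φ (c₁ m₁) (c₁ m₁') v v' := fun c₁ => by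
    by_cases h : m₂ = m₂'
    · subst h
      simp only [if_true]
      exact mean_iidLaw_eval hb m₂ fun v => φ (c₁ m₁) (c₁ m₁') v v
    · simp only [h, if_false]
      exact mean_iidLaw_pair hb h fun v v' => φ (c₁ m₁) (c₁ m₁') v v'
  simp only [h]
  by_cases h₁ : m₁ = m₁'
  · subst h₁
    simp only [if_true]
    exact mean_iidLaw_eval ha m₁ fun u => mean b fun v => if m₂ = m₂' then φ u u v v
        else mean b fun v' => φ u u v v'
  · simp only [h₁, if_false]
    rw [mean_iidLaw_pair ha h₁ fun u u' => mean b fun v => if m₂ = m₂' then φ u u' v v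
        else mean b fun v' => φ u u' v v']
    refine mean_congr fun u => ?_
    rw [mean_comm]
    refine mean_congr fun v => ?_
    split_ifs <;> rfl

theorem exists_le_codeMean (ha : a ∈ stdSimplex ℝ A) (hb : b ∈ stdSimplex ℝ B)
    (f : (M₁ → A) → (M₂ → B) → ℝ) :
    ∃ c₁ c₂, (∀ m, a (c₁ m) ≠ 0) ∧ (∀ m, b (c₂ m) ≠ 0) ∧ f c₁ c₂ ≤ codeMean a b M₁ M₂ f := by
  obtain ⟨c₁, h₁, k₁⟩ := exists_ne_zero_le_sum_mul (iidLaw_mem (ι := M₁) ha) fun c₁ =>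
    mean (iidLaw b M₂) fun c₂ => f c₁ c₂
  obtain ⟨c₂, h₂, k₂⟩ := exists_ne_zero_le_sum_mul (iidLaw_mem (ι := M₂) hb) fun c₂ => f c₁ c₂
  exact ⟨c₁, c₂, iidLaw_ne_zero h₁, iidLaw_ne_zero h₂, k₂.trans k₁⟩

/-! ### Random coding: the error probability -/

/-- All three likelihood ratios of the codeword pair `(u, v)` exceed their thresholds. -/
def Typical (W : A → B → O → ℝ) (a : A → ℝ) (b : B → ℝ) (T₁ T₂ T₃ : ℝ) (u : A) (v : B) (o : O) :
    Prop :=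
  T₁ * avgLeft W a v o < W u v o ∧ T₂ * avgRight W b u o < W u v o ∧
    T₃ * avgBoth W a b o < W u v o

open Classical in
/-- The decoder that looks for a message pair whose codewords pass the threshold test. -/
noncomputable def thresholdDecoder [Nonempty M₁] [Nonempty M₂] (W : A → B → O → ℝ) (a : A → ℝ)
    (b : B → ℝ) (T₁ T₂ T₃ : ℝ) (c₁ : M₁ → A) (c₂ : M₂ → B) (o : O) : M₁ × M₂ :=
  if h : ∃ m : M₁ × M₂, Typical W a b T₁ T₂ T₃ (c₁ m.1) (c₂ m.2) o then h.choose
  else Classical.arbitrary _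

open Classical in
theorem thresholdDecoder_error_le [Nonempty M₁] [Nonempty M₂] (T₁ T₂ T₃ : ℝ) (c₁ : M₁ → A)
    (c₂ : M₂ → B) (o : O) (m₁ : M₁) (m₂ : M₂) :
    (if thresholdDecoder W a b T₁ T₂ T₃ c₁ c₂ o ≠ (m₁, m₂) then (1 : ℝ) else 0) ≤
      (if Typical W a b T₁ T₂ T₃ (c₁ m₁) (c₂ m₂) o then 0 else 1) +
      ((∑ m₁' ∈ Finset.univ.erase m₁,
        if T₁ * avgLeft W a (c₂ m₂) o < W (c₁ m₁') (c₂ m₂) o then 1 else 0) +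
      (∑ m₂' ∈ Finset.univ.erase m₂,
        if T₂ * avgRight W b (c₁ m₁) o < W (c₁ m₁) (c₂ m₂') o then 1 else 0) +
      ∑ m₁' ∈ Finset.univ.erase m₁, ∑ m₂' ∈ Finset.univ.erase m₂,
        if T₃ * avgBoth W a b o < W (c₁ m₁') (c₂ m₂') o then 1 else 0) := by
  have n₁ : ∀ m₁', (0 : ℝ) ≤
      if T₁ * avgLeft W a (c₂ m₂) o < W (c₁ m₁') (c₂ m₂) o then 1 else 0 := fun _ => by
    split_ifs <;> norm_num
  have n₂ : ∀ m₂', (0 : ℝ) ≤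
      if T₂ * avgRight W b (c₁ m₁) o < W (c₁ m₁) (c₂ m₂') o then 1 else 0 := fun _ => by
    split_ifs <;> norm_num
  have n₃ : ∀ m₁' m₂', (0 : ℝ) ≤
      if T₃ * avgBoth W a b o < W (c₁ m₁') (c₂ m₂') o then 1 else 0 := fun _ _ => by
    split_ifs <;> norm_num
  have s₁ := Finset.sum_nonneg fun m₁' (_ : m₁' ∈ Finset.univ.erase m₁) => n₁ m₁'
  have s₂ := Finset.sum_nonneg fun m₂' (_ : m₂' ∈ Finset.univ.erase m₂) => n₂ m₂'
  have s₃ := Finset.sum_nonneg fun m₁' (_ : m₁' ∈ Finset.univ.erase m₁) => Finset.sum_nonneg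
    fun m₂' (_ : m₂' ∈ Finset.univ.erase m₂) => n₃ m₁' m₂'
  by_cases ht : Typical W a b T₁ T₂ T₃ (c₁ m₁) (c₂ m₂) o
  swap
  · rw [if_neg ht]
    have : (if thresholdDecoder W a b T₁ T₂ T₃ c₁ c₂ o ≠ (m₁, m₂) then (1 : ℝ) else 0) ≤ 1 := by
      split_ifs <;> norm_num
    linarith
  rw [if_pos ht]
  split_ifs with hd
  swap
  · linarith
  have hex : ∃ m : M₁ × M₂, Typical W a b T₁ T₂ T₃ (c₁ m.1) (c₂ m.2) o := ⟨(m₁, m₂), ht⟩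
  obtain ⟨m, hm, hne⟩ : ∃ m : M₁ × M₂, Typical W a b T₁ T₂ T₃ (c₁ m.1) (c₂ m.2) o ∧
      m ≠ (m₁, m₂) := by
    refine ⟨_, hex.choose_spec, ?_⟩
    rwa [thresholdDecoder, dif_pos hex] at hd
  obtain ⟨k₁, k₂⟩ := m
  by_cases h₁ : k₁ = m₁
  · have h₂ : k₂ ≠ m₂ := fun h => hne (by rw [h₁, h])
    subst h₁
    have := Finset.single_le_sum (fun m₂' (_ : m₂' ∈ Finset.univ.erase m₂) => n₂ m₂')
      (Finset.mem_erase.2 ⟨h₂, Finset.mem_univ _⟩)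
    rw [if_pos hm.2.1] at this
    linarith
  · by_cases h₂ : k₂ = m₂
    · subst h₂
      have := Finset.single_le_sum (fun m₁' (_ : m₁' ∈ Finset.univ.erase m₁) => n₁ m₁')
        (Finset.mem_erase.2 ⟨h₁, Finset.mem_univ _⟩)
      rw [if_pos hm.1] at this
      linarith
    · have := Finset.single_le_sum (fun m₁' (_ : m₁' ∈ Finset.univ.erase m₁) => Finset.sum_nonneg
        fun m₂' (_ : m₂' ∈ Finset.univ.erase m₂) => n₃ m₁' m₂')
        (Finset.mem_erase.2 ⟨h₁, Finset.mem_univ _⟩)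
      have h' := Finset.single_le_sum (fun m₂' (_ : m₂' ∈ Finset.univ.erase m₂) => n₃ k₁ m₂')
        (Finset.mem_erase.2 ⟨h₂, Finset.mem_univ _⟩)
      rw [if_pos hm.2.2] at h'
      linarith

/-- Markov's inequality: under an independent output law `q`, a likelihood ratio exceeds `T` with
probability at most `1 / T`. -/
theorem mean_threshold_le {q w : O → ℝ} (hw : w ∈ stdSimplex ℝ O) {T : ℝ}
    (hT : 0 < T) [∀ o, Decidable (T * q o < w o)] :
    mean q (fun o => if T * q o < w o then 1 else 0) ≤ 1 / T := by
  rw [mean, show 1 / T = ∑ o, w o / T by rw [← Finset.sum_div, hw.2]]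
  refine Finset.sum_le_sum fun o _ => ?_
  rw [le_div_iff₀ hT]
  split_ifs with h
  · linarith
  · simpa using hw.1 o

open Classical in
theorem codeMean_macError_le [Nonempty M₁] [Nonempty M₂] (hW : ∀ u v, W u v ∈ stdSimplex ℝ O)
    (ha : a ∈ stdSimplex ℝ A) (hb : b ∈ stdSimplex ℝ B) {T₁ T₂ T₃ : ℝ} (hT₁ : 0 < T₁)
    (hT₂ : 0 < T₂) (hT₃ : 0 < T₃) :
    codeMean a b M₁ M₂ (fun c₁ c₂ => macError W c₁ c₂ (thresholdDecoder W a b T₁ T₂ T₃ c₁ c₂)) ≤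
      mean (tripleLaw W a b) (fun ω => if Typical W a b T₁ T₂ T₃ ω.1 ω.2.1 ω.2.2 then 0 else 1) +
        (Fintype.card M₁ / T₁ + Fintype.card M₂ / T₂ +
          (Fintype.card M₁ * Fintype.card M₂ : ℝ) / T₃) := by
  set F := mean (tripleLaw W a b)
    (fun ω => if Typical W a b T₁ T₂ T₃ ω.1 ω.2.1 ω.2.2 then 0 else 1) +
        (Fintype.card M₁ / T₁ + Fintype.card M₂ / T₂ +
          (Fintype.card M₁ * Fintype.card M₂ : ℝ) / T₃) with hF
  have main : ∀ m₁ m₂, codeMean a b M₁ M₂ (fun c₁ c₂ => mean (W (c₁ m₁) (c₂ m₂)) fun o =>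
      if thresholdDecoder W a b T₁ T₂ T₃ c₁ c₂ o ≠ (m₁, m₂) then 1 else 0) ≤ F := by
    intro m₁ m₂
    refine (codeMean_mono ha hb fun c₁ c₂ _ _ => mean_mono (hW _ _) fun o _ =>
      thresholdDecoder_error_le T₁ T₂ T₃ c₁ c₂ o m₁ m₂).trans ?_
    simp only [mean_add, mean_sum, codeMean_add, codeMean_sum]
    refine add_le_add (le_of_eq ?_) (add_le_add (add_le_add ?_ ?_) ?_)
    · rw [codeMean_eval ha hb m₁ m₂ fun u v => mean (W u v) fun o =>
        if Typical W a b T₁ T₂ T₃ u v o then 0 else 1]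
      exact (mean_tripleLaw W a b fun u v o => if Typical W a b T₁ T₂ T₃ u v o then 0 else 1).symm
    · have h : ∀ m₁' ∈ Finset.univ.erase m₁, codeMean a b M₁ M₂ (fun c₁ c₂ =>
          mean (W (c₁ m₁) (c₂ m₂)) fun o =>
            if T₁ * avgLeft W a (c₂ m₂) o < W (c₁ m₁') (c₂ m₂) o then 1 else 0) ≤ 1 / T₁ := by
        intro m₁' hm
        rw [codeMean_pair ha hb m₁ m₁' m₂ m₂ fun u u' v _ => mean (W u v) fun o =>
            if T₁ * avgLeft W a v o < W u' v o then 1 else 0]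
        simp only [(Finset.ne_of_mem_erase hm).symm, if_false, if_true]
        rw [mean_comm, ← mean_const hb (1 / T₁)]
        refine mean_mono hb fun v _ => ?_
        rw [mean_comm, ← mean_const ha (1 / T₁)]
        refine mean_mono ha fun u' _ => le_trans (le_of_eq ?_)
          (mean_threshold_le (q := avgLeft W a v) (hW u' v) hT₁)
        simp only [mean, avgLeft, Finset.sum_mul, Finset.mul_sum]
        rw [Finset.sum_comm]
        exact Finset.sum_congr rfl fun o _ => Finset.sum_congr rfl fun u _ => by ring
      refine (Finset.sum_le_sum h).trans ?_
      rw [Finset.sum_const, nsmul_eq_mul, mul_one_div]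
      gcongr
      exact Finset.card_le_univ _
    · have h : ∀ m₂' ∈ Finset.univ.erase m₂, codeMean a b M₁ M₂ (fun c₁ c₂ =>
          mean (W (c₁ m₁) (c₂ m₂)) fun o =>
            if T₂ * avgRight W b (c₁ m₁) o < W (c₁ m₁) (c₂ m₂') o then 1 else 0) ≤ 1 / T₂ := by
        intro m₂' hm
        rw [codeMean_pair ha hb m₁ m₁ m₂ m₂' fun u _ v v' => mean (W u v) fun o =>
            if T₂ * avgRight W b u o < W u v' o then 1 else 0]
        simp only [(Finset.ne_of_mem_erase hm).symm, if_false, if_true]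
        rw [← mean_const ha (1 / T₂)]
        refine mean_mono ha fun u _ => ?_
        rw [mean_comm, ← mean_const hb (1 / T₂)]
        refine mean_mono hb fun v' _ => le_trans (le_of_eq ?_)
          (mean_threshold_le (q := avgRight W b u) (hW u v') hT₂)
        simp only [mean, avgRight, Finset.sum_mul, Finset.mul_sum]
        rw [Finset.sum_comm]
        exact Finset.sum_congr rfl fun o _ => Finset.sum_congr rfl fun u _ => by ring
      refine (Finset.sum_le_sum h).trans ?_
      rw [Finset.sum_const, nsmul_eq_mul, mul_one_div]
      gcongr
      exact Finset.card_le_univ _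
    · have h : ∀ m₁' ∈ Finset.univ.erase m₁, ∀ m₂' ∈ Finset.univ.erase m₂,
          codeMean a b M₁ M₂ (fun c₁ c₂ => mean (W (c₁ m₁) (c₂ m₂)) fun o =>
            if T₃ * avgBoth W a b o < W (c₁ m₁') (c₂ m₂') o then 1 else 0) ≤ 1 / T₃ := by
        intro m₁' hm₁ m₂' hm₂
        rw [codeMean_pair ha hb m₁ m₁' m₂ m₂' fun u u' v v' => mean (W u v) fun o =>
            if T₃ * avgBoth W a b o < W u' v' o then 1 else 0]
        simp only [(Finset.ne_of_mem_erase hm₁).symm, (Finset.ne_of_mem_erase hm₂).symm, if_false]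
        have hswap : (mean a fun u => mean b fun v => mean a fun u' => mean b fun v' =>
            mean (W u v) fun o => if T₃ * avgBoth W a b o < W u' v' o then 1 else 0) =
            mean a fun u' => mean b fun v' => mean (avgBoth W a b) fun o =>
              if T₃ * avgBoth W a b o < W u' v' o then 1 else 0 := by
          calc _ = mean a fun u => mean a fun u' => mean b fun v => mean b fun v' =>
                mean (W u v) fun o => if T₃ * avgBoth W a b o < W u' v' o then 1 else 0 :=
                mean_congr fun u => by rw [mean_comm]
            _ = mean a fun u' => mean a fun u => mean b fun v' => mean b fun v =>
                mean (W u v) fun o => if T₃ * avgBoth W a b o < W u' v' o then 1 else 0 := by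
                rw [mean_comm]
                exact mean_congr fun u' => mean_congr fun u => by rw [mean_comm]
            _ = mean a fun u' => mean b fun v' => mean a fun u => mean b fun v =>
                mean (W u v) fun o => if T₃ * avgBoth W a b o < W u' v' o then 1 else 0 :=
                mean_congr fun u' => by rw [mean_comm]
            _ = _ := by
                refine mean_congr fun u' => mean_congr fun v' => ?_
                simp only [mean, avgBoth, avgRight, Finset.sum_mul, Finset.mul_sum]
                rw [Finset.sum_comm' (t' := Finset.univ) (s' := fun _ => Finset.univ) (by simp)]
                rw [Finset.sum_comm]
                rw [Finset.sum_congr rfl fun u _ => Finset.sum_comm]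
                rw [Finset.sum_comm]
                exact Finset.sum_congr rfl fun o _ => Finset.sum_congr rfl fun u _ =>
                  Finset.sum_congr rfl fun v _ => by ring
        rw [hswap, ← mean_const ha (1 / T₃)]
        refine mean_mono ha fun u' _ => ?_
        rw [← mean_const hb (1 / T₃)]
        exact mean_mono hb fun v' _ => mean_threshold_le (q := avgBoth W a b) (hW u' v') hT₃
      refine (Finset.sum_le_sum fun m₁' h₁ => Finset.sum_le_sum fun m₂' h₂ =>
        h m₁' h₁ m₂' h₂).trans ?_
      simp only [Finset.sum_const, nsmul_eq_mul, mul_one_div]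
      rw [mul_div_assoc']
      gcongr
      · exact Finset.card_le_univ _
      · exact Finset.card_le_univ _
  have hm : ∀ (c₁ : M₁ → A) (c₂ : M₂ → B), macError W c₁ c₂ (thresholdDecoder W a b T₁ T₂ T₃ c₁ c₂) =
      ((Fintype.card M₁ : ℝ) * Fintype.card M₂)⁻¹ * ∑ m₁, ∑ m₂, mean (W (c₁ m₁) (c₂ m₂)) fun o =>
        if thresholdDecoder W a b T₁ T₂ T₃ c₁ c₂ o ≠ (m₁, m₂) then 1 else 0 := fun c₁ c₂ => by
    rw [macError]
    congr! 1
    refine Finset.sum_congr rfl fun _ _ => Finset.sum_congr rfl fun _ _ =>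
      Finset.sum_congr rfl fun _ _ => ?_
    congr
  simp only [hm, codeMean_const_mul, codeMean_sum]
  rw [inv_mul_le_iff₀ (by positivity)]
  refine (Finset.sum_le_sum fun m₁ _ => Finset.sum_le_sum fun m₂ _ => main m₁ m₂).trans
    (le_of_eq ?_)
  simp only [Finset.sum_const, Finset.card_univ, nsmul_eq_mul, mul_assoc]

end OneShot

/-! ### Random coding: the output law at Eve -/

section Resolvability

variable {A B O : Type*} [Fintype A] [Fintype B] [Fintype O] {V : A → B → O → ℝ}
  {a : A → ℝ} {b : B → ℝ} {S₁ S₂ L₁ L₂ : Type*} [Fintype S₁] [Fintype S₂] [Fintype L₁] [Fintype L₂]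

/-- The output law for uniformly chosen codewords. -/
noncomputable def mixture (V : A → B → O → ℝ) (c₁ : L₁ → A) (c₂ : L₂ → B) (o : O) : ℝ :=
  ((Fintype.card L₁ : ℝ) * Fintype.card L₂)⁻¹ * ∑ l₁, ∑ l₂, V (c₁ l₁) (c₂ l₂) o

/-- The relative entropy (in nats) of the output law for uniformly chosen codewords with respect to
`Q`. -/
noncomputable def outputDivergence (V : A → B → O → ℝ) (Q : O → ℝ) (c₁ : L₁ → A) (c₂ : L₂ → B) : ℝ :=
  ∑ o, mixture V c₁ c₂ o * (Real.log (mixture V c₁ c₂ o) - Real.log (Q o))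

/-- A bound for the mean likelihood ratio of the output law of a random codebook with `N₁` and `N₂`
codewords with respect to `avgBoth`, given one codeword pair and the output. The summands stand for
the pairs that share neither, both, the first or the second codeword with the given one. -/
noncomputable def mixtureRatio (V : A → B → O → ℝ) (a : A → ℝ) (b : B → ℝ) (N₁ N₂ : ℝ) (u : A)
    (v : B) (o : O) : ℝ :=
  1 + V u v o / (N₁ * N₂ * avgBoth V a b o) + avgRight V b u o / (N₁ * avgBoth V a b o) +
    avgLeft V a v o / (N₂ * avgBoth V a b o)

theorem mixture_pos (hV : ∀ u v, V u v ∈ stdSimplex ℝ O) (c₁ : L₁ → A) (c₂ : L₂ → B) {o : O}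
    {l₁ : L₁} {l₂ : L₂} (h : V (c₁ l₁) (c₂ l₂) o ≠ 0) : 0 < mixture V c₁ c₂ o := by
  have : Nonempty L₁ := ⟨l₁⟩
  have : Nonempty L₂ := ⟨l₂⟩
  refine mul_pos (by positivity) ?_
  refine (((hV _ _).1 _).lt_of_ne' h).trans_le ?_
  refine le_trans ?_ (Finset.single_le_sum (f := fun l₁ => ∑ l₂, V (c₁ l₁) (c₂ l₂) o)
    (fun _ _ => Finset.sum_nonneg fun _ _ => (hV _ _).1 _) (Finset.mem_univ l₁))
  exact Finset.single_le_sum (f := fun l₂ => V (c₁ l₁) (c₂ l₂) o)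
    (fun _ _ => (hV _ _).1 _) (Finset.mem_univ l₂)

theorem outputDivergence_eq (V : A → B → O → ℝ) (Q : O → ℝ) (c₁ : L₁ → A) (c₂ : L₂ → B) :
    outputDivergence V Q c₁ c₂ = ((Fintype.card L₁ : ℝ) * Fintype.card L₂)⁻¹ *
      ∑ l₁, ∑ l₂, mean (V (c₁ l₁) (c₂ l₂)) fun o =>
        Real.log (mixture V c₁ c₂ o) - Real.log (Q o) := by
  have h : ∀ o, mixture V c₁ c₂ o * (Real.log (mixture V c₁ c₂ o) - Real.log (Q o)) =
      ((Fintype.card L₁ : ℝ) * Fintype.card L₂)⁻¹ * ∑ l₁, ∑ l₂, V (c₁ l₁) (c₂ l₂) o *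
        (Real.log (mixture V c₁ c₂ o) - Real.log (Q o)) := fun o => by
    rw [mixture, mul_assoc]
    simp only [Finset.sum_mul]
  simp only [outputDivergence, h, mean]
  rw [← Finset.mul_sum, Finset.sum_comm]
  congr 1
  exact Finset.sum_congr rfl fun l₁ _ => Finset.sum_comm

variable [DecidableEq S₁] [DecidableEq S₂] [DecidableEq L₁] [DecidableEq L₂]

theorem mixtureRatio_pos (hV : ∀ u v, V u v ∈ stdSimplex ℝ O) (ha : a ∈ stdSimplex ℝ A)
    (hb : b ∈ stdSimplex ℝ B) {N₁ N₂ : ℝ} (h₁ : 0 ≤ N₁) (h₂ : 0 ≤ N₂) (u : A) (v : B) (o : O) :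
    0 < mixtureRatio V a b N₁ N₂ u v o := by
  have q := (avgBoth_mem hV ha hb).1 o
  have l := (avgLeft_mem hV ha v).1 o
  have r := (avgRight_mem hV hb u).1 o
  have w := (hV u v).1 o
  unfold mixtureRatio
  positivity

/-- Given one codeword pair and the output, the likelihood ratio of the mixture has conditional mean at
most `mixtureRatio`. -/
theorem codeMean_mixture_le [Nonempty L₁] [Nonempty L₂] (hV : ∀ u v, V u v ∈ stdSimplex ℝ O)
    (ha : a ∈ stdSimplex ℝ A) (hb : b ∈ stdSimplex ℝ B) (s₁ : S₁) (s₂ : S₂) (l₁ : L₁) (l₂ : L₂) :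
    codeMean a b (S₁ × L₁) (S₂ × L₂) (fun c₁ c₂ => mean (V (c₁ (s₁, l₁)) (c₂ (s₂, l₂))) fun o =>
      mixture V (fun l => c₁ (s₁, l)) (fun l => c₂ (s₂, l)) o / (avgBoth V a b o *
        mixtureRatio V a b (Fintype.card L₁) (Fintype.card L₂) (c₁ (s₁, l₁)) (c₂ (s₂, l₂)) o)) ≤ 1 := by
  set t := mixtureRatio V a b (Fintype.card L₁) (Fintype.card L₂) with ht
  set Q := avgBoth V a b with hQ
  set D : ℝ := (Fintype.card L₁ : ℝ) * Fintype.card L₂ with hD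
  have hD0 : 0 < D := by positivity
  let h : L₁ → L₂ → A → B → O → ℝ := fun k₁ k₂ u v o =>
    if l₁ = k₁ then (if l₂ = k₂ then V u v o else avgRight V b u o)
    else if l₂ = k₂ then avgLeft V a v o else Q o
  have e1 : ∀ (c₁ : S₁ × L₁ → A) (c₂ : S₂ × L₂ → B),
      mean (V (c₁ (s₁, l₁)) (c₂ (s₂, l₂))) (fun o =>
        mixture V (fun l => c₁ (s₁, l)) (fun l => c₂ (s₂, l)) o /
          (Q o * t (c₁ (s₁, l₁)) (c₂ (s₂, l₂)) o)) =
      ∑ k₁, ∑ k₂, mean (V (c₁ (s₁, l₁)) (c₂ (s₂, l₂))) fun o => V (c₁ (s₁, k₁)) (c₂ (s₂, k₂)) o *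
        (D⁻¹ * (Q o * t (c₁ (s₁, l₁)) (c₂ (s₂, l₂)) o)⁻¹) := fun c₁ c₂ => by
    simp only [← mean_sum]
    refine mean_congr fun o => ?_
    simp only [mixture, ← Finset.sum_mul]
    rw [← hD]
    ring
  have e2 : ∀ k₁ k₂, codeMean a b (S₁ × L₁) (S₂ × L₂) (fun c₁ c₂ =>
      mean (V (c₁ (s₁, l₁)) (c₂ (s₂, l₂))) fun o => V (c₁ (s₁, k₁)) (c₂ (s₂, k₂)) o *
        (D⁻¹ * (Q o * t (c₁ (s₁, l₁)) (c₂ (s₂, l₂)) o)⁻¹)) =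
      mean a fun u => mean b fun v => mean (V u v) fun o =>
        h k₁ k₂ u v o * (D⁻¹ * (Q o * t u v o)⁻¹) := by
    intro k₁ k₂
    rw [codeMean_pair ha hb (s₁, l₁) (s₁, k₁) (s₂, l₂) (s₂, k₂) fun u u' v v' => mean (V u v) fun o =>
      V u' v' o * (D⁻¹ * (Q o * t u v o)⁻¹)]
    refine mean_congr fun u => mean_congr fun v => ?_
    have hR : mean b (fun v' => mean (V u v) fun o => V u v' o * (D⁻¹ * (Q o * t u v o)⁻¹)) =
        mean (V u v) fun o => avgRight V b u o * (D⁻¹ * (Q o * t u v o)⁻¹) := by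
      rw [mean_comm]
      refine mean_congr fun o => ?_
      simp only [mean, avgRight, Finset.sum_mul, mul_assoc]
    have hL : mean a (fun u' => mean (V u v) fun o => V u' v o * (D⁻¹ * (Q o * t u v o)⁻¹)) =
        mean (V u v) fun o => avgLeft V a v o * (D⁻¹ * (Q o * t u v o)⁻¹) := by
      rw [mean_comm]
      refine mean_congr fun o => ?_
      simp only [mean, avgLeft, Finset.sum_mul, mul_assoc]
    have hB : mean a (fun u' => mean b fun v' => mean (V u v) fun o =>
        V u' v' o * (D⁻¹ * (Q o * t u v o)⁻¹)) =
        mean (V u v) fun o => Q o * (D⁻¹ * (Q o * t u v o)⁻¹) := by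
      have : ∀ u', (mean b fun v' => mean (V u v) fun o =>
          V u' v' o * (D⁻¹ * (Q o * t u v o)⁻¹)) =
          mean (V u v) fun o => avgRight V b u' o * (D⁻¹ * (Q o * t u v o)⁻¹) := fun u' => by
        rw [mean_comm]
        refine mean_congr fun o => ?_
        simp only [mean, avgRight, Finset.sum_mul, mul_assoc]
      simp only [this]
      rw [mean_comm]
      refine mean_congr fun o => ?_
      simp only [mean, hQ, avgBoth, Finset.sum_mul, mul_assoc]
    simp only [Prod.mk.injEq, true_and, h]
    split_ifs
    · rfl
    · exact hR
    · exact hL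
    · exact hB
  simp only [e1, codeMean_sum, e2]
  simp only [← mean_sum, ← Finset.sum_mul]
  rw [← mean_tripleLaw V a b fun u v o =>
    (∑ k₁, ∑ k₂, h k₁ k₂ u v o) * (D⁻¹ * (Q o * t u v o)⁻¹), ← mean_const (tripleLaw_mem hV ha hb) 1]
  refine mean_mono (tripleLaw_mem hV ha hb) fun ω hω => ?_
  obtain ⟨k1, k2, k3⟩ := tripleLaw_ne_zero hω
  obtain ⟨u, v, o⟩ := ω
  have q : 0 < Q o := avgBoth_pos hV ha hb k1 k2 k3
  have l := (avgLeft_mem hV ha v).1 o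
  have r := (avgRight_mem hV hb u).1 o
  have w := (hV u v).1 o
  have ht0 : 0 < t u v o := mixtureRatio_pos hV ha hb (by positivity) (by positivity) u v o
  have hh : ∀ k₁ k₂, h k₁ k₂ u v o ≤ (if l₁ = k₁ then (if l₂ = k₂ then V u v o else 0) else 0) +
      (if l₁ = k₁ then avgRight V b u o else 0) + (if l₂ = k₂ then avgLeft V a v o else 0) +
      Q o := fun k₁ k₂ => by
    simp only [h]
    split_ifs <;> linarith
  have hsum : ∑ k₁, ∑ k₂, h k₁ k₂ u v o ≤ D * (Q o * t u v o) := by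
    refine (Finset.sum_le_sum fun k₁ _ => Finset.sum_le_sum fun k₂ _ => hh k₁ k₂).trans
      (le_of_eq ?_)
    simp only [Finset.sum_add_distrib, Finset.sum_ite_irrel, Finset.sum_ite_eq, Finset.mem_univ,
      if_true, Finset.sum_const, Finset.card_univ, nsmul_eq_mul]
    simp only [mul_zero, Finset.sum_ite_eq, Finset.mem_univ, if_true]
    simp only [ht, mixtureRatio, hD, ← hQ]
    field_simp
    ring
  dsimp only
  rw [← mul_inv, ← div_eq_mul_inv]
  exact (div_le_one (by positivity)).2 hsum

/-- Soft covering: the mean relative entropy of the output law of a random codebook. The concavity of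
the logarithm is used through its tangent at `mixtureRatio`. -/
theorem codeMean_outputDivergence_le [Nonempty L₁] [Nonempty L₂]
    (hV : ∀ u v, V u v ∈ stdSimplex ℝ O) (ha : a ∈ stdSimplex ℝ A) (hb : b ∈ stdSimplex ℝ B)
    (s₁ : S₁) (s₂ : S₂) :
    codeMean a b (S₁ × L₁) (S₂ × L₂) (fun c₁ c₂ => outputDivergence V (avgBoth V a b)
      (fun l => c₁ (s₁, l)) fun l => c₂ (s₂, l)) ≤
      mean (tripleLaw V a b) fun ω =>
        Real.log (mixtureRatio V a b (Fintype.card L₁) (Fintype.card L₂) ω.1 ω.2.1 ω.2.2) := by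
  set t := mixtureRatio V a b (Fintype.card L₁) (Fintype.card L₂) with ht
  set Q := avgBoth V a b with hQ
  set F := mean (tripleLaw V a b) fun ω => Real.log (t ω.1 ω.2.1 ω.2.2) with hF
  simp only [outputDivergence_eq, codeMean_const_mul, codeMean_sum]
  rw [inv_mul_le_iff₀ (by positivity)]
  have main : ∀ l₁ l₂, codeMean a b (S₁ × L₁) (S₂ × L₂) (fun c₁ c₂ =>
      mean (V (c₁ (s₁, l₁)) (c₂ (s₂, l₂))) fun o =>
        Real.log (mixture V (fun l => c₁ (s₁, l)) (fun l => c₂ (s₂, l)) o) - Real.log (Q o)) ≤ F := by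
    intro l₁ l₂
    have step : codeMean a b (S₁ × L₁) (S₂ × L₂) (fun c₁ c₂ =>
      mean (V (c₁ (s₁, l₁)) (c₂ (s₂, l₂))) fun o =>
        Real.log (mixture V (fun l => c₁ (s₁, l)) (fun l => c₂ (s₂, l)) o) - Real.log (Q o)) ≤
      codeMean a b (S₁ × L₁) (S₂ × L₂) (fun c₁ c₂ =>
        mean (V (c₁ (s₁, l₁)) (c₂ (s₂, l₂))) (fun o => Real.log (t (c₁ (s₁, l₁)) (c₂ (s₂, l₂)) o)) +
        mean (V (c₁ (s₁, l₁)) (c₂ (s₂, l₂))) (fun o =>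
          mixture V (fun l => c₁ (s₁, l)) (fun l => c₂ (s₂, l)) o /
            (Q o * t (c₁ (s₁, l₁)) (c₂ (s₂, l₂)) o)) +
        mean (V (c₁ (s₁, l₁)) (c₂ (s₂, l₂))) (fun _ => -1)) := by
      refine codeMean_mono ha hb fun c₁ c₂ h₁ h₂ => ?_
      rw [← mean_add, ← mean_add]
      refine mean_mono (hV _ _) fun o ho => ?_
      have q : 0 < Q o := avgBoth_pos hV ha hb (h₁ _) (h₂ _) ho
      have ht0 : 0 < t (c₁ (s₁, l₁)) (c₂ (s₂, l₂)) o :=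
        mixtureRatio_pos hV ha hb (by positivity) (by positivity) _ _ o
      have hm : 0 < mixture V (fun l => c₁ (s₁, l)) (fun l => c₂ (s₂, l)) o :=
        mixture_pos hV (fun l => c₁ (s₁, l)) (fun l => c₂ (s₂, l)) ho
      have := Real.log_le_sub_one_of_pos (div_pos hm (mul_pos q ht0))
      rw [Real.log_div hm.ne' (mul_pos q ht0).ne', Real.log_mul q.ne' ht0.ne'] at this
      linarith
    refine step.trans ?_
    rw [codeMean_add, codeMean_add]
    have k1 := codeMean_mixture_le hV ha hb s₁ s₂ l₁ l₂
    have k2 : codeMean a b (S₁ × L₁) (S₂ × L₂) (fun c₁ c₂ =>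
        mean (V (c₁ (s₁, l₁)) (c₂ (s₂, l₂))) (fun _ => -1)) = -1 := by
      simp only [codeMean, mean_const (hV _ _), mean_const (iidLaw_mem hb),
        mean_const (iidLaw_mem ha)]
    have k3 : codeMean a b (S₁ × L₁) (S₂ × L₂) (fun c₁ c₂ =>
        mean (V (c₁ (s₁, l₁)) (c₂ (s₂, l₂)))
          (fun o => Real.log (t (c₁ (s₁, l₁)) (c₂ (s₂, l₂)) o))) = F := by
      rw [codeMean_eval ha hb (s₁, l₁) (s₂, l₂) fun u v => mean (V u v) fun o => Real.log (t u v o),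
        hF, mean_tripleLaw V a b fun u v o => Real.log (t u v o)]
    rw [k2, k3]
    linarith
  refine (Finset.sum_le_sum fun l₁ _ => Finset.sum_le_sum fun l₂ _ => main l₁ l₂).trans
    (le_of_eq ?_)
  simp only [Finset.sum_const, Finset.card_univ, nsmul_eq_mul, mul_assoc]

theorem log_mixtureRatio_le (hV : ∀ u v, V u v ∈ stdSimplex ℝ O) (ha : a ∈ stdSimplex ℝ A)
    (hb : b ∈ stdSimplex ℝ B) {N₁ N₂ : ℝ} (h₁ : 0 ≤ N₁) (h₂ : 0 ≤ N₂) (u : A) (v : B) (o : O) :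
    Real.log (mixtureRatio V a b N₁ N₂ u v o) ≤
      Real.log (1 + V u v o / (N₁ * N₂ * avgBoth V a b o)) +
      Real.log (1 + avgRight V b u o / (N₁ * avgBoth V a b o)) +
      Real.log (1 + avgLeft V a v o / (N₂ * avgBoth V a b o)) := by
  have q := (avgBoth_mem hV ha hb).1 o
  have l := (avgLeft_mem hV ha v).1 o
  have r := (avgRight_mem hV hb u).1 o
  have w := (hV u v).1 o
  have x0 : 0 ≤ V u v o / (N₁ * N₂ * avgBoth V a b o) := by positivity
  have y0 : 0 ≤ avgRight V b u o / (N₁ * avgBoth V a b o) := by positivity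
  have z0 : 0 ≤ avgLeft V a v o / (N₂ * avgBoth V a b o) := by positivity
  rw [← Real.log_mul (by positivity) (by positivity), ← Real.log_mul (by positivity) (by positivity)]
  refine Real.log_le_log (mixtureRatio_pos hV ha hb h₁ h₂ u v o) ?_
  unfold mixtureRatio
  have := mul_nonneg x0 y0
  have := mul_nonneg x0 z0
  have := mul_nonneg y0 z0
  have := mul_nonneg (mul_nonneg x0 y0) z0
  linarith

end Resolvability

/-! ### Leakage of block codes -/

section Leakage

variable {X₁ X₂ Y Z : Type*} [Fintype X₁] [Fintype X₂] [Fintype Y] [Fintype Z]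
  (ch : Channel X₁ X₂ Y Z) {n : ℕ} {S₁ S₂ L₁ L₂ : Type*} [Fintype S₁] [Fintype S₂] [Fintype L₁]
  [Fintype L₂] [Nonempty S₁] [Nonempty S₂] [Nonempty L₁] [Nonempty L₂]

open Classical in
/-- The stochastic encoder that picks uniformly one of the codewords of the message. -/
noncomputable def uniformEncoder {A S L : Type*} [Fintype L] (c : S × L → A) (s : S) (x : A) : ℝ :=
  (Fintype.card L : ℝ)⁻¹ * ∑ l, if c (s, l) = x then 1 else 0

theorem sum_uniformEncoder_mul {A S L : Type*} [Fintype A] [Fintype L] (c : S × L → A) (s : S)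
    (φ : A → ℝ) :
    ∑ x, uniformEncoder c s x * φ x = (Fintype.card L : ℝ)⁻¹ * ∑ l, φ (c (s, l)) := by
  classical
  simp only [uniformEncoder, mul_assoc, ← Finset.mul_sum, Finset.sum_mul]
  rw [Finset.sum_comm]
  simp

theorem uniformEncoder_mem {A S L : Type*} [Fintype A] [Fintype L] [Nonempty L] (c : S × L → A)
    (s : S) : uniformEncoder c s ∈ stdSimplex ℝ A := by
  classical
  refine ⟨fun x => mul_nonneg (by positivity) (Finset.sum_nonneg fun _ _ => by
    split_ifs <;> norm_num), ?_⟩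
  have := sum_uniformEncoder_mul c s fun _ => 1
  simpa using this

/-- The leakage is at most the mean relative entropy of the output law given the message with respect
to any fixed output law. -/
theorem Channel.mutualInfo_blockJoint_le (c₁ : S₁ × L₁ → Fin n → X₁) (c₂ : S₂ × L₂ → Fin n → X₂)
    {Q : (Fin n → Z) → ℝ} (hQ : Q ∈ stdSimplex ℝ (Fin n → Z))
    (hQ0 : ∀ m₁ m₂ z, blockKernel ch.eve n (c₁ m₁) (c₂ m₂) z ≠ 0 → Q z ≠ 0) :
    mutualInfo (ch.blockJoint (uniformEncoder c₁) (uniformEncoder c₂)) (fun ω => ω.1)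
      (fun ω => ω.2.2.2) * Real.log 2 ≤ ((Fintype.card S₁ : ℝ) * Fintype.card S₂)⁻¹ *
      ∑ s₁, ∑ s₂, outputDivergence (blockKernel ch.eve n) Q (fun l => c₁ (s₁, l))
        fun l => c₂ (s₂, l) := by
  classical
  set P := ch.blockJoint (uniformEncoder c₁) (uniformEncoder c₂) with hPd
  have hP : P ∈ stdSimplex ℝ _ := ch.blockJoint_mem (uniformEncoder_mem c₁) (uniformEncoder_mem c₂)
  have hV := fun u v => blockKernel_mem ch.eve_mem (n := n) u v
  set κ : ℝ := ((Fintype.card S₁ : ℝ) * Fintype.card S₂)⁻¹ with hκ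
  have hκ0 : 0 < κ := by positivity
  let G : S₁ × S₂ → (Fin n → Z) → ℝ := fun s =>
    mixture (blockKernel ch.eve n) (fun l => c₁ (s.1, l)) fun l => c₂ (s.2, l)
  have hsum : ∀ φ : S₁ × S₂ → (Fin n → Z) → ℝ, ∑ ω, P ω * φ ω.1 ω.2.2.2 =
      κ * ∑ s, ∑ z, G s z * φ s z := by
    intro φ
    have h1 : ∀ (s : S₁ × S₂) (u : Fin n → X₁) (v : Fin n → X₂),
        ∑ y : Fin n → Y, ∑ z : Fin n → Z, P (s, (u, v), y, z) * φ s z =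
        κ * (uniformEncoder c₁ s.1 u * (uniformEncoder c₂ s.2 v *
          ∑ z, blockKernel ch.eve n u v z * φ s z)) := fun s u v => by
      rw [Finset.sum_comm]
      simp only [hPd, Channel.blockJoint, ← Finset.sum_mul, ← Finset.mul_sum, ch.sum_block_bob]
      simp only [Fintype.card_prod, Nat.cast_mul, ← hκ, mul_assoc, ← Finset.mul_sum]
    have h2 : ∀ s : S₁ × S₂, ∑ q : ((Fin n → X₁) × (Fin n → X₂)) × (Fin n → Y) × (Fin n → Z),
        P (s, q) * φ s q.2.2 = κ * ∑ z, G s z * φ s z := fun s => by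
      simp only [Fintype.sum_prod_type]
      simp only [h1, ← Finset.mul_sum]
      simp only [sum_uniformEncoder_mul, ← Finset.mul_sum]
      rw [← mul_assoc (Fintype.card L₁ : ℝ)⁻¹, ← mul_inv]
      simp only [G, mixture, mul_assoc, ← Finset.mul_sum]
      congr 2
      simp only [Finset.sum_mul]
      refine Eq.trans (Finset.sum_congr rfl fun l₁ _ => Finset.sum_comm) ?_
      exact Finset.sum_comm
    rw [Fintype.sum_prod_type]
    simp only [h2, ← Finset.mul_sum]
  have hG1 : ∀ s, ∑ z, G s z = 1 := fun s => by
    simp only [G, mixture]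
    rw [← Finset.mul_sum, Finset.sum_comm]
    simp only [Finset.sum_comm (s := (Finset.univ : Finset (Fin n → Z)))]
    rw [Finset.sum_congr rfl fun l₁ _ => Finset.sum_congr rfl fun l₂ _ => (hV _ _).2]
    simp only [Finset.sum_const, Finset.card_univ, nsmul_eq_mul, mul_one]
    field_simp
  have hlawS : ∀ s, law P (fun ω => ω.1) s = κ := fun s => by
    rw [law_eq_sum, hsum fun s' _ => if s' = s then 1 else 0]
    simp [hG1]
  have hlawSZ : ∀ s z, law P (fun ω => (ω.1, ω.2.2.2)) (s, z) = κ * G s z := fun s z => by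
    rw [law_eq_sum, hsum fun s' z' => if (s', z') = (s, z) then 1 else 0]
    simp [Prod.mk.injEq, ite_and]
  have hG : ∀ ω, P ω ≠ 0 → 0 < G ω.1 ω.2.2.2 := fun ω hω => by
    have := law_pos hP.1 (fun ω => (ω.1, ω.2.2.2)) hω
    rw [hlawSZ] at this
    exact pos_of_mul_pos_right this hκ0.le
  have hQp : ∀ ω, P ω ≠ 0 → 0 < Q ω.2.2.2 := fun ω hω => by
    refine (hQ.1 _).lt_of_ne' ?_
    have h1 := right_ne_zero_of_mul (hG ω hω).ne'
    obtain ⟨l₁, -, h2⟩ := Finset.exists_ne_zero_of_sum_ne_zero h1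
    obtain ⟨l₂, -, h3⟩ := Finset.exists_ne_zero_of_sum_ne_zero h2
    exact hQ0 _ _ _ h3
  have gibbs := sum_mul_log_le hP.1 (r := fun ω => Q ω.2.2.2 / law P (fun ω => ω.2.2.2) ω.2.2.2)
    (fun ω hω => div_pos (hQp ω hω) (law_pos hP.1 _ hω)) (by
      rw [hP.2, ← sum_law_mul P (fun ω => ω.2.2.2) fun z => Q z / law P (fun ω => ω.2.2.2) z, ← hQ.2]
      refine Finset.sum_le_sum fun z _ => ?_
      by_cases h : law P (fun ω => ω.2.2.2) z = 0
      · simpa [h] using hQ.1 z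
      · rw [mul_div_cancel₀ _ h])
  have hR : κ * ∑ s₁, ∑ s₂, outputDivergence (blockKernel ch.eve n) Q (fun l => c₁ (s₁, l))
        (fun l => c₂ (s₂, l)) =
      ∑ ω, P ω * (Real.log (G ω.1 ω.2.2.2) - Real.log (Q ω.2.2.2)) := by
    rw [hsum fun s z => Real.log (G s z) - Real.log (Q z), Fintype.sum_prod_type]
    rfl
  rw [hR, mutualInfo_mul_log, ← sub_nonpos, ← Finset.sum_sub_distrib]
  refine le_trans (le_of_eq (Finset.sum_congr rfl fun ω _ => ?_)) gibbs
  by_cases hω : P ω = 0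
  · simp [hω]
  · rw [hlawS, hlawSZ, Real.log_mul hκ0.ne' (hG ω hω).ne',
      Real.log_div (hQp ω hω).ne' (law_pos hP.1 _ hω).ne']
    ring

end Leakage

/-! ### Exponential bounds for memoryless blocks -/

section Blocks

variable {A B O Ω : Type*} [Fintype A] [Fintype B] [Fintype O] [Fintype Ω] {W : A → B → O → ℝ}
  {a : A → ℝ} {b : B → ℝ}

theorem avgLeft_block (n : ℕ) (v : Fin n → B) (o : Fin n → O) :
    avgLeft (blockKernel W n) (iidLaw a (Fin n)) v o = ∏ t, avgLeft W a (v t) (o t) := by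
  simp only [avgLeft, iidLaw, blockKernel, ← Finset.prod_mul_distrib]
  exact sum_pi_prod fun t u => a u * W u (v t) (o t)

theorem avgRight_block (n : ℕ) (u : Fin n → A) (o : Fin n → O) :
    avgRight (blockKernel W n) (iidLaw b (Fin n)) u o = ∏ t, avgRight W b (u t) (o t) := by
  simp only [avgRight, iidLaw, blockKernel, ← Finset.prod_mul_distrib]
  exact sum_pi_prod fun t v => b v * W (u t) v (o t)

theorem avgBoth_block (n : ℕ) (o : Fin n → O) :
    avgBoth (blockKernel W n) (iidLaw a (Fin n)) (iidLaw b (Fin n)) o =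
      ∏ t, avgBoth W a b (o t) := by
  simp only [avgBoth, avgRight_block, iidLaw, ← Finset.prod_mul_distrib]
  exact sum_pi_prod fun t u => a u * avgRight W b u (o t)

/-- A block of triples as a triple of blocks. -/
def tripleEquiv (A B O : Type*) (n : ℕ) :
    (Fin n → A × B × O) ≃ (Fin n → A) × (Fin n → B) × (Fin n → O) where
  toFun ω := (fun t => (ω t).1, fun t => (ω t).2.1, fun t => (ω t).2.2)
  invFun q := fun t => (q.1 t, q.2.1 t, q.2.2 t)
  left_inv _ := rfl
  right_inv _ := rfl

theorem tripleLaw_block (n : ℕ) (ω : Fin n → A × B × O) :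
    tripleLaw (blockKernel W n) (iidLaw a (Fin n)) (iidLaw b (Fin n)) (tripleEquiv A B O n ω) =
      iidLaw (tripleLaw W a b) (Fin n) ω := by
  simp only [tripleLaw, iidLaw, blockKernel, tripleEquiv, Equiv.coe_fn_mk,
    ← Finset.prod_mul_distrib]

theorem mean_tripleLaw_block (n : ℕ) (f : (Fin n → A) × (Fin n → B) × (Fin n → O) → ℝ) :
    mean (tripleLaw (blockKernel W n) (iidLaw a (Fin n)) (iidLaw b (Fin n))) f =
      mean (iidLaw (tripleLaw W a b) (Fin n)) fun ω => f (tripleEquiv A B O n ω) := by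
  rw [mean, ← (tripleEquiv A B O n).sum_comp]
  simp only [tripleLaw_block, mean]

theorem log_one_add_exp_le {s : ℝ} (hs : 0 < s) (hs1 : s ≤ 1) (x : ℝ) :
    Real.log (1 + Real.exp x) ≤ Real.exp (s * x) / s := by
  have h1 := Real.rpow_add_le_add_rpow zero_le_one (Real.exp_pos x).le hs.le hs1
  rw [Real.one_rpow, ← Real.exp_mul, mul_comm x s] at h1
  have h2 := Real.log_le_log (by positivity) h1
  rw [Real.log_rpow (by positivity)] at h2
  have h3 := Real.log_le_sub_one_of_pos (show (0 : ℝ) < 1 + Real.exp (s * x) by positivity)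
  rw [le_div_iff₀ hs]
  linarith

theorem mean_iidLaw_exp (P : Ω → ℝ) (n : ℕ) (g : Ω → ℝ) (s : ℝ) :
    mean (iidLaw P (Fin n)) (fun ω => Real.exp (s * ∑ t, g (ω t))) =
      (∑ x, P x * Real.exp (s * g x)) ^ n := by
  simp only [mean, iidLaw, Finset.mul_sum, Real.exp_sum, ← Finset.prod_mul_distrib]
  rw [sum_pi_prod fun (_ : Fin n) x => P x * Real.exp (s * g x)]
  simp

/-- A sum of independent terms with negative mean is nonnegative with vanishing probability, and its
positive part, smoothed to `log (1 + exp ·)`, has vanishing mean. -/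
theorem exists_tendsto_iidLaw_bound {P : Ω → ℝ} (hP : P ∈ stdSimplex ℝ Ω) (g : Ω → ℝ)
    (hg : mean P g < 0) : ∃ η : ℕ → ℝ, Tendsto η atTop (𝓝 0) ∧ ∀ n,
      mean (iidLaw P (Fin n)) (fun ω => if 0 ≤ ∑ t, g (ω t) then 1 else 0) ≤ η n ∧
      mean (iidLaw P (Fin n)) (fun ω => Real.log (1 + Real.exp (∑ t, g (ω t)))) ≤ η n := by
  obtain ⟨s, hs, hs1, hρ⟩ := exists_sum_mul_exp_lt_one hP g hg
  set ρ := ∑ ω, P ω * Real.exp (s * g ω) with hρd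
  have hρ0 : 0 ≤ ρ := Finset.sum_nonneg fun ω _ => mul_nonneg (hP.1 ω) (Real.exp_pos _).le
  have hb : ∀ n : ℕ, mean (iidLaw P (Fin n)) (fun ω => s⁻¹ * Real.exp (s * ∑ t, g (ω t))) =
      s⁻¹ * ρ ^ n := fun n => by rw [mean_const_mul, mean_iidLaw_exp]
  refine ⟨fun n => s⁻¹ * ρ ^ n, ?_, fun n => ⟨?_, ?_⟩⟩
  · simpa using (tendsto_pow_atTop_nhds_zero_of_lt_one hρ0 hρ).const_mul s⁻¹
  · refine (mean_mono (iidLaw_mem hP) fun ω _ => ?_).trans_eq (hb n)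
    split_ifs with h
    · have h1 := Real.one_le_exp (mul_nonneg hs.le h)
      have h2 := (one_le_inv₀ hs).2 hs1
      nlinarith
    · positivity
  · refine (mean_mono (iidLaw_mem hP) fun ω _ => ?_).trans_eq (hb n)
    rw [inv_mul_eq_div]
    exact log_one_add_exp_le hs hs1 _

theorem block_div_eq_exp {n : ℕ} {x y : Fin n → ℝ} (hx : ∀ t, 0 < x t) (hy : ∀ t, 0 < y t)
    (τ : ℝ) : Real.exp (n * τ) * (∏ t, y t) =
      (∏ t, x t) * Real.exp (∑ t, (τ - (Real.log (x t) - Real.log (y t)))) := by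
  have h : ∀ t, Real.exp (τ - (Real.log (x t) - Real.log (y t))) = Real.exp τ * y t / x t :=
    fun t => by
      rw [show τ - (Real.log (x t) - Real.log (y t)) = τ + Real.log (y t) - Real.log (x t) by ring,
        Real.exp_sub, Real.exp_add, Real.exp_log (hx t), Real.exp_log (hy t)]
  rw [Real.exp_sum, ← Finset.prod_mul_distrib, Real.exp_nat_mul]
  have : ∀ t, x t * Real.exp (τ - (Real.log (x t) - Real.log (y t))) = Real.exp τ * y t :=
    fun t => by rw [h]; field_simp [(hx t).ne']
  simp [this, Finset.prod_mul_distrib]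

theorem mean_const_sub {P : Ω → ℝ} (hP : P ∈ stdSimplex ℝ Ω) (c : ℝ) (f : Ω → ℝ) :
    mean P (fun ω => c - f ω) = c - mean P f := by
  have h := mean_add (p := P) (f := fun ω => c - f ω) (g := f)
  simp only [sub_add_cancel, mean_const hP] at h
  linarith

theorem exponent_nonneg {x z e : ℝ} (hx : 0 < x) (h : z = x * Real.exp e) (hz : ¬ z < x) :
    0 ≤ e := by
  by_contra hc
  push Not at hc
  have := mul_lt_mul_of_pos_left (Real.exp_lt_exp.2 hc) hx
  rw [← h, Real.exp_zero, mul_one] at this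
  exact hz this

open Classical in
/-- With thresholds below the three information quantities, the transmitted codewords and the output
are typical with probability tending to one. -/
theorem exists_tendsto_not_typical (hW : ∀ u v, W u v ∈ stdSimplex ℝ O) (ha : a ∈ stdSimplex ℝ A)
    (hb : b ∈ stdSimplex ℝ B) {τ₁ τ₂ τ₃ : ℝ} (h₁ : τ₁ < condInfoLeft W a b)
    (h₂ : τ₂ < condInfoRight W a b) (h₃ : τ₃ < jointInfo W a b) :
    ∃ η : ℕ → ℝ, Tendsto η atTop (𝓝 0) ∧ ∀ n : ℕ,
      mean (tripleLaw (blockKernel W n) (iidLaw a (Fin n)) (iidLaw b (Fin n))) (fun ω =>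
        if Typical (blockKernel W n) (iidLaw a (Fin n)) (iidLaw b (Fin n)) (Real.exp (n * τ₁))
          (Real.exp (n * τ₂)) (Real.exp (n * τ₃)) ω.1 ω.2.1 ω.2.2 then 0 else 1) ≤ η n := by
  have hP := tripleLaw_mem hW ha hb
  obtain ⟨η₁, k₁, l₁⟩ := exists_tendsto_iidLaw_bound hP (fun ω => τ₁ -
    (Real.log (W ω.1 ω.2.1 ω.2.2) - Real.log (avgLeft W a ω.2.1 ω.2.2)))
    (by rw [mean_const_sub hP]; exact sub_neg.2 h₁)
  obtain ⟨η₂, k₂, l₂⟩ := exists_tendsto_iidLaw_bound hP (fun ω => τ₂ -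
    (Real.log (W ω.1 ω.2.1 ω.2.2) - Real.log (avgRight W b ω.1 ω.2.2)))
    (by rw [mean_const_sub hP]; exact sub_neg.2 h₂)
  obtain ⟨η₃, k₃, l₃⟩ := exists_tendsto_iidLaw_bound hP (fun ω => τ₃ -
    (Real.log (W ω.1 ω.2.1 ω.2.2) - Real.log (avgBoth W a b ω.2.2)))
    (by rw [mean_const_sub hP]; exact sub_neg.2 h₃)
  refine ⟨fun n => η₁ n + η₂ n + η₃ n, by simpa using (k₁.add k₂).add k₃, fun n => ?_⟩
  rw [mean_tripleLaw_block]
  refine le_trans ?_ (add_le_add (add_le_add (l₁ n).1 (l₂ n).1) (l₃ n).1)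
  rw [← mean_add, ← mean_add]
  refine mean_mono (iidLaw_mem hP) fun ω hω => ?_
  have hs := fun t => tripleLaw_ne_zero (iidLaw_ne_zero hω t)
  have w : ∀ t, 0 < W (ω t).1 (ω t).2.1 (ω t).2.2 := fun t =>
    ((hW _ _).1 _).lt_of_ne' (hs t).2.2
  have e₁ := block_div_eq_exp w (fun t => avgLeft_pos hW ha (hs t).1 (hs t).2.2) τ₁
  have e₂ := block_div_eq_exp w (fun t => avgRight_pos hW hb (hs t).2.1 (hs t).2.2) τ₂
  have e₃ := block_div_eq_exp w (fun t => avgBoth_pos hW ha hb (hs t).1 (hs t).2.1 (hs t).2.2) τ₃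
  have w0 : 0 < ∏ t, W (ω t).1 (ω t).2.1 (ω t).2.2 := Finset.prod_pos fun t _ => w t
  simp only [Typical, avgLeft_block, avgRight_block, avgBoth_block, tripleEquiv, Equiv.coe_fn_mk,
    blockKernel]
  by_cases c₁ : Real.exp (n * τ₁) * (∏ t, avgLeft W a (ω t).2.1 (ω t).2.2) <
      ∏ t, W (ω t).1 (ω t).2.1 (ω t).2.2
  · by_cases c₂ : Real.exp (n * τ₂) * (∏ t, avgRight W b (ω t).1 (ω t).2.2) <
        ∏ t, W (ω t).1 (ω t).2.1 (ω t).2.2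
    · by_cases c₃ : Real.exp (n * τ₃) * (∏ t, avgBoth W a b (ω t).2.2) <
          ∏ t, W (ω t).1 (ω t).2.1 (ω t).2.2
      · rw [if_pos ⟨c₁, c₂, c₃⟩]
        split_ifs <;> norm_num
      · have := exponent_nonneg w0 e₃ c₃
        rw [if_neg (fun h => c₃ h.2.2), if_pos this]
        split_ifs <;> norm_num
    · have := exponent_nonneg w0 e₂ c₂
      rw [if_neg (fun h => c₂ h.2.1), if_pos this]
      split_ifs <;> norm_num
  · have := exponent_nonneg w0 e₁ c₁
    rw [if_neg (fun h => c₁ h.1), if_pos this]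
    split_ifs <;> norm_num

/-- Above the single-letter resolvability rates the random mixture is asymptotically
indistinguishable from the output law of the inputs. -/
theorem exists_tendsto_log_mixtureRatio (hW : ∀ u v, W u v ∈ stdSimplex ℝ O)
    (ha : a ∈ stdSimplex ℝ A) (hb : b ∈ stdSimplex ℝ B) {δ₁ δ₂ : ℝ} (h₁ : leftInfo W a b < δ₁)
    (h₂ : rightInfo W a b < δ₂) (h₃ : jointInfo W a b < δ₁ + δ₂) :
    ∃ η : ℕ → ℝ, Tendsto η atTop (𝓝 0) ∧ ∀ (n : ℕ) (N₁ N₂ : ℝ), Real.exp (n * δ₁) ≤ N₁ →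
      Real.exp (n * δ₂) ≤ N₂ →
      mean (tripleLaw (blockKernel W n) (iidLaw a (Fin n)) (iidLaw b (Fin n))) (fun ω =>
        Real.log (mixtureRatio (blockKernel W n) (iidLaw a (Fin n)) (iidLaw b (Fin n)) N₁ N₂
          ω.1 ω.2.1 ω.2.2)) ≤ η n := by
  have hP := tripleLaw_mem hW ha hb
  have neg : ∀ (c : ℝ) (f : A × B × O → ℝ), mean (tripleLaw W a b) f < c →
      mean (tripleLaw W a b) (fun ω => f ω - c) < 0 := fun c f h => by
    have := mean_const_sub hP c f
    have h2 := mean_const_mul (p := tripleLaw W a b) (-1) (f := fun ω => c - f ω)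
    simp only [neg_mul, one_mul, neg_sub] at h2
    linarith
  obtain ⟨η₁, k₁, l₁⟩ := exists_tendsto_iidLaw_bound hP (fun ω =>
    (Real.log (avgRight W b ω.1 ω.2.2) - Real.log (avgBoth W a b ω.2.2)) - δ₁) (neg _ _ h₁)
  obtain ⟨η₂, k₂, l₂⟩ := exists_tendsto_iidLaw_bound hP (fun ω =>
    (Real.log (avgLeft W a ω.2.1 ω.2.2) - Real.log (avgBoth W a b ω.2.2)) - δ₂) (neg _ _ h₂)
  obtain ⟨η₃, k₃, l₃⟩ := exists_tendsto_iidLaw_bound hP (fun ω =>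
    (Real.log (W ω.1 ω.2.1 ω.2.2) - Real.log (avgBoth W a b ω.2.2)) - (δ₁ + δ₂)) (neg _ _ h₃)
  refine ⟨fun n => η₃ n + η₁ n + η₂ n, by simpa using (k₃.add k₁).add k₂,
    fun n N₁ N₂ hN₁ hN₂ => ?_⟩
  have p₁ := (Real.exp_pos _).trans_le hN₁
  have p₂ := (Real.exp_pos _).trans_le hN₂
  rw [mean_tripleLaw_block]
  refine le_trans ?_ (add_le_add (add_le_add (l₃ n).2 (l₁ n).2) (l₂ n).2)
  rw [← mean_add, ← mean_add]
  refine mean_mono (iidLaw_mem hP) fun ω hω => ?_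
  have hs := fun t => tripleLaw_ne_zero (iidLaw_ne_zero hω t)
  have w : ∀ t, 0 < W (ω t).1 (ω t).2.1 (ω t).2.2 := fun t =>
    ((hW _ _).1 _).lt_of_ne' (hs t).2.2
  have wl := fun t => avgLeft_pos hW ha (v := (ω t).2.1) (hs t).1 (hs t).2.2
  have wr := fun t => avgRight_pos hW hb (u := (ω t).1) (hs t).2.1 (hs t).2.2
  have wb := fun t => avgBoth_pos hW ha hb (hs t).1 (hs t).2.1 (hs t).2.2
  refine (log_mixtureRatio_le (fun u v => blockKernel_mem hW u v) (iidLaw_mem ha) (iidLaw_mem hb)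
    p₁.le p₂.le _ _ _).trans ?_
  simp only [avgLeft_block, avgRight_block, avgBoth_block, tripleEquiv, Equiv.coe_fn_mk,
    blockKernel]
  have key : ∀ (x y : Fin n → ℝ) (N δ : ℝ), (∀ t, 0 < x t) → (∀ t, 0 < y t) →
      Real.exp (n * δ) ≤ N → Real.log (1 + (∏ t, x t) / (N * ∏ t, y t)) ≤
        Real.log (1 + Real.exp (∑ t, ((Real.log (x t) - Real.log (y t)) - δ))) := by
    intro x y N δ hx hy hN
    have hN0 := (Real.exp_pos _).trans_le hN
    have X := Finset.prod_pos (s := Finset.univ) fun t _ => hx t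
    have Y := Finset.prod_pos (s := Finset.univ) fun t _ => hy t
    refine Real.log_le_log (by positivity) (add_le_add le_rfl ?_)
    have e := block_div_eq_exp hx hy δ
    have e' : ∑ t, ((Real.log (x t) - Real.log (y t)) - δ) =
        -∑ t, (δ - (Real.log (x t) - Real.log (y t))) := by
      rw [← Finset.sum_neg_distrib]
      exact Finset.sum_congr rfl fun t _ => by ring
    rw [e', Real.exp_neg, div_le_iff₀ (by positivity), inv_mul_eq_div, le_div_iff₀ (Real.exp_pos _),
      ← e]
    exact mul_le_mul_of_nonneg_right hN Y.le
  refine add_le_add (add_le_add (key _ _ _ _ w wb ?_) (key _ _ _ _ wr wb hN₁)) (key _ _ _ _ wl wb hN₂)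
  rw [mul_add, Real.exp_add]
  exact mul_le_mul hN₁ hN₂ (Real.exp_pos _).le p₁.le

end Blocks

/-! ### Codes for the multiple access channel and wiretap codes -/

section RandomCodes

variable {A B O : Type*} [Fintype A] [Fintype B] [Fintype O] {W : A → B → O → ℝ}
  {a : A → ℝ} {b : B → ℝ}

theorem tendsto_exp_nat_mul {c : ℝ} (hc : c < 0) :
    Tendsto (fun n : ℕ => Real.exp (n * c)) atTop (𝓝 0) := by
  simp only [Real.exp_nat_mul]
  exact tendsto_pow_atTop_nhds_zero_of_lt_one (Real.exp_pos _).le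
    (by simpa using Real.exp_lt_exp.2 hc)

/-- Below the single-letter bounds, random codes have vanishing mean error probability, uniformly in
the message sets. -/
theorem exists_tendsto_codeMean_macError (hW : ∀ u v, W u v ∈ stdSimplex ℝ O)
    (ha : a ∈ stdSimplex ℝ A) (hb : b ∈ stdSimplex ℝ B) {r₁ r₂ : ℝ} (h₁ : r₁ < condInfoLeft W a b)
    (h₂ : r₂ < condInfoRight W a b) (h₃ : r₁ + r₂ < jointInfo W a b) :
    ∃ η : ℕ → ℝ, Tendsto η atTop (𝓝 0) ∧ ∀ n : ℕ, ∃ T₁ T₂ T₃ : ℝ, ∀ (M₁ M₂ : Type) [Fintype M₁]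
      [Fintype M₂] [Nonempty M₁] [Nonempty M₂] [DecidableEq M₁] [DecidableEq M₂],
      (Fintype.card M₁ : ℝ) ≤ Real.exp (n * r₁) → (Fintype.card M₂ : ℝ) ≤ Real.exp (n * r₂) →
      codeMean (iidLaw a (Fin n)) (iidLaw b (Fin n)) M₁ M₂ (fun c₁ c₂ =>
        macError (blockKernel W n) c₁ c₂ (thresholdDecoder (blockKernel W n) (iidLaw a (Fin n))
          (iidLaw b (Fin n)) T₁ T₂ T₃ c₁ c₂)) ≤ η n := by
  obtain ⟨τ₁, l₁, u₁⟩ := exists_between h₁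
  obtain ⟨τ₂, l₂, u₂⟩ := exists_between h₂
  obtain ⟨τ₃, l₃, u₃⟩ := exists_between h₃
  obtain ⟨η, hη, key⟩ := exists_tendsto_not_typical hW ha hb u₁ u₂ u₃
  refine ⟨fun n => η n + (Real.exp (n * (r₁ - τ₁)) + Real.exp (n * (r₂ - τ₂)) +
    Real.exp (n * (r₁ + r₂ - τ₃))), ?_, fun n => ⟨_, _, _, fun M₁ M₂ _ _ _ _ _ _ k₁ k₂ =>
      (codeMean_macError_le (fun u v => blockKernel_mem hW u v) (iidLaw_mem ha) (iidLaw_mem hb)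
        (Real.exp_pos (n * τ₁)) (Real.exp_pos (n * τ₂)) (Real.exp_pos (n * τ₃))).trans ?_⟩⟩
  · simpa using hη.add (((tendsto_exp_nat_mul (sub_neg.2 l₁)).add
      (tendsto_exp_nat_mul (sub_neg.2 l₂))).add (tendsto_exp_nat_mul (sub_neg.2 l₃)))
  · refine add_le_add (key n) (add_le_add (add_le_add ?_ ?_) ?_)
    · rw [mul_sub, Real.exp_sub]
      gcongr
    · rw [mul_sub, Real.exp_sub]
      gcongr
    · rw [mul_sub, Real.exp_sub, mul_add, Real.exp_add]
      gcongr

/-- Dropping the local randomness from the decoded pair only helps. -/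
theorem stochasticError_uniformEncoder_le {S₁ S₂ L₁ L₂ : Type*} [Fintype S₁] [Fintype S₂]
    [Fintype L₁] [Fintype L₂] (hW : ∀ u v, W u v ∈ stdSimplex ℝ O) (c₁ : S₁ × L₁ → A)
    (c₂ : S₂ × L₂ → B) (d : O → (S₁ × L₁) × (S₂ × L₂)) :
    stochasticError W (uniformEncoder c₁) (uniformEncoder c₂) (fun o => ((d o).1.1, (d o).2.1)) ≤
      macError W c₁ c₂ d := by
  classical
  let g : S₁ → S₂ → A → B → ℝ := fun s₁ s₂ u v =>
    ∑ o, W u v o * if ((d o).1.1, (d o).2.1) ≠ (s₁, s₂) then 1 else 0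
  have h : ∀ s₁ s₂, ∑ u, ∑ v, uniformEncoder c₁ s₁ u * uniformEncoder c₂ s₂ v * g s₁ s₂ u v =
      ((Fintype.card L₁ : ℝ) * Fintype.card L₂)⁻¹ * ∑ l₁, ∑ l₂, g s₁ s₂ (c₁ (s₁, l₁)) (c₂ (s₂, l₂)) :=
    fun s₁ s₂ => by
      simp only [mul_assoc, ← Finset.mul_sum]
      simp only [sum_uniformEncoder_mul, ← Finset.mul_sum]
      rw [mul_inv, mul_assoc]
  have e : stochasticError W (uniformEncoder c₁) (uniformEncoder c₂)
      (fun o => ((d o).1.1, (d o).2.1)) = ((Fintype.card S₁ : ℝ) * Fintype.card S₂)⁻¹ *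
        ∑ s₁, ∑ s₂, ((Fintype.card L₁ : ℝ) * Fintype.card L₂)⁻¹ *
          ∑ l₁, ∑ l₂, g s₁ s₂ (c₁ (s₁, l₁)) (c₂ (s₂, l₂)) := by
    simp only [← h]
    simp only [stochasticError, g]
  rw [e, macError]
  simp only [← Finset.mul_sum]
  rw [← mul_assoc]
  simp only [Fintype.sum_prod_type, Fintype.card_prod, Nat.cast_mul]
  have hc : ((Fintype.card S₁ : ℝ) * Fintype.card S₂)⁻¹ *
      ((Fintype.card L₁ : ℝ) * Fintype.card L₂)⁻¹ =
      ((Fintype.card S₁ : ℝ) * Fintype.card L₁ * (Fintype.card S₂ * Fintype.card L₂))⁻¹ := by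
    rw [← mul_inv]
    congr 1
    ring
  rw [hc]
  refine mul_le_mul_of_nonneg_left (Finset.sum_le_sum fun s₁ _ => ?_) (by positivity)
  rw [Finset.sum_comm]
  refine Finset.sum_le_sum fun l₁ _ => Finset.sum_le_sum fun s₂ _ => Finset.sum_le_sum fun l₂ _ =>
    Finset.sum_le_sum fun o _ => mul_le_mul_of_nonneg_left ?_ ((hW _ _).1 _)
  by_cases hd : d o = ((s₁, l₁), (s₂, l₂))
  · simp [hd]
  · rw [if_pos (show d o ≠ ((s₁, l₁), (s₂, l₂)) from hd)]
    split_ifs <;> norm_num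

end RandomCodes

section ChannelCodes

variable {X₁ X₂ Y Z : Type*} [Fintype X₁] [Fintype X₂] [Fintype Y] [Fintype Z]
  (ch : Channel X₁ X₂ Y Z)

/-- The coding theorem for the multiple access channel, with an error bound that is uniform in the
message sets. -/
theorem Channel.exists_macCodes {p₁ : X₁ → ℝ} {p₂ : X₂ → ℝ} (hp₁ : p₁ ∈ stdSimplex ℝ X₁)
    (hp₂ : p₂ ∈ stdSimplex ℝ X₂) {R₁ R₂ : ℝ} (h₁ : R₁ < ch.infoY₁ p₁ p₂) (h₂ : R₂ < ch.infoY₂ p₁ p₂)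
    (h₃ : R₁ + R₂ < ch.infoY p₁ p₂) : ∃ η : ℕ → ℝ, Tendsto η atTop (𝓝 0) ∧
    ∀ (n : ℕ) (M₁ M₂ : Type) [Fintype M₁] [Fintype M₂] [Nonempty M₁] [Nonempty M₂],
      Real.log (Fintype.card M₁) ≤ n * R₁ * Real.log 2 →
      Real.log (Fintype.card M₂) ≤ n * R₂ * Real.log 2 →
      ∃ (c₁ : M₁ → Fin n → X₁) (c₂ : M₂ → Fin n → X₂) (d : (Fin n → Y) → M₁ × M₂),
        macError (blockKernel ch.bob n) c₁ c₂ d ≤ η n := by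
  classical
  have l2 := Real.log_pos one_lt_two
  obtain ⟨η, hη, key⟩ := exists_tendsto_codeMean_macError ch.bob_mem hp₁ hp₂
    (r₁ := R₁ * Real.log 2) (r₂ := R₂ * Real.log 2)
    (by rw [← ch.infoY₁_mul_log hp₁]; gcongr) (by rw [← ch.infoY₂_mul_log hp₂]; gcongr)
    (by rw [← ch.infoY_mul_log, ← add_mul]; gcongr)
  refine ⟨η, hη, fun n M₁ M₂ _ _ _ _ k₁ k₂ => ?_⟩
  obtain ⟨T₁, T₂, T₃, hT⟩ := key n
  have card : ∀ (M : Type) [Fintype M] [Nonempty M] (r : ℝ), Real.log (Fintype.card M) ≤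
      n * r * Real.log 2 → (Fintype.card M : ℝ) ≤ Real.exp (n * (r * Real.log 2)) :=
    fun M _ _ r h => by
      rw [← mul_assoc]
      exact (Real.log_le_iff_le_exp (by exact_mod_cast Fintype.card_pos)).1 h
  obtain ⟨c₁, c₂, -, -, hc⟩ := exists_le_codeMean (M₁ := M₁) (M₂ := M₂)
    (iidLaw_mem (ι := Fin n) hp₁) (iidLaw_mem (ι := Fin n) hp₂) fun c₁ c₂ =>
    macError (blockKernel ch.bob n) c₁ c₂ (thresholdDecoder (blockKernel ch.bob n)
      (iidLaw p₁ (Fin n)) (iidLaw p₂ (Fin n)) T₁ T₂ T₃ c₁ c₂)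
  exact ⟨c₁, c₂, _, hc.trans (hT M₁ M₂ (card M₁ _ k₁) (card M₂ _ k₂))⟩

/-- Rates of local randomness and of messages for the random wiretap code. -/
theorem exists_wiretap_rates {z₁ z₂ z y₁ y₂ y : ℝ} (h₁ : z₁ < y₁) (h₂ : z₂ < y₂) (h : z < y)
    (hz : z₁ + z₂ ≤ z) (hy : y ≤ y₁ + y₂) : ∃ D₁ D₂ R : ℝ, 0 < R ∧ z₁ < D₁ ∧ z₂ < D₂ ∧
      z < D₁ + D₂ ∧ D₁ + 3 * R < y₁ ∧ D₂ + 3 * R < y₂ ∧ D₁ + 3 * R + (D₂ + 3 * R) < y := by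
  have hd : 0 < y₁ + y₂ - z₁ - z₂ := by linarith
  set θ := ((z + y) / 2 - z₁ - z₂) / (y₁ + y₂ - z₁ - z₂) with hθ
  have θ0 : 0 < θ := div_pos (by linarith) hd
  have θ1 : θ < 1 := (div_lt_one hd).2 (by linarith)
  have hs : z₁ + θ * (y₁ - z₁) + (z₂ + θ * (y₂ - z₂)) = (z + y) / 2 := by
    have : θ * (y₁ + y₂ - z₁ - z₂) = (z + y) / 2 - z₁ - z₂ := div_mul_cancel₀ _ hd.ne'
    linarith
  set m := min (min ((1 - θ) * (y₁ - z₁)) ((1 - θ) * (y₂ - z₂))) ((y - z) / 2) with hm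
  have m0 : 0 < m := lt_min (lt_min (mul_pos (by linarith) (by linarith))
    (mul_pos (by linarith) (by linarith))) (by linarith)
  have a1 : m ≤ (1 - θ) * (y₁ - z₁) := (min_le_left _ _).trans (min_le_left _ _)
  have a2 : m ≤ (1 - θ) * (y₂ - z₂) := (min_le_left _ _).trans (min_le_right _ _)
  have a3 : m ≤ (y - z) / 2 := min_le_right _ _
  have b1 := mul_pos θ0 (sub_pos.2 h₁)
  have b2 := mul_pos θ0 (sub_pos.2 h₂)
  -- Both randomness rates lie at the same fraction `θ` of their intervals, with sum `(z + y) / 2`.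
  exact ⟨z₁ + θ * (y₁ - z₁), z₂ + θ * (y₂ - z₂), m / 7, by linarith, by linarith, by linarith,
    by linarith, by linarith, by linarith, by linarith⟩

end ChannelCodes

section Wiretap

variable {X₁ X₂ Y Z : Type*} [Fintype X₁] [Fintype X₂] [Fintype Y] [Fintype Z]
  (ch : Channel X₁ X₂ Y Z)

theorem nonempty_of_mem_stdSimplex {A : Type*} [Fintype A] {p : A → ℝ} (hp : p ∈ stdSimplex ℝ A) :
    Nonempty A := by
  by_contra h
  rw [not_nonempty_iff] at h
  simpa using hp.2

/-- One codebook is good for both purposes: the mean error probability and the mean output divergence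
are small together. -/
theorem Channel.exists_wiretapCodes {p₁ : X₁ → ℝ} {p₂ : X₂ → ℝ} (hp₁ : p₁ ∈ stdSimplex ℝ X₁)
    (hp₂ : p₂ ∈ stdSimplex ℝ X₂) {D₁ D₂ R : ℝ} (hR : 0 < R) (hD₁ : ch.infoZ₁ p₁ p₂ < D₁)
    (hD₂ : ch.infoZ₂ p₁ p₂ < D₂) (hD : ch.infoZ p₁ p₂ < D₁ + D₂)
    (h₁ : D₁ + 3 * R < ch.infoY₁ p₁ p₂) (h₂ : D₂ + 3 * R < ch.infoY₂ p₁ p₂)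
    (h₃ : D₁ + 3 * R + (D₂ + 3 * R) < ch.infoY p₁ p₂) :
    ∃ η : ℕ → ℝ, Tendsto η atTop (𝓝 0) ∧ ∀ᶠ n : ℕ in atTop,
      ∃ C : WiretapCode X₁ X₂ Y n ⌈n * R⌉₊ ⌈n * R⌉₊, C.errorProb ch ≤ η n ∧
        C.leakage ch * Real.log 2 ≤ η n := by
  classical
  have l2 := Real.log_pos one_lt_two
  have z₁ : 0 ≤ ch.infoZ₁ p₁ p₂ := by
    refine nonneg_of_mul_nonneg_left ?_ l2
    rw [ch.infoZ₁_mul_log hp₂]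
    exact leftInfo_nonneg ch.eve_mem hp₁ hp₂
  have z₂ : 0 ≤ ch.infoZ₂ p₁ p₂ := by
    refine nonneg_of_mul_nonneg_left ?_ l2
    rw [ch.infoZ₂_mul_log hp₁]
    exact rightInfo_nonneg ch.eve_mem hp₁ hp₂
  obtain ⟨η, hη, kη⟩ := exists_tendsto_codeMean_macError ch.bob_mem hp₁ hp₂
    (r₁ := (D₁ + 3 * R) * Real.log 2) (r₂ := (D₂ + 3 * R) * Real.log 2)
    (by rw [← ch.infoY₁_mul_log hp₁]; gcongr) (by rw [← ch.infoY₂_mul_log hp₂]; gcongr)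
    (by rw [← ch.infoY_mul_log, ← add_mul]; gcongr)
  obtain ⟨ζ, hζ, kζ⟩ := exists_tendsto_log_mixtureRatio ch.eve_mem hp₁ hp₂
    (δ₁ := D₁ * Real.log 2) (δ₂ := D₂ * Real.log 2)
    (by rw [← ch.infoZ₁_mul_log hp₂]; gcongr) (by rw [← ch.infoZ₂_mul_log hp₁]; gcongr)
    (by rw [← ch.infoZ_mul_log, ← add_mul]; gcongr)
  refine ⟨fun n => η n + ζ n, by simpa using hη.add hζ, ?_⟩
  -- For `n R ≥ 1` rounding up two numbers of bits costs at most `2 n R` bits.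
  filter_upwards [(tendsto_natCast_atTop_atTop (R := ℝ)).eventually_ge_atTop (1 / R)] with n hn
  rw [div_le_iff₀ hR] at hn
  obtain ⟨T₁, T₂, T₃, hT⟩ := kη n
  have q₁ := iidLaw_mem (ι := Fin n) hp₁
  have q₂ := iidLaw_mem (ι := Fin n) hp₂
  set Q₁ := iidLaw p₁ (Fin n) with hQ₁
  set Q₂ := iidLaw p₂ (Fin n) with hQ₂
  set S := Bits ⌈n * R⌉₊ with hS
  set L₁ := Bits ⌈n * D₁⌉₊ with hL₁
  set L₂ := Bits ⌈n * D₂⌉₊ with hL₂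
  have cardM : ∀ D : ℝ, 0 ≤ D → (Fintype.card (Bits ⌈n * R⌉₊ × Bits ⌈n * D⌉₊) : ℝ) ≤
      Real.exp (n * ((D + 3 * R) * Real.log 2)) := fun D hD => by
    rw [← Real.log_le_iff_le_exp (by exact_mod_cast Fintype.card_pos), Fintype.card_prod,
      Nat.cast_mul, Real.log_mul (by exact_mod_cast Fintype.card_ne_zero)
        (by exact_mod_cast Fintype.card_ne_zero), log_card_bits, log_card_bits, ← add_mul, ← mul_assoc]
    refine mul_le_mul_of_nonneg_right ?_ l2.le
    have e1 := (Nat.ceil_lt_add_one (show 0 ≤ (n : ℝ) * R by positivity)).le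
    have e2 := (Nat.ceil_lt_add_one (show 0 ≤ (n : ℝ) * D by positivity)).le
    linarith
  have cardL : ∀ D : ℝ, Real.exp (n * (D * Real.log 2)) ≤ Fintype.card (Bits ⌈n * D⌉₊) :=
    fun D => by
      rw [← Real.le_log_iff_exp_le (by exact_mod_cast Fintype.card_pos), log_card_bits, ← mul_assoc]
      exact mul_le_mul_of_nonneg_right (Nat.le_ceil _) l2.le
  let dec : (S × L₁ → Fin n → X₁) → (S × L₂ → Fin n → X₂) → (Fin n → Y) → (S × L₁) × (S × L₂) :=
    thresholdDecoder (blockKernel ch.bob n) Q₁ Q₂ T₁ T₂ T₃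
  let V := blockKernel ch.eve n
  have hV := fun u v => blockKernel_mem ch.eve_mem (n := n) u v
  let κ : ℝ := ((Fintype.card S : ℝ) * Fintype.card S)⁻¹
  obtain ⟨c₁, c₂, hc₁, hc₂, hc⟩ := exists_le_codeMean (M₁ := S × L₁) (M₂ := S × L₂) q₁ q₂
    fun c₁ c₂ => macError (blockKernel ch.bob n) c₁ c₂ (dec c₁ c₂) + κ * ∑ s₁, ∑ s₂,
      outputDivergence V (avgBoth V Q₁ Q₂) (fun l => c₁ (s₁, l)) fun l => c₂ (s₂, l)
  have bound : macError (blockKernel ch.bob n) c₁ c₂ (dec c₁ c₂) + κ * ∑ s₁, ∑ s₂,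
      outputDivergence V (avgBoth V Q₁ Q₂) (fun l => c₁ (s₁, l)) (fun l => c₂ (s₂, l)) ≤
      η n + ζ n := by
    refine hc.trans ?_
    rw [codeMean_add, codeMean_const_mul]
    simp only [codeMean_sum]
    refine add_le_add (hT (S × L₁) (S × L₂) (cardM D₁ (by linarith)) (cardM D₂ (by linarith))) ?_
    have h : ∀ s₁ s₂ : S, codeMean Q₁ Q₂ (S × L₁) (S × L₂) (fun c₁ c₂ =>
        outputDivergence V (avgBoth V Q₁ Q₂) (fun l => c₁ (s₁, l)) fun l => c₂ (s₂, l)) ≤ ζ n :=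
      fun s₁ s₂ => (codeMean_outputDivergence_le hV q₁ q₂ s₁ s₂).trans
        (kζ n _ _ (cardL D₁) (cardL D₂))
    refine (mul_le_mul_of_nonneg_left (Finset.sum_le_sum fun s₁ _ => Finset.sum_le_sum
      fun s₂ _ => h s₁ s₂) (by positivity)).trans (le_of_eq ?_)
    have hS0 : (Fintype.card S : ℝ) ≠ 0 := by exact_mod_cast Fintype.card_ne_zero
    simp only [Finset.sum_const, Finset.card_univ, nsmul_eq_mul, κ]
    field_simp
  let C : WiretapCode X₁ X₂ Y n ⌈n * R⌉₊ ⌈n * R⌉₊ :=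
    { enc₁ := uniformEncoder c₁
      enc₁_mem := uniformEncoder_mem c₁
      enc₂ := uniformEncoder c₂
      enc₂_mem := uniformEncoder_mem c₂
      dec := fun o => ((dec c₁ c₂ o).1.1, (dec c₁ c₂ o).2.1) }
  have hleak : C.leakage ch * Real.log 2 ≤ κ * ∑ s₁, ∑ s₂,
      outputDivergence V (avgBoth V Q₁ Q₂) (fun l => c₁ (s₁, l)) fun l => c₂ (s₂, l) :=
    ch.mutualInfo_blockJoint_le c₁ c₂ (avgBoth_mem hV q₁ q₂) fun m₁ m₂ z hz =>
      (avgBoth_pos hV q₁ q₂ (hc₁ m₁) (hc₂ m₂) hz).ne'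
  have herr : C.errorProb ch ≤ macError (blockKernel ch.bob n) c₁ c₂ (dec c₁ c₂) := by
    rw [WiretapCode.errorProb_eq]
    exact stochasticError_uniformEncoder_le (fun u v => blockKernel_mem ch.bob_mem u v) c₁ c₂ _
  have e0 : 0 ≤ C.errorProb ch := by
    rw [WiretapCode.errorProb_eq]
    exact ch.stochasticError_nonneg C.enc₁_mem C.enc₂_mem _
  have i0 : 0 ≤ C.leakage ch :=
    mutualInfo_nonneg (ch.blockJoint_mem C.enc₁_mem C.enc₂_mem) _ _
  have i1 := mul_nonneg i0 l2.le
  exact ⟨C, by linarith, by linarith⟩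

theorem Channel.PositiveSingleLetter.positiveSecrecy (h : ch.PositiveSingleLetter) :
    ch.PositiveSecrecy := by
  classical
  obtain ⟨p₁, hp₁, p₂, hp₂, h₁, h₂, h₃⟩ := h
  have l2 := Real.log_pos one_lt_two
  have hz : ch.infoZ₁ p₁ p₂ + ch.infoZ₂ p₁ p₂ ≤ ch.infoZ p₁ p₂ := by
    refine le_of_mul_le_mul_right ?_ l2
    rw [add_mul, ch.infoZ₁_mul_log hp₂, ch.infoZ₂_mul_log hp₁, ch.infoZ_mul_log]
    exact leftInfo_add_rightInfo_le ch.eve_mem hp₁ hp₂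
  obtain ⟨D₁, D₂, R, hR, hD₁, hD₂, hD, k₁, k₂, k₃⟩ :=
    exists_wiretap_rates h₁ h₂ h₃ hz (ch.infoY_le_add hp₁ hp₂)
  obtain ⟨η, hη, key⟩ := ch.exists_wiretapCodes hp₁ hp₂ hR hD₁ hD₂ hD k₁ k₂ k₃
  have : Nonempty X₁ := nonempty_of_mem_stdSimplex hp₁
  have : Nonempty X₂ := nonempty_of_mem_stdSimplex hp₂
  -- Short blocks need some code, too.
  have default : ∀ n, Nonempty (WiretapCode X₁ X₂ Y n ⌈n * R⌉₊ ⌈n * R⌉₊) := fun n =>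
    ⟨⟨fun _ => Pi.single (Classical.arbitrary _) 1, fun _ => single_mem_stdSimplex _ _,
      fun _ => Pi.single (Classical.arbitrary _) 1, fun _ => single_mem_stdSimplex _ _,
      fun _ => Classical.arbitrary _⟩⟩
  have hC : ∀ n, ∃ C : WiretapCode X₁ X₂ Y n ⌈n * R⌉₊ ⌈n * R⌉₊,
      (∃ C : WiretapCode X₁ X₂ Y n ⌈n * R⌉₊ ⌈n * R⌉₊, C.errorProb ch ≤ η n ∧
        C.leakage ch * Real.log 2 ≤ η n) → C.errorProb ch ≤ η n ∧
        C.leakage ch * Real.log 2 ≤ η n := fun n => by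
    by_cases h : ∃ C : WiretapCode X₁ X₂ Y n ⌈n * R⌉₊ ⌈n * R⌉₊, C.errorProb ch ≤ η n ∧
        C.leakage ch * Real.log 2 ≤ η n
    · obtain ⟨C, hC⟩ := h
      exact ⟨C, fun _ => hC⟩
    · exact ⟨(default n).some, fun h' => absurd h' h⟩
  choose C hC using hC
  refine ⟨R, hR, R, hR, _, _, C, Eventually.of_forall fun n => ⟨Nat.le_ceil _, Nat.le_ceil _⟩,
    ?_, ?_⟩
  · refine squeeze_zero' (Eventually.of_forall fun n => ?_) (key.mono fun n hn => (hC n hn).1) hη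
    rw [WiretapCode.errorProb_eq]
    exact ch.stochasticError_nonneg (C n).enc₁_mem (C n).enc₂_mem _
  · have hη2 : Tendsto (fun n => η n / Real.log 2) atTop (𝓝 0) := by simpa using hη.div_const _
    have i0 : ∀ n, 0 ≤ (C n).leakage ch := fun n =>
      mutualInfo_nonneg (ch.blockJoint_mem (C n).enc₁_mem (C n).enc₂_mem) _ _
    refine squeeze_zero' (Eventually.of_forall fun n => div_nonneg (i0 n) (by positivity)) ?_ hη2
    filter_upwards [key, eventually_ge_atTop 1] with n hn h1
    refine (div_le_self (i0 n) (by exact_mod_cast h1)).trans ?_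
    rw [le_div_iff₀ l2]
    exact (hC n hn).2

end Wiretap

/-! ### Keys from the preceding slot -/

section Sent

variable {a r K : ℕ}

/-- The messages of slot `k` when message `s + 1` is masked by message `s` of the preceding slot: the
number of masked messages grows by one in each slot until it reaches `r`. -/
abbrev ShiftMsg (a r k : ℕ) : Type := Fin (min k r + 1) → Bits a

/-- What is transmitted: message `0` of each slot as it is, the other ones masked. -/
def sent (w : (j : Fin K) → ShiftMsg a r j) (j : Fin K) : ShiftMsg a r j := fun s =>
  w j s + if h : (s : ℕ) = 0 then 0 else
    w ⟨j - 1, by omega⟩ ⟨s - 1, by have := s.2; simp only; omega⟩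

/-- Families of messages as functions of two natural numbers, with value `0` outside the range. -/
def extend (w : (j : Fin K) → ShiftMsg a r j) (k s : ℕ) : Bits a :=
  if h : k < K ∧ s < min k r + 1 then w ⟨k, h.1⟩ ⟨s, h.2⟩ else 0

theorem extend_apply (w : (j : Fin K) → ShiftMsg a r j) (j : Fin K) (s : Fin (min (j : ℕ) r + 1)) :
    extend w j s = w j s :=
  dif_pos ⟨j.2, s.2⟩

theorem extend_sent_zero (w : (j : Fin K) → ShiftMsg a r j) (k : ℕ) :
    extend (sent w) k 0 = extend w k 0 := by
  unfold extend
  split_ifs with h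
  · simp [sent]
  · rfl

theorem extend_sent_succ (w : (j : Fin K) → ShiftMsg a r j) {k s : ℕ} (hk : k + 1 < K)
    (hs : s + 1 < min (k + 1) r + 1) :
    extend (sent w) (k + 1) (s + 1) = extend w (k + 1) (s + 1) + extend w k s := by
  rw [extend, dif_pos ⟨hk, hs⟩, extend, dif_pos ⟨hk, hs⟩, extend, dif_pos ⟨by omega, by omega⟩]
  simp [sent]

/-- The sum of the masked messages along the chain of keys of message `s` of slot `k`. The chain ends
at message `0` of slot `k - s`, which is not included. The value for `k < s` is irrelevant. -/
def offset {V : Type*} [AddCommMonoid V] (u : ℕ → ℕ → V) : ℕ → ℕ → V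
  | _, 0 => 0
  | 0, _ + 1 => 0
  | k + 1, s + 1 => u (k + 1) (s + 1) + offset u k s

theorem offset_congr {V : Type*} [AddCommMonoid V] {u u' : ℕ → ℕ → V}
    (h : ∀ k s, u k (s + 1) = u' k (s + 1)) : ∀ k s, offset u k s = offset u' k s
  | 0, 0 => rfl
  | _ + 1, 0 => rfl
  | 0, _ + 1 => rfl
  | k + 1, s + 1 => by rw [offset, offset, h, offset_congr h k s]

theorem bits_add_self {m : ℕ} (x : Bits m) : x + x = 0 := by
  funext t
  exact CharTwo.add_self_eq_zero _

theorem extend_eq_offset_add (w : (j : Fin K) → ShiftMsg a r j) : ∀ {s k : ℕ}, k < K →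
    s < min k r + 1 → extend w k s = offset (extend (sent w)) k s + extend (sent w) (k - s) 0 := by
  intro s
  induction s with
  | zero =>
    intro k _ _
    rw [extend_sent_zero]
    cases k <;> simp [offset]
  | succ s ih =>
    intro k hk hs
    obtain ⟨k, rfl⟩ : ∃ k', k = k' + 1 := ⟨k - 1, by omega⟩
    rw [offset, add_assoc, Nat.add_sub_add_right, ← ih (by omega) (by omega),
      extend_sent_succ w hk hs, add_assoc, bits_add_self, add_zero]

theorem sent_injective : Function.Injective (sent (a := a) (r := r) (K := K)) := by
  intro w w' h
  funext j s
  rw [← extend_apply w, ← extend_apply w', extend_eq_offset_add w j.2 s.2,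
    extend_eq_offset_add w' j.2 s.2, h]

/-- The messages and what is transmitted determine each other. -/
noncomputable def sentEquiv (a r K : ℕ) :
    ((j : Fin K) → ShiftMsg a r j) ≃ ((j : Fin K) → ShiftMsg a r j) :=
  Equiv.ofBijective sent (Finite.injective_iff_bijective.1 sent_injective)

variable {X : Type*} [Fintype X] {n₁ n₂ : ℕ}

/-- One user's part of the scheme in which message `s` of slot `k` is the key of message `s + 1` of
slot `k + 1`. -/
def shiftUser (a r : ℕ) (e : Bits a → (Fin n₁ → X) → ℝ) (he : ∀ w, e w ∈ stdSimplex ℝ (Fin n₁ → X))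
    (c : (k : ℕ) → (Fin (min k r) → Bits a) → Fin n₂ → X) : KeyEncoder X n₁ n₂ where
  a := a
  r k := min k r
  r_zero := Nat.zero_min r
  key k := Fin.castLEEmb (by omega)
  wiretapEnc := e
  wiretapEnc_mem := he
  plainEnc := c

variable {e : Bits a → (Fin n₁ → X) → ℝ} {he : ∀ w, e w ∈ stdSimplex ℝ (Fin n₁ → X)}
  {c : (k : ℕ) → (Fin (min k r) → Bits a) → Fin n₂ → X}

theorem shiftUser_masked (w : (j : Fin K) → ShiftMsg a r j) (j : Fin K) (s : Fin (min (j : ℕ) r)) :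
    (shiftUser a r e he c).masked j (fun i => w ⟨i, by omega⟩) s = sent w j s.succ := by
  obtain ⟨j, hj⟩ := j
  cases j with
  | zero => exact absurd s.2 (by simp)
  | succ k =>
    simp only [sent, Fin.val_succ, Nat.add_eq_zero_iff, one_ne_zero, and_false, dif_neg,
      not_false_eq_true]
    rfl

open Classical in
/-- A deterministic encoder as a stochastic one. -/
noncomputable def pointEncoder {M A : Type*} (c : M → A) (m : M) (x : A) : ℝ := if x = c m then 1 else 0

/-- The two parts of a block. -/
def splitEquiv (X : Type*) {n₁ n₂ n : ℕ} (h : n₁ + n₂ = n) :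
    (Fin n → X) ≃ (Fin n₁ → X) × (Fin n₂ → X) where
  toFun x := (fun t => x ⟨t, by omega⟩, fun t => x ⟨n₁ + t, by omega⟩)
  invFun p t := Fin.append p.1 p.2 (Fin.cast h.symm t)
  left_inv x := by
    subst h
    funext t
    refine Fin.addCases (fun i => ?_) (fun i => ?_) t
    · exact Fin.append_left _ _ i
    · exact Fin.append_right _ _ i
  right_inv p := by
    subst h
    refine Prod.ext (funext fun t => ?_) (funext fun t => ?_)
    · exact Fin.append_left _ _ t
    · exact Fin.append_right _ _ t

theorem prod_split {n₁ n₂ n : ℕ} (h : n₁ + n₂ = n) (F : Fin n → ℝ) :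
    ∏ t, F t = (∏ t : Fin n₁, F ⟨t, by omega⟩) * ∏ t : Fin n₂, F ⟨n₁ + t, by omega⟩ := by
  subst h
  exact Fin.prod_univ_add F

theorem shiftUser_enc {n : ℕ} (h : n₁ + n₂ = n) (w : (j : Fin K) → ShiftMsg a r j) (j : Fin K)
    (x : Fin n → X) :
    (shiftUser a r e he c).enc h j (fun i => w ⟨i, by omega⟩) x =
      e (sent w j 0) (splitEquiv X h x).1 *
        pointEncoder (c j) (Fin.tail (sent w j)) (splitEquiv X h x).2 := by
  have h0 : sent w j 0 = w j 0 := by simp [sent]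
  have h1 : (shiftUser a r e he c).masked j (fun i => w ⟨i, by omega⟩) = Fin.tail (sent w j) :=
    funext fun s => shiftUser_masked w j s
  rw [h0, ← h1]
  unfold KeyEncoder.enc pointEncoder
  congr!

theorem shiftUser_prob {n : ℕ} (h : n₁ + n₂ = n) (w : (j : Fin K) → ShiftMsg a r j)
    (x : Fin K → Fin n → X) :
    ((shiftUser a r e he c).toSlotEncoder h).prob K w x =
      ∏ j, (e (sent w j 0) (splitEquiv X h (x j)).1 *
        pointEncoder (c j) (Fin.tail (sent w j)) (splitEquiv X h (x j)).2) :=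
  Finset.prod_congr rfl fun j _ => shiftUser_enc h w j (x j)

end Sent

/-! ### The law of the scheme -/

section SchemeLaw

variable {X₁ X₂ Y Z : Type*} [Fintype X₁] [Fintype X₂] [Fintype Y] [Fintype Z]
  (ch : Channel X₁ X₂ Y Z) {n₁ n₂ n a₁ a₂ r₁ r₂ K : ℕ}

/-- Messages, codewords and outputs of a block of length `n`. -/
abbrev BlockSpace (X₁ X₂ Y Z M₁ M₂ : Type*) (n : ℕ) : Type _ :=
  (M₁ × M₂) × ((Fin n → X₁) × (Fin n → X₂)) × (Fin n → Y) × (Fin n → Z)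

/-- The two blocks of slot `j`; the messages are the transmitted ones. -/
abbrev SlotSpace (X₁ X₂ Y Z : Type*) (n₁ n₂ a₁ a₂ r₁ r₂ j : ℕ) : Type _ :=
  BlockSpace X₁ X₂ Y Z (Bits a₁) (Bits a₂) n₁ ×
    BlockSpace X₁ X₂ Y Z (Fin (min j r₁) → Bits a₁) (Fin (min j r₂) → Bits a₂) n₂

/-- The scheme with keys from the preceding slot, see `shiftUser`. Bob decodes what was
transmitted in each block and then removes the keys. -/
noncomputable def shiftScheme (C : WiretapCode X₁ X₂ Y n₁ a₁ a₂) (r₁ r₂ : ℕ)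
    (c₁ : (k : ℕ) → (Fin (min k r₁) → Bits a₁) → Fin n₂ → X₁)
    (c₂ : (k : ℕ) → (Fin (min k r₂) → Bits a₂) → Fin n₂ → X₂)
    (d : (k : ℕ) → (Fin n₂ → Y) → (Fin (min k r₁) → Bits a₁) × (Fin (min k r₂) → Bits a₂))
    (h : n₁ + n₂ = n) : KeyScheme X₁ X₂ Y n where
  n₁ := n₁
  n₂ := n₂
  length_eq := h
  user₁ := shiftUser a₁ r₁ C.enc₁ C.enc₁_mem c₁
  user₂ := shiftUser a₂ r₂ C.enc₂ C.enc₂_mem c₂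
  dec k y :=
    ((sentEquiv a₁ r₁ (k + 1)).symm (fun j => Fin.cons (C.dec (splitEquiv Y h (y j)).1).1
        (d j (splitEquiv Y h (y j)).2).1) (Fin.last k),
      (sentEquiv a₂ r₂ (k + 1)).symm (fun j => Fin.cons (C.dec (splitEquiv Y h (y j)).1).2
        (d j (splitEquiv Y h (y j)).2).2) (Fin.last k))

/-- The slotted code given by `shiftScheme`, with its message sets in explicit form. -/
noncomputable def shiftCode (C : WiretapCode X₁ X₂ Y n₁ a₁ a₂) (r₁ r₂ : ℕ)
    (c₁ : (k : ℕ) → (Fin (min k r₁) → Bits a₁) → Fin n₂ → X₁)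
    (c₂ : (k : ℕ) → (Fin (min k r₂) → Bits a₂) → Fin n₂ → X₂)
    (d : (k : ℕ) → (Fin n₂ → Y) → (Fin (min k r₁) → Bits a₁) × (Fin (min k r₂) → Bits a₂))
    (h : n₁ + n₂ = n) : SlottedCode X₁ X₂ Y n (ShiftMsg a₁ r₁) (ShiftMsg a₂ r₂) :=
  (shiftScheme C r₁ r₂ c₁ c₂ d h).code

/-- The first `K` slots in terms of what is transmitted. -/
noncomputable def schemeEquiv (X₁ X₂ Y Z : Type*) (a₁ a₂ r₁ r₂ K : ℕ) (h : n₁ + n₂ = n) :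
    ((j : Fin K) → SlotSpace X₁ X₂ Y Z n₁ n₂ a₁ a₂ r₁ r₂ j) ≃
      (((j : Fin K) → ShiftMsg a₁ r₁ j) × ((j : Fin K) → ShiftMsg a₂ r₂ j)) ×
      ((Fin K → Fin n → X₁) × (Fin K → Fin n → X₂)) × (Fin K → Fin n → Y) × (Fin K → Fin n → Z) where
  toFun ω := (((sentEquiv a₁ r₁ K).symm fun j => Fin.cons (ω j).1.1.1 (ω j).2.1.1,
      (sentEquiv a₂ r₂ K).symm fun j => Fin.cons (ω j).1.1.2 (ω j).2.1.2),
    (fun j => (splitEquiv X₁ h).symm ((ω j).1.2.1.1, (ω j).2.2.1.1),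
      fun j => (splitEquiv X₂ h).symm ((ω j).1.2.1.2, (ω j).2.2.1.2)),
    fun j => (splitEquiv Y h).symm ((ω j).1.2.2.1, (ω j).2.2.2.1),
    fun j => (splitEquiv Z h).symm ((ω j).1.2.2.2, (ω j).2.2.2.2))
  invFun p j :=
    (((sentEquiv a₁ r₁ K p.1.1 j 0, sentEquiv a₂ r₂ K p.1.2 j 0),
      ((splitEquiv X₁ h (p.2.1.1 j)).1, (splitEquiv X₂ h (p.2.1.2 j)).1),
      (splitEquiv Y h (p.2.2.1 j)).1, (splitEquiv Z h (p.2.2.2 j)).1),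
    ((Fin.tail (sentEquiv a₁ r₁ K p.1.1 j), Fin.tail (sentEquiv a₂ r₂ K p.1.2 j)),
      ((splitEquiv X₁ h (p.2.1.1 j)).2, (splitEquiv X₂ h (p.2.1.2 j)).2),
      (splitEquiv Y h (p.2.2.1 j)).2, (splitEquiv Z h (p.2.2.2 j)).2))
  left_inv ω := by
    simp only [Equiv.apply_symm_apply, Fin.cons_zero, Fin.tail_cons]
  right_inv p := by
    simp only [Prod.mk.eta, Equiv.symm_apply_apply, Fin.cons_self_tail]

/-- The law of slot `j`: its two blocks are independent. -/
noncomputable def slotLaw (C : WiretapCode X₁ X₂ Y n₁ a₁ a₂)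
    {M₁ M₂ : Type*} [Fintype M₁] [Fintype M₂] (c₁ : M₁ → Fin n₂ → X₁) (c₂ : M₂ → Fin n₂ → X₂)
    (ω : BlockSpace X₁ X₂ Y Z (Bits a₁) (Bits a₂) n₁ × BlockSpace X₁ X₂ Y Z M₁ M₂ n₂) : ℝ :=
  C.joint ch ω.1 * ch.blockJoint (pointEncoder c₁) (pointEncoder c₂) ω.2

theorem Channel.block_split (h : n₁ + n₂ = n) (x₁ : Fin n → X₁) (x₂ : Fin n → X₂) (y : Fin n → Y)
    (z : Fin n → Z) : ch.block x₁ x₂ y z =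
      ch.block (splitEquiv X₁ h x₁).1 (splitEquiv X₂ h x₂).1 (splitEquiv Y h y).1
        (splitEquiv Z h z).1 *
      ch.block (splitEquiv X₁ h x₁).2 (splitEquiv X₂ h x₂).2 (splitEquiv Y h y).2
        (splitEquiv Z h z).2 :=
  prod_split h fun t => ch.prob (x₁ t) (x₂ t) (y t, z t)

variable (C : WiretapCode X₁ X₂ Y n₁ a₁ a₂) (c₁ : (k : ℕ) → (Fin (min k r₁) → Bits a₁) → Fin n₂ → X₁)
  (c₂ : (k : ℕ) → (Fin (min k r₂) → Bits a₂) → Fin n₂ → X₂)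
  (d : (k : ℕ) → (Fin n₂ → Y) → (Fin (min k r₁) → Bits a₁) × (Fin (min k r₂) → Bits a₂))
  (h : n₁ + n₂ = n)

theorem card_shiftMsg (a r k : ℕ) : Fintype.card (ShiftMsg a r k) =
    Fintype.card (Bits a) * Fintype.card (Fin (min k r) → Bits a) := by
  simp only [Fintype.card_fun, Fintype.card_fin, pow_succ']

/-- What is transmitted is independent over blocks. -/
theorem shiftCode_joint (ω : (j : Fin K) → SlotSpace X₁ X₂ Y Z n₁ n₂ a₁ a₂ r₁ r₂ j) :
    (shiftCode C r₁ r₂ c₁ c₂ d h).joint ch K (schemeEquiv X₁ X₂ Y Z a₁ a₂ r₁ r₂ K h ω) =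
      ∏ j : Fin K, slotLaw ch C (c₁ j) (c₂ j) (ω j) := by
  -- In terms of the original messages no inverse of `sent` appears.
  obtain ⟨p, rfl⟩ := (schemeEquiv X₁ X₂ Y Z a₁ a₂ r₁ r₂ K h).symm.surjective ω
  rw [Equiv.apply_symm_apply]
  obtain ⟨⟨w₁, w₂⟩, ⟨x₁, x₂⟩, y, z⟩ := p
  have e₁ := shiftUser_prob (he := C.enc₁_mem) (c := c₁) h w₁ x₁
  have e₂ := shiftUser_prob (he := C.enc₂_mem) (c := c₂) h w₂ x₂
  have e : (shiftCode C r₁ r₂ c₁ c₂ d h).joint ch K ((w₁, w₂), (x₁, x₂), y, z) =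
    (Fintype.card (((j : Fin K) → ShiftMsg a₁ r₁ j) × ((j : Fin K) → ShiftMsg a₂ r₂ j)) : ℝ)⁻¹ *
    (((shiftUser a₁ r₁ C.enc₁ C.enc₁_mem c₁).toSlotEncoder h).prob K w₁ x₁ *
      ((shiftUser a₂ r₂ C.enc₂ C.enc₂_mem c₂).toSlotEncoder h).prob K w₂ x₂) *
    ∏ j, ch.block (x₁ j) (x₂ j) (y j) (z j) := rfl
  rw [e, e₁, e₂, Fintype.card_prod, Fintype.card_pi, Fintype.card_pi]
  simp only [card_shiftMsg, ch.block_split h, Nat.cast_mul, Nat.cast_prod, Finset.prod_mul_distrib,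
    slotLaw, WiretapCode.joint, Channel.blockJoint, Finset.prod_inv_distrib, mul_inv,
    Fintype.card_prod]
  simp only [schemeEquiv, sentEquiv, Equiv.coe_fn_symm_mk, Equiv.ofBijective_apply]
  ring

end SchemeLaw

/-! ### Error probability and leakage of the scheme -/

section PointEncoder

variable {A B O M₁ M₂ : Type*} [Fintype A] [Fintype B] [Fintype O] [Fintype M₁] [Fintype M₂]

theorem pointEncoder_mem {M A : Type*} [Fintype A] (c : M → A) (m : M) :
    pointEncoder c m ∈ stdSimplex ℝ A := by
  classical
  refine ⟨fun x => ?_, ?_⟩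
  · unfold pointEncoder
    split_ifs <;> norm_num
  · simp [pointEncoder]

theorem stochasticError_pointEncoder (W : A → B → O → ℝ) (c₁ : M₁ → A) (c₂ : M₂ → B)
    (d : O → M₁ × M₂) :
    stochasticError W (pointEncoder c₁) (pointEncoder c₂) d = macError W c₁ c₂ d := by
  classical
  unfold stochasticError macError
  congr 1
  refine Finset.sum_congr rfl fun m₁ _ => Finset.sum_congr rfl fun m₂ _ => ?_
  simp only [mul_assoc, ← Finset.mul_sum]
  simp [pointEncoder]

end PointEncoder

section UniformHom

variable {Ω G H : Type*} [Fintype Ω] [Fintype G] [Fintype H] [AddCommGroup G] [AddCommGroup H]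

/-- A surjective homomorphism maps the uniform law to the uniform law. -/
theorem law_comp_hom {P : Ω → ℝ} (hP : P ∈ stdSimplex ℝ Ω) {f : Ω → G} {c : ℝ}
    (hf : ∀ g, law P f g = c) (π : G →+ H) (hπ : Function.Surjective π) (b : H) :
    law P (fun ω => π (f ω)) b = (Fintype.card H : ℝ)⁻¹ := by
  classical
  have hc : ∀ b b', law P (fun ω => π (f ω)) b = law P (fun ω => π (f ω)) b' := fun b b' => by
    have e : ∀ b, law P (fun ω => π (f ω)) b = c * (Finset.univ.filter fun g => π g = b).card :=
      fun b => by
        rw [law_eq_sum, ← sum_law_mul P f fun g => if π g = b then 1 else 0]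
        simp only [hf, ← Finset.mul_sum, Finset.sum_boole]
    rw [e, e, AddMonoidHom.card_fiber_eq_of_mem_range π (hπ b) (hπ b')]
  have hs : ∑ b, law P (fun ω => π (f ω)) b = 1 := by
    have := sum_law_mul P (fun ω => π (f ω)) fun _ => 1
    simpa [hP.2] using this
  rw [Finset.sum_congr rfl fun b' _ => hc b' b, Finset.sum_const, Finset.card_univ,
    nsmul_eq_mul] at hs
  exact eq_inv_of_mul_eq_one_right hs

end UniformHom

section SchemeBounds

set_option synthInstance.maxSize 1000

variable {X₁ X₂ Y Z : Type*} [Fintype X₁] [Fintype X₂] [Fintype Y] [Fintype Z]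
  (ch : Channel X₁ X₂ Y Z) {n₁ n₂ n a₁ a₂ r₁ r₂ : ℕ}

theorem Channel.law_blockJoint_messages {M₁ M₂ : Type*} [Fintype M₁] [Fintype M₂]
    {e₁ : M₁ → (Fin n → X₁) → ℝ} {e₂ : M₂ → (Fin n → X₂) → ℝ}
    (h₁ : ∀ m, e₁ m ∈ stdSimplex ℝ (Fin n → X₁)) (h₂ : ∀ m, e₂ m ∈ stdSimplex ℝ (Fin n → X₂))
    (m : M₁ × M₂) :
    law (ch.blockJoint e₁ e₂) (fun ω => ω.1) m = (Fintype.card (M₁ × M₂) : ℝ)⁻¹ := by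
  classical
  have h : ∀ m' : M₁ × M₂, ∑ q, ch.blockJoint e₁ e₂ (m', q) = (Fintype.card (M₁ × M₂) : ℝ)⁻¹ :=
    fun m' => by
      simp only [Channel.blockJoint, Fintype.sum_prod_type, ← Finset.mul_sum, ch.sum_block_eve,
        (blockKernel_mem ch.bob_mem _ _).2, mul_one, (h₂ _).2, (h₁ _).2]
  have h' : ∀ φ : M₁ × M₂ → ℝ, ∑ ω, ch.blockJoint e₁ e₂ ω * φ ω.1 =
      (Fintype.card (M₁ × M₂) : ℝ)⁻¹ * ∑ m', φ m' := fun φ => by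
    rw [Fintype.sum_prod_type]
    simp only [← Finset.sum_mul, h, ← Finset.mul_sum]
  rw [law_eq_sum]
  exact (h' fun m' => if m' = m then 1 else 0).trans (by simp)

variable (C : WiretapCode X₁ X₂ Y n₁ a₁ a₂)

theorem slotLaw_mem {M₁ M₂ : Type*} [Fintype M₁] [Fintype M₂] [Nonempty M₁] [Nonempty M₂]
    (c₁ : M₁ → Fin n₂ → X₁) (c₂ : M₂ → Fin n₂ → X₂) : slotLaw ch C c₁ c₂ ∈ stdSimplex ℝ _ :=
  prod_mem_stdSimplex (ch.blockJoint_mem C.enc₁_mem C.enc₂_mem)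
    (ch.blockJoint_mem (pointEncoder_mem c₁) (pointEncoder_mem c₂))

theorem sum_slotLaw_mul_add {M₁ M₂ : Type*} [Fintype M₁] [Fintype M₂] [Nonempty M₁] [Nonempty M₂]
    (c₁ : M₁ → Fin n₂ → X₁) (c₂ : M₂ → Fin n₂ → X₂)
    (f : BlockSpace X₁ X₂ Y Z (Bits a₁) (Bits a₂) n₁ → ℝ) (g : BlockSpace X₁ X₂ Y Z M₁ M₂ n₂ → ℝ) :
    ∑ ω, slotLaw ch C c₁ c₂ ω * (f ω.1 + g ω.2) = ∑ p, C.joint ch p * f p +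
      ∑ q, ch.blockJoint (pointEncoder c₁) (pointEncoder c₂) q * g q := by
  have h₁ := (ch.blockJoint_mem C.enc₁_mem C.enc₂_mem).2
  have h₂ := (ch.blockJoint_mem (pointEncoder_mem c₁) (pointEncoder_mem c₂)).2
  have h₁' : ∑ p, C.joint ch p = 1 := h₁
  rw [Fintype.sum_prod_type]
  have e : ∀ p, ∑ q, slotLaw ch C c₁ c₂ (p, q) * (f p + g q) = C.joint ch p * f p +
      C.joint ch p * ∑ q, ch.blockJoint (pointEncoder c₁) (pointEncoder c₂) q * g q := fun p => by
    simp only [slotLaw, mul_add, Finset.sum_add_distrib, mul_assoc, ← Finset.mul_sum]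
    rw [← Finset.sum_mul, h₂, one_mul]
  simp only [e, Finset.sum_add_distrib, ← Finset.sum_mul, h₁', one_mul]

variable (c₁ : (k : ℕ) → (Fin (min k r₁) → Bits a₁) → Fin n₂ → X₁)
  (c₂ : (k : ℕ) → (Fin (min k r₂) → Bits a₂) → Fin n₂ → X₂)
  (d : (k : ℕ) → (Fin n₂ → Y) → (Fin (min k r₁) → Bits a₁) × (Fin (min k r₂) → Bits a₂))
  (h : n₁ + n₂ = n)

theorem shiftCode_errorProb_le (k : ℕ) : (shiftCode C r₁ r₂ c₁ c₂ d h).errorProb ch k ≤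
    ∑ j : Fin (k + 1), (C.errorProb ch + macError (blockKernel ch.bob n₂) (c₁ j) (c₂ j) (d j)) := by
  classical
  have hJ := fun j : Fin (k + 1) => slotLaw_mem ch C (c₁ j) (c₂ j)
  have e : ∀ j : Fin (k + 1), C.errorProb ch +
      macError (blockKernel ch.bob n₂) (c₁ j) (c₂ j) (d j) = ∑ ω, slotLaw ch C (c₁ j) (c₂ j) ω *
        ((if C.dec ω.1.2.2.1 ≠ ω.1.1 then 1 else 0) +
          if d j ω.2.2.2.1 ≠ ω.2.1 then 1 else 0) := fun j => by
    rw [sum_slotLaw_mul_add ch C (c₁ j) (c₂ j) (fun p => if C.dec p.2.2.1 ≠ p.1 then 1 else 0)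
      fun q => if d j q.2.2.1 ≠ q.1 then 1 else 0, ← stochasticError_pointEncoder,
      ← ch.sum_blockJoint_error, WiretapCode.errorProb_eq, ← ch.sum_blockJoint_error]
    congr!
  rw [Finset.sum_congr rfl fun j _ => e j, ← sum_pi_mul_sum hJ fun j ω =>
    ((if C.dec ω.1.2.2.1 ≠ ω.1.1 then 1 else 0) + if d j ω.2.2.2.1 ≠ ω.2.1 then 1 else 0),
    SlottedCode.errorProb, ← (schemeEquiv X₁ X₂ Y Z a₁ a₂ r₁ r₂ (k + 1) h).sum_comp]
  refine Finset.sum_le_sum fun ω _ => ?_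
  rw [shiftCode_joint ch C c₁ c₂ d h ω]
  have hp : 0 ≤ ∏ j : Fin (k + 1), slotLaw ch C (c₁ j) (c₂ j) (ω j) :=
    Finset.prod_nonneg fun j _ => (hJ j).1 _
  have hterm : ∀ j : Fin (k + 1), (0 : ℝ) ≤ (if C.dec (ω j).1.2.2.1 ≠ (ω j).1.1 then 1 else 0) +
      if d j (ω j).2.2.2.1 ≠ (ω j).2.1 then 1 else 0 := fun j => by
    split_ifs <;> norm_num
  by_cases hall : ∀ j : Fin (k + 1), C.dec (ω j).1.2.2.1 = (ω j).1.1 ∧ d j (ω j).2.2.2.1 = (ω j).2.1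
  · have hd : (shiftCode C r₁ r₂ c₁ c₂ d h).dec k
        (schemeEquiv X₁ X₂ Y Z a₁ a₂ r₁ r₂ (k + 1) h ω).2.2.1 =
        ((schemeEquiv X₁ X₂ Y Z a₁ a₂ r₁ r₂ (k + 1) h ω).1.1 (Fin.last k),
          (schemeEquiv X₁ X₂ Y Z a₁ a₂ r₁ r₂ (k + 1) h ω).1.2 (Fin.last k)) := by
      simp only [shiftCode, shiftScheme, KeyScheme.code, schemeEquiv, Equiv.coe_fn_mk,
        Equiv.apply_symm_apply, (hall _).1, (hall _).2]
      rfl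
    rw [if_neg (not_not.2 hd)]
    exact mul_nonneg hp (Finset.sum_nonneg fun j _ => hterm j)
  · push Not at hall
    obtain ⟨j, hj⟩ := hall
    have h1 : (1 : ℝ) ≤ ∑ j : Fin (k + 1), ((if C.dec (ω j).1.2.2.1 ≠ (ω j).1.1 then 1 else 0) +
        if d j (ω j).2.2.2.1 ≠ (ω j).2.1 then 1 else 0) := by
      refine le_trans ?_ (Finset.single_le_sum (fun j _ => hterm j) (Finset.mem_univ j))
      by_cases hC : C.dec (ω j).1.2.2.1 = (ω j).1.1
      · rw [if_pos (hj hC)]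
        split_ifs <;> norm_num
      · rw [if_pos hC]
        split_ifs <;> norm_num
    refine le_trans ?_ (le_mul_of_one_le_right hp h1)
    split_ifs
    · exact le_rfl
    · exact hp

end SchemeBounds

section Roots

variable {a₁ a₂ r₁ r₂ : ℕ}

/-- The roots of the chains of keys of the messages of slot `l`. -/
def roots {a₁ a₂ K : ℕ} (r₁ r₂ : ℕ) (l : Fin K) :
    (Fin K → Bits a₁ × Bits a₂) →+ ShiftMsg a₁ r₁ l × ShiftMsg a₂ r₂ l where
  toFun u := (fun s => (u ⟨l - s, by omega⟩).1, fun s => (u ⟨l - s, by omega⟩).2)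
  map_zero' := rfl
  map_add' _ _ := rfl

theorem roots_surjective {K : ℕ} (l : Fin K) :
    Function.Surjective (roots (a₁ := a₁) (a₂ := a₂) r₁ r₂ l) := by
  rintro ⟨w₁, w₂⟩
  refine ⟨fun j => (if h : (l : ℕ) - j < min (l : ℕ) r₁ + 1 then w₁ ⟨l - j, h⟩ else 0,
    if h : (l : ℕ) - j < min (l : ℕ) r₂ + 1 then w₂ ⟨l - j, h⟩ else 0), ?_⟩
  refine Prod.ext (funext fun s => ?_) (funext fun s => ?_)
  · have e : (l : ℕ) - (l - s) = s := by have := s.2; omega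
    simp only [roots, AddMonoidHom.coe_mk, ZeroHom.coe_mk, e]
    exact dif_pos s.2
  · have e : (l : ℕ) - (l - s) = s := by have := s.2; omega
    simp only [roots, AddMonoidHom.coe_mk, ZeroHom.coe_mk, e]
    exact dif_pos s.2

theorem sentEquiv_symm_apply {a r K : ℕ} (v : (j : Fin K) → ShiftMsg a r j) (l : Fin K)
    (s : Fin (min (l : ℕ) r + 1)) : (sentEquiv a r K).symm v l s =
      offset (extend v) l s + v ⟨l - s, by omega⟩ 0 := by
  obtain ⟨w, rfl⟩ := (sentEquiv a r K).surjective v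
  rw [Equiv.symm_apply_apply, ← extend_apply w l s, extend_eq_offset_add w l.2 s.2]
  have e : extend (sent w) (l - s) 0 = sent w ⟨l - s, by omega⟩ 0 :=
    extend_apply (sent w) ⟨l - s, by omega⟩ 0
  rw [e]
  rfl

theorem offset_extend_cons {a r K : ℕ} (u u' : Fin K → Bits a)
    (v : (j : Fin K) → Fin (min (j : ℕ) r) → Bits a) (k s : ℕ) :
    offset (extend (r := r) fun j => Fin.cons (u j) (v j)) k s =
      offset (extend (r := r) fun j => Fin.cons (u' j) (v j)) k s := by
  refine offset_congr (fun k s => ?_) k s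
  unfold extend
  split_ifs with h
  · rfl
  · rfl

end Roots

section SchemeLeakage

set_option synthInstance.maxSize 1000

variable {X₁ X₂ Y Z : Type*} [Fintype X₁] [Fintype X₂] [Fintype Y] [Fintype Z]
  (ch : Channel X₁ X₂ Y Z) {n₁ n₂ n a₁ a₂ r₁ r₂ : ℕ}

/-- A variable that is masked by a uniform one leaks no more than the mask. -/
theorem mutualInfo_mask_le {Ω V G : Type*} [Fintype Ω] [Fintype V] [Fintype G] [AddGroup V]
    {P : Ω → ℝ} (hP : P ∈ stdSimplex ℝ Ω) (u : Ω → V) (g : Ω → G) (t : G → V)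
    (hu : ∀ v, law P u v = (Fintype.card V : ℝ)⁻¹) :
    mutualInfo P (fun ω => t (g ω) + u ω) g ≤ mutualInfo P u g := by
  have l2 := Real.log_pos one_lt_two
  have h1 : entropy P (fun ω => t (g ω) + u ω) ≤ entropy P u :=
    le_of_mul_le_mul_right ((entropy_le_log_card hP _).trans
      (entropy_of_law_uniform hP u hu).ge) l2
  have h2 : entropy P (fun ω => (t (g ω) + u ω, g ω)) = entropy P (fun ω => (u ω, g ω)) :=
    entropy_comp_injective P (fun ω => (u ω, g ω)) (φ := fun p => (t p.2 + p.1, p.2)) (by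
      rintro ⟨x, y⟩ ⟨x', y'⟩ h
      simp only [Prod.mk.injEq] at h
      obtain ⟨h, rfl⟩ := h
      simpa using h)
  rw [mutualInfo, mutualInfo, h2]
  linarith

variable (C : WiretapCode X₁ X₂ Y n₁ a₁ a₂) (c₁ : (k : ℕ) → (Fin (min k r₁) → Bits a₁) → Fin n₂ → X₁)
  (c₂ : (k : ℕ) → (Fin (min k r₂) → Bits a₂) → Fin n₂ → X₂)
  (d : (k : ℕ) → (Fin n₂ → Y) → (Fin (min k r₁) → Bits a₁) × (Fin (min k r₂) → Bits a₂))
  (h : n₁ + n₂ = n)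

/-- What Eve observes of slot `j`, when she is also given the second block with its messages. -/
abbrev EveSpace (X₁ X₂ Y Z : Type*) (n₁ n₂ a₁ a₂ r₁ r₂ j : ℕ) : Type _ :=
  (Fin n₁ → Z) × BlockSpace X₁ X₂ Y Z (Fin (min j r₁) → Bits a₁) (Fin (min j r₂) → Bits a₂) n₂

/-- Only the first blocks of the slots in which the chains of keys start contribute to the leakage. -/
theorem shiftCode_leakage_le (k : ℕ) (l : Fin (k + 1)) :
    (shiftCode C r₁ r₂ c₁ c₂ d h).leakage ch k l ≤ (max r₁ r₂ + 1) * C.leakage ch := by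
  classical
  have hJ := fun j : Fin (k + 1) => slotLaw_mem ch C (c₁ j) (c₂ j)
  set P : ((j : Fin (k + 1)) → SlotSpace X₁ X₂ Y Z n₁ n₂ a₁ a₂ r₁ r₂ j) → ℝ := 
    fun ω => ∏ j : Fin (k + 1), slotLaw ch C (c₁ j) (c₂ j) (ω j) with hPd
  have hP : P ∈ stdSimplex ℝ ((j : Fin (k + 1)) → SlotSpace X₁ X₂ Y Z n₁ n₂ a₁ a₂ r₁ r₂ j) := pi_mem_stdSimplex hJ
  let E := schemeEquiv X₁ X₂ Y Z a₁ a₂ r₁ r₂ (k + 1) h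
  -- The messages transmitted in the first blocks, and what Eve observes.
  let u : ((j : Fin (k + 1)) → SlotSpace X₁ X₂ Y Z n₁ n₂ a₁ a₂ r₁ r₂ j) →
      Fin (k + 1) → Bits a₁ × Bits a₂ := fun ω j => (ω j).1.1
  let g : ((j : Fin (k + 1)) → SlotSpace X₁ X₂ Y Z n₁ n₂ a₁ a₂ r₁ r₂ j) →
      ∀ j : Fin (k + 1), EveSpace X₁ X₂ Y Z n₁ n₂ a₁ a₂ r₁ r₂ j :=
    fun ω j => ((ω j).1.2.2.2, (ω j).2)
  let t : (∀ j : Fin (k + 1), EveSpace X₁ X₂ Y Z n₁ n₂ a₁ a₂ r₁ r₂ j) →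
      ShiftMsg a₁ r₁ l × ShiftMsg a₂ r₂ l := fun g =>
    (fun s => offset (extend (r := r₁) fun j => Fin.cons 0 (g j).2.1.1) l s,
      fun s => offset (extend (r := r₂) fun j => Fin.cons 0 (g j).2.1.2) l s)
  have hleak : (shiftCode C r₁ r₂ c₁ c₂ d h).leakage ch k l =
      mutualInfo P (fun ω => ((E ω).1.1 l, (E ω).1.2 l)) (fun ω => (E ω).2.2.2) := by
    have := mutualInfo_comp_equiv ((shiftCode C r₁ r₂ c₁ c₂ d h).joint ch (k + 1)) E
      (fun ω => (ω.1.1 l, ω.1.2 l)) (fun ω => ω.2.2.2)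
    rw [SlottedCode.leakage, ← this]
    congr 1
    funext ω
    exact shiftCode_joint ch C c₁ c₂ d h ω
  have hmsg : ∀ ω, ((E ω).1.1 l, (E ω).1.2 l) = t (g ω) + roots r₁ r₂ l (u ω) := fun ω => by
    refine Prod.ext (funext fun s => ?_) (funext fun s => ?_)
    · refine (sentEquiv_symm_apply (fun j => Fin.cons (ω j).1.1.1 (ω j).2.1.1) l s).trans ?_
      rw [offset_extend_cons _ (fun _ => 0)]
      rfl
    · refine (sentEquiv_symm_apply (fun j => Fin.cons (ω j).1.1.2 (ω j).2.1.2) l s).trans ?_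
      rw [offset_extend_cons _ (fun _ => 0)]
      rfl
  have hu : ∀ v, law P u v = ∏ _j : Fin (k + 1), (Fintype.card (Bits a₁ × Bits a₂) : ℝ)⁻¹ :=
    fun v => by
      refine (law_pi (fun j : Fin (k + 1) => slotLaw ch C (c₁ j) (c₂ j)) (fun j ω => ω.1.1) v).trans
        (Finset.prod_congr rfl fun j _ => ?_)
      refine (law_comp_fst (ch.blockJoint_mem (pointEncoder_mem (c₁ j)) (pointEncoder_mem (c₂ j))).2
        (fun p : BlockSpace X₁ X₂ Y Z (Bits a₁) (Bits a₂) n₁ => p.1) (v j)).trans ?_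
      exact ch.law_blockJoint_messages C.enc₁_mem C.enc₂_mem (v j)
  -- The roots of slot `l` lie in the slots `l - max r₁ r₂, …, l`.
  let A : Fin (k + 1) → Bits a₁ × Bits a₂ → Bits a₁ × Bits a₂ := fun j m =>
    if (l : ℕ) ≤ j + max r₁ r₂ ∧ j ≤ l then m else 0
  have hroots : ∀ u, roots r₁ r₂ l u = roots r₁ r₂ l fun j => A j (u j) := fun u => by
    refine Prod.ext (funext fun s => ?_) (funext fun s => ?_)
    · have hs := s.2
      simp only [roots, A, AddMonoidHom.coe_mk, ZeroHom.coe_mk]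
      rw [if_pos ⟨by omega, Fin.le_def.2 (Nat.sub_le _ _)⟩]
    · have hs := s.2
      simp only [roots, A, AddMonoidHom.coe_mk, ZeroHom.coe_mk]
      rw [if_pos ⟨by omega, Fin.le_def.2 (Nat.sub_le _ _)⟩]
  have hblock : ∀ j : Fin (k + 1), mutualInfo (slotLaw ch C (c₁ j) (c₂ j)) (fun ω => A j ω.1.1)
      (fun ω => ((ω.1.2.2.2, ω.2) : EveSpace X₁ X₂ Y Z n₁ n₂ a₁ a₂ r₁ r₂ j)) =
      if (l : ℕ) ≤ j + max r₁ r₂ ∧ j ≤ l then C.leakage ch else 0 := fun j => by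
    by_cases hj : (l : ℕ) ≤ j + max r₁ r₂ ∧ j ≤ l
    · simp only [A, if_pos hj]
      exact mutualInfo_prod (ch.blockJoint_mem C.enc₁_mem C.enc₂_mem)
        (ch.blockJoint_mem (pointEncoder_mem (c₁ j)) (pointEncoder_mem (c₂ j))) (fun p => p.1)
        (fun p => p.2.2.2) fun q => q
    · simp only [A, if_neg hj]
      rw [mutualInfo_comm]
      exact mutualInfo_const_right (hJ j).2 _ _
  have hcard : (Finset.univ.filter fun j : Fin (k + 1) =>
      (l : ℕ) ≤ j + max r₁ r₂ ∧ j ≤ l).card ≤ max r₁ r₂ + 1 := by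
    rw [← Finset.card_range (max r₁ r₂ + 1)]
    refine Finset.card_le_card_of_injOn (fun j : Fin (k + 1) => (l : ℕ) - j)
      (fun j hj => ?_) fun j hj j' hj' hjj => ?_
    · have hj := (Finset.mem_filter.1 hj).2
      refine Finset.mem_coe.2 (Finset.mem_range.2 ?_)
      dsimp only
      omega
    · simp only [Finset.coe_filter, Finset.mem_univ, true_and, Set.mem_ofPred_eq, Fin.le_def] at hj hj'
      ext
      simp only at hjj
      omega
  have h0 : 0 ≤ C.leakage ch := mutualInfo_nonneg (ch.blockJoint_mem C.enc₁_mem C.enc₂_mem) _ _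
  calc (shiftCode C r₁ r₂ c₁ c₂ d h).leakage ch k l
      = mutualInfo P (fun ω => t (g ω) + roots r₁ r₂ l (u ω)) (fun ω => (E ω).2.2.2) := by
        rw [hleak, funext hmsg]
    _ ≤ mutualInfo P (fun ω => t (g ω) + roots r₁ r₂ l (u ω)) g :=
        mutualInfo_comp_right_le hP.1 _ g fun g j => (splitEquiv Z h).symm ((g j).1, (g j).2.2.2.2)
    _ ≤ mutualInfo P (fun ω => roots r₁ r₂ l (u ω)) g :=
        mutualInfo_mask_le hP _ g t (law_comp_hom hP hu _ (roots_surjective l))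
    _ = mutualInfo P (fun ω => roots r₁ r₂ l fun j => A j (u ω j)) g := by
        simp only [← hroots]
    _ ≤ mutualInfo P (fun ω j => A j (u ω j)) g :=
        mutualInfo_comp_left_le hP.1 (fun ω j => A j (u ω j)) g (roots r₁ r₂ l)
    _ = ∑ j : Fin (k + 1), if (l : ℕ) ≤ j + max r₁ r₂ ∧ j ≤ l then C.leakage ch else 0 := by
        rw [← Finset.sum_congr rfl fun j _ => hblock j]
        exact mutualInfo_pi hJ (fun j ω => A j ω.1.1) fun j ω => (ω.1.2.2.2, ω.2)
    _ ≤ (max r₁ r₂ + 1) * C.leakage ch := by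
        rw [← Finset.sum_filter, Finset.sum_const, nsmul_eq_mul]
        refine mul_le_mul_of_nonneg_right ?_ h0
        exact_mod_cast hcard

end SchemeLeakage

/-! ### The rates of the scheme -/

section Rates

variable {X₁ X₂ Y Z : Type*} [Fintype X₁] [Fintype X₂] [Fintype Y] [Fintype Z]
  (ch : Channel X₁ X₂ Y Z)

/-- The messages of `a` bits fit into `x` bits, also for `a = 0`, where the quotient is `0`. -/
theorem floor_div_mul_le {x : ℝ} (hx : 0 ≤ x) (a k : ℕ) :
    ((min k ⌊x / a⌋₊ * a : ℕ) : ℝ) ≤ x := by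
  rcases Nat.eq_zero_or_pos a with rfl | ha
  · simpa using hx
  · have ha' : (0 : ℝ) < a := by exact_mod_cast ha
    have h1 : ((min k ⌊x / a⌋₊ : ℕ) : ℝ) ≤ x / a :=
      (Nat.cast_le.2 (min_le_right _ _)).trans (Nat.floor_le (by positivity))
    rw [Nat.cast_mul]
    exact (le_div_iff₀ ha').1 h1

theorem le_floor_div_add_one_mul (x : ℝ) {a : ℕ} (ha : 0 < a) :
    x ≤ ((⌊x / a⌋₊ + 1) * a : ℕ) := by
  have ha' : (0 : ℝ) < a := by exact_mod_cast ha
  push_cast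
  exact (div_le_iff₀ ha').1 (Nat.lt_floor_add_one _).le

theorem log_card_messages (a r : ℕ) :
    Real.log (Fintype.card (Fin r → Bits a)) = (r * a : ℕ) * Real.log 2 := by
  rw [Fintype.card_fun, Fintype.card_fin, Nat.cast_pow, Real.log_pow, log_card_bits]
  push_cast
  ring

theorem SlottedCode.errorProb_nonneg {n : ℕ} {M₁ M₂ : ℕ → Type} [∀ k, Fintype (M₁ k)]
    [∀ k, Fintype (M₂ k)] [∀ k, Nonempty (M₁ k)] [∀ k, Nonempty (M₂ k)]
    (C : SlottedCode X₁ X₂ Y n M₁ M₂) (k : ℕ) : 0 ≤ C.errorProb ch k := by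
  classical
  refine Finset.sum_nonneg fun ω _ => ?_
  split_ifs
  · exact (C.joint_mem ch (k + 1)).1 ω
  · exact le_rfl

/-- If wiretap coding yields some positive secrecy rates, then the scheme achieves every pair inside
the capacity region of the multiple access channel: a small fixed fraction of each slot is left to the
wiretap code, so that a bounded number of masked messages fills the rest of the slot. -/
theorem Channel.PositiveSecrecy.achievableByKeys (hsec : ch.PositiveSecrecy) {p₁ : X₁ → ℝ}
    {p₂ : X₂ → ℝ} (hp₁ : p₁ ∈ stdSimplex ℝ X₁) (hp₂ : p₂ ∈ stdSimplex ℝ X₂) {R : ℝ × ℝ}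
    (hR₁ : 0 ≤ R.1) (hR₂ : 0 ≤ R.2) (h₁ : R.1 < ch.infoY₁ p₁ p₂) (h₂ : R.2 < ch.infoY₂ p₁ p₂)
    (h₃ : R.1 + R.2 < ch.infoY p₁ p₂) : ch.AchievableByKeys R := by
  refine ⟨hR₁, hR₂, fun ε hε => ?_⟩
  obtain ⟨ρ₁, hρ₁, ρ₂, hρ₂, b₁, b₂, C, hb, herr, hleak⟩ := hsec
  have l2 := Real.log_pos one_lt_two
  -- Rates slightly above the required ones make up for the part left to the wiretap code.
  obtain ⟨κ, hκ, k₁, k₂, k₃⟩ : ∃ κ > 0, R.1 + κ < ch.infoY₁ p₁ p₂ ∧ R.2 + κ < ch.infoY₂ p₁ p₂ ∧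
      R.1 + κ + (R.2 + κ) < ch.infoY p₁ p₂ := by
    obtain ⟨κ, hκ, hm⟩ := exists_between (lt_min (lt_min (sub_pos.2 h₁) (sub_pos.2 h₂))
      (half_pos (sub_pos.2 h₃)))
    have m1 := hm.trans_le ((min_le_left _ _).trans (min_le_left _ _))
    have m2 := hm.trans_le ((min_le_left _ _).trans (min_le_right _ _))
    have m3 := hm.trans_le (min_le_right _ _)
    exact ⟨κ, hκ, by linarith, by linarith, by linarith⟩
  set R₁ := R.1 + κ with hR₁d
  set R₂ := R.2 + κ with hR₂d
  have R₁0 : 0 ≤ R₁ := by linarith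
  have R₂0 : 0 ≤ R₂ := by linarith
  obtain ⟨q, hq⟩ := exists_nat_ge (max 2 (max (R₁ / κ) (R₂ / κ)))
  have q2 : 2 ≤ q := by exact_mod_cast (le_max_left _ _).trans hq
  have q0 : (0 : ℝ) < q := by positivity
  have qR₁ : R₁ ≤ q * κ :=
    (div_le_iff₀ hκ).1 (((le_max_left _ _).trans (le_max_right _ _)).trans hq)
  have qR₂ : R₂ ≤ q * κ :=
    (div_le_iff₀ hκ).1 (((le_max_right _ _).trans (le_max_right _ _)).trans hq)
  obtain ⟨η, hη, hmac⟩ := ch.exists_macCodes hp₁ hp₂ k₁ k₂ k₃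
  have hlen : ∀ n : ℕ, n / q + (n - n / q) = n := fun n => Nat.add_sub_of_le (Nat.div_le_self n q)
  let r₁ : ℕ → ℕ := fun n => ⌊((n - n / q : ℕ) * R₁) / b₁ (n / q)⌋₊
  let r₂ : ℕ → ℕ := fun n => ⌊((n - n / q : ℕ) * R₂) / b₂ (n / q)⌋₊
  have hcodes : ∀ n k : ℕ, ∃ (c₁ : (Fin (min k (r₁ n)) → Bits (b₁ (n / q))) → Fin (n - n / q) → X₁)
      (c₂ : (Fin (min k (r₂ n)) → Bits (b₂ (n / q))) → Fin (n - n / q) → X₂)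
      (d : (Fin (n - n / q) → Y) → (Fin (min k (r₁ n)) → Bits (b₁ (n / q))) ×
        (Fin (min k (r₂ n)) → Bits (b₂ (n / q)))),
      macError (blockKernel ch.bob (n - n / q)) c₁ c₂ d ≤ η (n - n / q) := fun n k => by
    refine hmac _ _ _ ?_ ?_
    · rw [log_card_messages]
      exact mul_le_mul_of_nonneg_right (floor_div_mul_le (by positivity) _ _) l2.le
    · rw [log_card_messages]
      exact mul_le_mul_of_nonneg_right (floor_div_mul_le (by positivity) _ _) l2.le
  choose c₁ c₂ d hd using hcodes
  have lim₁ : Tendsto (fun n : ℕ => n / q) atTop atTop :=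
    Nat.tendsto_div_const_atTop (by omega)
  have lim₂ : Tendsto (fun n : ℕ => n - n / q) atTop atTop := by
    refine tendsto_atTop_mono (fun n => ?_) (Nat.tendsto_div_const_atTop (show 2 ≠ 0 by norm_num))
    have : n / q ≤ n / 2 := Nat.div_le_div_left q2 (by norm_num)
    omega
  -- The numbers of masked messages are bounded, as the slot is at most `2 q` times as long as its
  -- first part.
  let B : ℕ := ⌈max (2 * q * R₁ / ρ₁) (2 * q * R₂ / ρ₂)⌉₊
  have bound : ∀ (n b : ℕ) (ρ R' : ℝ), 0 < ρ → 0 ≤ R' → 1 ≤ n / q → (n / q : ℕ) * ρ ≤ b →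
      ((n - n / q : ℕ) * R') / b ≤ 2 * q * R' / ρ := by
    intro n b ρ R' hρ hR' hn hb
    have hn' : (1 : ℝ) ≤ (n / q : ℕ) := by exact_mod_cast hn
    have hb0 : (0 : ℝ) < b := (mul_pos (by linarith) hρ).trans_le hb
    have h2 : n - n / q ≤ 2 * q * (n / q) := by
      have e1 := Nat.div_add_mod n q
      have e2 := Nat.mod_lt n (show 0 < q by omega)
      have e3 : q * 1 ≤ q * (n / q) := Nat.mul_le_mul_left q hn
      rw [mul_assoc]
      omega
    have h2' : ((n - n / q : ℕ) : ℝ) ≤ 2 * q * (n / q : ℕ) := by exact_mod_cast h2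
    rw [div_le_div_iff₀ hb0 hρ]
    calc ((n - n / q : ℕ) : ℝ) * R' * ρ ≤ 2 * q * (n / q : ℕ) * R' * ρ := by gcongr
      _ = 2 * q * R' * ((n / q : ℕ) * ρ) := by ring
      _ ≤ 2 * q * R' * b := by gcongr
  have evB : ∀ᶠ n in atTop, (0 < b₁ (n / q) ∧ r₁ n ≤ B) ∧ (0 < b₂ (n / q) ∧ r₂ n ≤ B) := by
    filter_upwards [lim₁.eventually hb, lim₁.eventually_ge_atTop 1] with n hn hn1
    have hn' : (1 : ℝ) ≤ (n / q : ℕ) := by exact_mod_cast hn1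
    have p₁ : (0 : ℝ) < b₁ (n / q) := (mul_pos (by linarith) hρ₁).trans_le hn.1
    have p₂ : (0 : ℝ) < b₂ (n / q) := (mul_pos (by linarith) hρ₂).trans_le hn.2
    refine ⟨⟨by exact_mod_cast p₁, ?_⟩, by exact_mod_cast p₂, ?_⟩
    · exact Nat.cast_le.1 ((Nat.floor_le (by positivity)).trans
        (((bound n _ ρ₁ R₁ hρ₁ R₁0 hn1 hn.1).trans (le_max_left _ _)).trans (Nat.le_ceil _)))
    · exact Nat.cast_le.1 ((Nat.floor_le (by positivity)).trans
        (((bound n _ ρ₂ R₂ hρ₂ R₂0 hn1 hn.2).trans (le_max_right _ _)).trans (Nat.le_ceil _)))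
  refine ⟨fun n => shiftScheme (C (n / q)) (r₁ n) (r₂ n) (c₁ n) (c₂ n) (d n) (hlen n),
    fun k => ?_, ?_, B, ?_⟩
  · have hlim : Tendsto (fun n => ∑ _j : Fin (k + 1), ((C (n / q)).errorProb ch + η (n - n / q)))
        atTop (𝓝 0) := by
      have := tendsto_finsetSum (Finset.univ : Finset (Fin (k + 1))) fun _ _ =>
        (herr.comp lim₁).add (hη.comp lim₂)
      simpa using this
    refine squeeze_zero (fun n => ?_) (fun n => ?_) hlim
    · exact (shiftCode (C (n / q)) (r₁ n) (r₂ n) (c₁ n) (c₂ n) (d n) (hlen n)).errorProb_nonneg ch k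
    · exact (shiftCode_errorProb_le ch (C (n / q)) (c₁ n) (c₂ n) (d n) (hlen n) k).trans
        (Finset.sum_le_sum fun j _ => add_le_add le_rfl (hd n j))
  · have hε' : 0 < ε / (B + 1) := by positivity
    filter_upwards [evB, lim₁.eventually (hleak.eventually_lt_const hε'),
      lim₁.eventually_ge_atTop 1] with n hB hn hn1 k l
    have hn' : (0 : ℝ) < (n / q : ℕ) := by exact_mod_cast hn1
    have hL := (div_lt_iff₀ hn').1 hn
    have h0 : 0 ≤ (C (n / q)).leakage ch :=
      mutualInfo_nonneg (ch.blockJoint_mem (C (n / q)).enc₁_mem (C (n / q)).enc₂_mem) _ _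
    have hmax : ((max (r₁ n) (r₂ n) : ℕ) : ℝ) ≤ B := by exact_mod_cast max_le hB.1.2 hB.2.2
    have hle : ((n / q : ℕ) : ℝ) ≤ n := by exact_mod_cast Nat.div_le_self n q
    refine (shiftCode_leakage_le ch (C (n / q)) (c₁ n) (c₂ n) (d n) (hlen n) k l).trans ?_
    calc (((max (r₁ n) (r₂ n) : ℕ) : ℝ) + 1) * (C (n / q)).leakage ch
        ≤ (B + 1) * (ε / (B + 1) * (n / q : ℕ)) := by
          refine mul_le_mul (by linarith) hL.le h0 (by positivity)
      _ = (n / q : ℕ) * ε := by field_simp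
      _ ≤ n * ε := by gcongr
  · have rate : ∀ (n : ℕ) (x : ℝ), 0 ≤ x → x + κ ≤ q * κ → n * x ≤ (n - n / q : ℕ) * (x + κ) := by
      intro n x hx hxq
      have e : ((n - n / q : ℕ) : ℝ) = n - (n / q : ℕ) := Nat.cast_sub (Nat.div_le_self n q)
      have e2 : ((n / q : ℕ) : ℝ) * q ≤ n := by exact_mod_cast Nat.div_mul_le_self n q
      have e3 : ((n / q : ℕ) : ℝ) * (x + κ) ≤ (n / q : ℕ) * (q * κ) := by gcongr
      have e4 := mul_le_mul_of_nonneg_right e2 hκ.le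
      rw [e]
      nlinarith
    filter_upwards [evB] with n hB k hk
    constructor
    · have e : (shiftUser (b₁ (n / q)) (r₁ n) (C (n / q)).enc₁ (C (n / q)).enc₁_mem (c₁ n)).bits k =
          (r₁ n + 1) * b₁ (n / q) := by
        simp only [KeyEncoder.bits, shiftUser, min_eq_right (hB.1.2.trans hk)]
      exact ((rate n R.1 hR₁ qR₁).trans (le_floor_div_add_one_mul _ hB.1.1)).trans_eq
        (congrArg Nat.cast e.symm)
    · have e : (shiftUser (b₂ (n / q)) (r₂ n) (C (n / q)).enc₂ (C (n / q)).enc₂_mem (c₂ n)).bits k =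
          (r₂ n + 1) * b₂ (n / q) := by
        simp only [KeyEncoder.bits, shiftUser, min_eq_right (hB.2.2.trans hk)]
      exact ((rate n R.2 hR₂ qR₂).trans (le_floor_div_add_one_mul _ hB.2.1)).trans_eq
        (congrArg Nat.cast e.symm)

end Rates

/-! ### Messages as bit strings -/

section Relabel

variable {X₁ X₂ Y Z : Type*} [Fintype X₁] [Fintype X₂] [Fintype Y] [Fintype Z]
  (ch : Channel X₁ X₂ Y Z) {n : ℕ} {M₁ M₂ M₁' M₂' : ℕ → Type} [∀ k, Fintype (M₁ k)]
  [∀ k, Fintype (M₂ k)] [∀ k, Fintype (M₁' k)] [∀ k, Fintype (M₂' k)]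

/-- A slotted code with renamed messages. -/
def SlottedCode.relabel (C : SlottedCode X₁ X₂ Y n M₁ M₂) (e₁ : ∀ k, M₁' k ≃ M₁ k)
    (e₂ : ∀ k, M₂' k ≃ M₂ k) : SlottedCode X₁ X₂ Y n M₁' M₂' where
  enc₁ := ⟨fun k w => C.enc₁.enc k fun j => e₁ j (w j), fun _ _ _ => C.enc₁.enc_mem _ _ _⟩
  enc₂ := ⟨fun k w => C.enc₂.enc k fun j => e₂ j (w j), fun _ _ _ => C.enc₂.enc_mem _ _ _⟩
  dec k y := ((e₁ k).symm (C.dec k y).1, (e₂ k).symm (C.dec k y).2)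

/-- The sample space of a slotted code with renamed messages. -/
def relabelEquiv (X₁ X₂ Y Z : Type*) (n : ℕ) (e₁ : ∀ k, M₁' k ≃ M₁ k) (e₂ : ∀ k, M₂' k ≃ M₂ k)
    (K : ℕ) :
    (((j : Fin K) → M₁' j) × ((j : Fin K) → M₂' j)) × ((Fin K → Fin n → X₁) × (Fin K → Fin n → X₂)) ×
      (Fin K → Fin n → Y) × (Fin K → Fin n → Z) ≃
    (((j : Fin K) → M₁ j) × ((j : Fin K) → M₂ j)) × ((Fin K → Fin n → X₁) × (Fin K → Fin n → X₂)) ×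
      (Fin K → Fin n → Y) × (Fin K → Fin n → Z) :=
  Equiv.prodCongr (Equiv.prodCongr (Equiv.piCongrRight fun j : Fin K => e₁ j)
    (Equiv.piCongrRight fun j : Fin K => e₂ j)) (Equiv.refl _)

theorem SlottedCode.relabel_joint (C : SlottedCode X₁ X₂ Y n M₁ M₂) (e₁ : ∀ k, M₁' k ≃ M₁ k)
    (e₂ : ∀ k, M₂' k ≃ M₂ k) (K : ℕ) (ω) : (C.relabel e₁ e₂).joint ch K ω =
      C.joint ch K (relabelEquiv X₁ X₂ Y Z n e₁ e₂ K ω) := by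
  unfold SlottedCode.joint
  rw [Fintype.card_congr (Equiv.prodCongr (Equiv.piCongrRight fun j : Fin K => e₁ j)
    (Equiv.piCongrRight fun j : Fin K => e₂ j))]
  rfl

theorem SlottedCode.relabel_errorProb (C : SlottedCode X₁ X₂ Y n M₁ M₂) (e₁ : ∀ k, M₁' k ≃ M₁ k)
    (e₂ : ∀ k, M₂' k ≃ M₂ k) (k : ℕ) : (C.relabel e₁ e₂).errorProb ch k = C.errorProb ch k := by
  classical
  rw [SlottedCode.errorProb, SlottedCode.errorProb,
    ← (relabelEquiv X₁ X₂ Y Z n e₁ e₂ (k + 1)).sum_comp]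
  refine Finset.sum_congr rfl fun ω _ => ?_
  rw [C.relabel_joint ch e₁ e₂]
  refine if_congr (not_congr ?_) rfl rfl
  simp only [SlottedCode.relabel, relabelEquiv, Prod.ext_iff, Equiv.symm_apply_eq]
  rfl

theorem SlottedCode.relabel_leakage (C : SlottedCode X₁ X₂ Y n M₁ M₂) (e₁ : ∀ k, M₁' k ≃ M₁ k)
    (e₂ : ∀ k, M₂' k ≃ M₂ k) (k : ℕ) (l : Fin (k + 1)) :
    (C.relabel e₁ e₂).leakage ch k l = C.leakage ch k l := by
  have hj : (C.relabel e₁ e₂).joint ch (k + 1) = fun ω =>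
      C.joint ch (k + 1) (relabelEquiv X₁ X₂ Y Z n e₁ e₂ (k + 1) ω) :=
    funext (C.relabel_joint ch e₁ e₂ (k + 1))
  have h := mutualInfo_comp_equiv (C.joint ch (k + 1)) (relabelEquiv X₁ X₂ Y Z n e₁ e₂ (k + 1))
    (fun ω => (ω.1.1 l, ω.1.2 l)) (fun ω => ω.2.2.2)
  rw [SlottedCode.leakage, SlottedCode.leakage, ← h, hj]
  exact (mutualInfo_comp_injective
    (fun ω => C.joint ch (k + 1) (relabelEquiv X₁ X₂ Y Z n e₁ e₂ (k + 1) ω))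
    (fun ω => (ω.1.1 l, ω.1.2 l)) (fun ω => ω.2.2.2)
    ((e₁ l).injective.prodMap (e₂ l).injective) Function.injective_id).symm

/-- A family of bit strings as one bit string. -/
def bitsEquiv (r a : ℕ) : Bits (r * a) ≃ (Fin r → Bits a) :=
  (Equiv.arrowCongr finProdFinEquiv.symm (Equiv.refl _)).trans (Equiv.curry _ _ _)

theorem Channel.AchievableByKeys.achievable {R : ℝ × ℝ} (h : ch.AchievableByKeys R) :
    ch.Achievable R := by
  obtain ⟨h₁, h₂, h⟩ := h
  refine ⟨h₁, h₂, fun ε hε => ?_⟩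
  obtain ⟨S, herr, hleak, k₀, hk₀⟩ := h ε hε
  refine ⟨fun n => (S n).user₁.bits, fun n => (S n).user₂.bits,
    fun n => (S n).code.relabel (fun k => bitsEquiv _ _) fun k => bitsEquiv _ _, fun k => ?_, ?_,
    k₀, hk₀⟩
  · exact (herr k).congr fun n => ((S n).code.relabel_errorProb ch _ _ k).symm
  · filter_upwards [hleak] with n hn k l
    exact ((S n).code.relabel_leakage ch _ _ k l).trans_le (hn k l)

end Relabel

/-! ### The regions -/

section Regions

variable {X₁ X₂ Y Z : Type*} [Fintype X₁] [Fintype X₂] [Fintype Y] [Fintype Z]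
  (ch : Channel X₁ X₂ Y Z)

theorem Channel.keyRegion_subset_secrecyRegion : ch.keyRegion ⊆ ch.secrecyRegion :=
  closure_mono (convexHull_mono fun _ h => Channel.AchievableByKeys.achievable ch h)

theorem Channel.PositiveSecrecy.macRegion_subset_keyRegion (h : ch.PositiveSecrecy) :
    ch.macRegion ⊆ ch.keyRegion :=
  closure_mono (convexHull_mono fun _ ⟨hR₁, hR₂, _, hp₁, _, hp₂, h₁, h₂, h₃⟩ =>
    Channel.PositiveSecrecy.achievableByKeys ch h hp₁ hp₂ hR₁ hR₂ h₁ h₂ h₃)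

end Regions

end MACWT

theorem theorem2 {X₁ X₂ Y Z : Type*} [Fintype X₁] [Fintype X₂] [Fintype Y] [Fintype Z]
    (ch : MACWT.Channel X₁ X₂ Y Z)
    (hpos : ch.PositiveSingleLetter ∨ ch.PositiveSecrecy) :
    ch.keyRegion = ch.macRegion ∧ ch.secrecyRegion = ch.macRegion := by
  have hsec : ch.PositiveSecrecy := hpos.elim (MACWT.Channel.PositiveSingleLetter.positiveSecrecy ch) id
  have mac_key := MACWT.Channel.PositiveSecrecy.macRegion_subset_keyRegion ch hsec
  have key_sec := ch.keyRegion_subset_secrecyRegion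
  have sec_mac := ch.secrecyRegion_subset (MACWT.Channel.PositiveSecrecy.bothPositive ch hsec)
  exact ⟨(key_sec.trans sec_mac).antisymm mac_key, sec_mac.antisymm (mac_key.trans key_sec)⟩
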